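/- Let $\Sigma$ be a finite alphabet and $\Xi$ a countably infinite set of variables disjoint from $\Sigma$. An *FC-Datalog program* $P=(\mathfrak u,\mathcal R,\Phi)$ consists of a universe variable $\mathfrak u\in\Xi$, a finite set $\mathcal R$ of relation symbols with arities that contains a distinguished symbol $\mathrm{Ans}$, and a finite set $\Phi$ of rules $R(x_1,\dots,x_{\mathrm{ar}(R)})\leftarrow\varphi_1,\dots,\varphi_m$ with $m\ge 1$, where every atom $\varphi_i$ is either a pattern equation $x\doteq\alpha$ with $x\in\Xi$, $\alpha\in(\Sigma\cup\Xi)^*$, or a relation atom $R'(y_1,\dots,y_{\mathrm{ar}(R')})$ with $R'\in\mathcal R$ and $y_j\in\Xi$, and where every head variable $x_j$ occurs in some $\varphi_i$. For a word $w\in\Sigma^*$, a *$w$-substitution* for a rule $\rho$ is a homomorphism $\theta$ that fixes the letters of $\Sigma$, with $\theta(\mathfrak u)=w$ and with $\theta(x)$ a factor of $w$ for every variable $x$ in the body of $\rho$. A pattern equation $x\doteq\alpha$ holds under $\theta$ if $\theta(x)=\theta(\alpha)$ and this word is a factor of $w$. Starting with all relations empty, one adds $(\theta(x_1),\dots,\theta(x_{\mathrm{ar}(R)}))$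 to $R$ whenever $\theta$ is a $w$-substitution under which all body atoms of a rule with head $R(x_1,\dots,x_{\mathrm{ar}(R)})$ hold, until nothing changes. $P$ is *Boolean* if $\mathrm{ar}(\mathrm{Ans})=0$; then $\mathcal L(P)$ is the set of all $w\in\Sigma^*$ for which $()$ is finally in $\mathrm{Ans}$. Write $R\leftarrow R'$ if some rule has head symbol $R$ and has $R'$ in its body; $R$ and $R'$ are *mutually recursive* if $R\leftarrow^+R'$ and $R'\leftarrow^+R$, where $\leftarrow^+$ is the transitive closure. $P$ is *linear* if the body of every rule contains at most one atom whose relation symbol is mutually recursive with the head symbol of the rule. For a rule $\rho$ with head $R(x_1,\dots,x_m)$ of a linear program, let $\mathsf{top}(\rho)=(x_1,\dots,x_m,\mathfrak u)$, and let $\mathsf{bottom}(\rho)$ be the tuple of arguments of the body atom whose symbol is mutually recursive with $R$ (the empty tuple if there is no such atom). For an input word $w$, let $W_\rho$ be the set of all pairs $(\theta(\mathsf{top}(\rho)),\theta(\mathsf{bottom}(\rho)))$ where $\theta$ is a $w$-substitution for $\rho$ under which all pattern equations of $\rho$ hold. $P$ is *locally deterministic* if for every $w\in\Sigma^*$ and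 every $\rho\in\Phi$ the relation $W_\rho$ is a partial function. $P$ is *globally deterministic* if for every $w\in\Sigma^*$ and all distinct rules $\rho,\chi\in\Phi$ with the same head symbol there are no $\vec t,\vec t\,',\vec t\,''$ with $(\vec t,\vec t\,')\in W_\rho$ and $(\vec t,\vec t\,'')\in W_\chi$. *Deterministic linear FC-Datalog* is the set of all linear FC-Datalog programs that are both locally and globally deterministic. **Theorem.** Deterministic linear FC-Datalog captures $\mathsf{LOGSPACE}$. That is, for every finite alphabet $\Sigma$, a language $L\subseteq\Sigma^*$ is decided by a deterministic Turing machine with a read-only input tape and $O(\log n)$ work space on inputs of length $n$ if and only if $L=\mathcal L(P)$ for some Boolean deterministic linear FC-Datalog program $P$ over $\Sigma$. -/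

import Mathlib

universe u

/-! ### FC-Datalog: syntax -/

namespace FCDatalog

/-- Variables: a fixed countably infinite set. -/
abbrev Var : Type := ℕ

/-- A pattern over the terminal alphabet `A`: a word over the disjoint union of terminals and
variables. -/
abbrev Pattern (A : Type u) : Type u := List (A ⊕ Var)

/-- The variables occurring in a pattern. -/
def Pattern.vars {A : Type u} (α : Pattern A) : Set Var := {x | Sum.inr x ∈ α}

/-- Image of a symbol under the homomorphism that fixes the terminals and maps each variable `x`
to the word `θ x`. -/
def symbolImage {A : Type u} (θ : Var → List A) : A ⊕ Var → List A
  | Sum.inl a => [a]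
  | Sum.inr x => θ x

/-- Image of a pattern under the homomorphism given by `θ`. -/
def Pattern.image {A : Type u} (θ : Var → List A) (α : Pattern A) : List A :=
  α.flatMap (symbolImage θ)

/-- An atom is a pattern equation `x ≐ α` or a relation atom `R(y₁, …, yₙ)`. -/
inductive Atom (A : Type u) (Rel : Type) : Type u
  | eqn (x : Var) (α : Pattern A) : Atom A Rel
  | rel (R : Rel) (ys : List Var) : Atom A Rel

/-- The variables of an atom. -/
def Atom.vars {A : Type u} {Rel : Type} : Atom A Rel → Set Var
  | Atom.eqn x α => {x} ∪ α.vars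
  | Atom.rel _ ys => {y | y ∈ ys}

/-- The number of arguments of a relation atom is the arity of its relation symbol. -/
def Atom.RespectsArity {A : Type u} {Rel : Type} (ar : Rel → ℕ) : Atom A Rel → Prop
  | Atom.eqn _ _ => True
  | Atom.rel R ys => ys.length = ar R

/-- A rule `R(x₁, …, xₙ) ← φ₁, …, φₘ`. -/
structure Rule (A : Type u) (Rel : Type) : Type u where
  head : Rel
  args : List Var
  body : List (Atom A Rel)

/-- The variables occurring in the body of a rule. -/
def Rule.vars {A : Type u} {Rel : Type} (ρ : Rule A Rel) : Set Var :=
  {x | ∃ φ ∈ ρ.body, x ∈ φ.vars}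

/-- A rule is well formed if all arities are respected, its body is nonempty, and every variable
of the head occurs in the body. -/
structure Rule.WellFormed {A : Type u} {Rel : Type} (ar : Rel → ℕ) (ρ : Rule A Rel) : Prop where
  head_arity : ρ.args.length = ar ρ.head
  body_arity : ∀ φ ∈ ρ.body, φ.RespectsArity ar
  body_ne_nil : ρ.body ≠ []
  safe : ∀ x ∈ ρ.args, x ∈ ρ.vars

/-- An FC-Datalog program: a universe variable, a finite set of relation symbols with arities that
contains the output symbol `Ans`, and a finite set of rules. -/
structure Program (A : Type u) : Type (max u 1) where
  univVar : Var
  Rel : Type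
  finiteRel : Finite Rel
  ar : Rel → ℕ
  Ans : Rel
  rules : Finset (Rule A Rel)
  wellFormed : ∀ ρ ∈ rules, ρ.WellFormed ar

/-- A program is Boolean if the output relation symbol has arity `0`. -/
def Program.IsBoolean {A : Type u} (P : Program A) : Prop := P.ar P.Ans = 0

/-! ### FC-Datalog: fixed-point semantics -/

/-- A set of facts `R(u₁, …, uₙ)`, that is, an interpretation of all relation symbols. -/
abbrev Facts (A : Type u) (Rel : Type) : Type u := Set (Rel × List (List A))

/-- `(w, θ) ⊨ φ`, where relation symbols are interpreted by `I`. (`u <:+: w` says that `u` is a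
factor of `w`.) -/
def Atom.Sat {A : Type u} {Rel : Type} (w : List A) (θ : Var → List A) (I : Facts A Rel) :
    Atom A Rel → Prop
  | Atom.eqn x α => θ x = α.image θ ∧ θ x <:+: w ∧ α.image θ <:+: w
  | Atom.rel R ys => (R, ys.map θ) ∈ I ∧ ∀ y ∈ ys, θ y <:+: w

/-- `θ` is a `w`-substitution for the rule `ρ`: the universe variable is mapped to `w` and every
variable of the rule to a factor of `w`. Values at other variables are irrelevant. -/
def Program.IsWSubst {A : Type u} (P : Program A) (ρ : Rule A P.Rel) (w : List A)
    (θ : Var → List A) : Prop :=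
  θ P.univVar = w ∧ ∀ x ∈ ρ.vars, θ x <:+: w

/-- One round of evaluation: add every fact that some rule yields from the facts in `I`. -/
def Program.round {A : Type u} (P : Program A) (w : List A) (I : Facts A P.Rel) :
    Facts A P.Rel :=
  I ∪ {f | ∃ ρ ∈ P.rules, ∃ θ : Var → List A, P.IsWSubst ρ w θ ∧
    (∀ φ ∈ ρ.body, φ.Sat w θ I) ∧ f = (ρ.head, ρ.args.map θ)}

/-- The facts obtained after `n` rounds, starting with empty relations. -/
def Program.stage {A : Type u} (P : Program A) (w : List A) (n : ℕ) : Facts A P.Rel :=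
  (P.round w)^[n] ∅

/-- The set of all facts derived by the program on the input word `w`. -/
def Program.facts {A : Type u} (P : Program A) (w : List A) : Facts A P.Rel :=
  {f | ∃ n, f ∈ P.stage w n}

/-- `⟦P⟧(w)`: the content of the output relation. -/
def Program.result {A : Type u} (P : Program A) (w : List A) : Set (List (List A)) :=
  {t | (P.Ans, t) ∈ P.facts w}

/-- The language of a (Boolean) program: the words for which the output relation contains the
empty tuple. -/
def Program.language {A : Type u} (P : Program A) : Language A :=
  {w | [] ∈ P.result w}

/-! ### Linear programs -/

/-- `R ← R'`: some rule has head symbol `R` and an atom with symbol `R'` in its body. -/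
def Program.DependsOn {A : Type u} (P : Program A) (R R' : P.Rel) : Prop :=
  ∃ ρ ∈ P.rules, ρ.head = R ∧ ∃ ys, Atom.rel R' ys ∈ ρ.body

/-- Mutual recursion of relation symbols. -/
def Program.MutuallyRecursive {A : Type u} (P : Program A) (R R' : P.Rel) : Prop :=
  Relation.TransGen P.DependsOn R R' ∧ Relation.TransGen P.DependsOn R' R

/-- `φ` is a relation atom whose symbol is mutually recursive with `R`. -/
def Program.IsRecursiveAtom {A : Type u} (P : Program A) (R : P.Rel) : Atom A P.Rel → Prop
  | Atom.eqn _ _ => False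
  | Atom.rel R' _ => P.MutuallyRecursive R R'

open Classical in
/-- The atoms in the body of `ρ` whose symbol is mutually recursive with the head symbol. -/
noncomputable def Program.recursiveAtoms {A : Type u} (P : Program A) (ρ : Rule A P.Rel) :
    List (Atom A P.Rel) :=
  ρ.body.filter (fun φ => decide (P.IsRecursiveAtom ρ.head φ))

/-- In every rule at most one body atom has a symbol that is mutually recursive with the head
symbol. -/
def Program.IsLinear {A : Type u} (P : Program A) : Prop :=
  ∀ ρ ∈ P.rules, (P.recursiveAtoms ρ).length ≤ 1

/-! ### Deterministic linear programs -/

/-- The tuple of arguments of a relation atom. -/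
def Atom.argList {A : Type u} {Rel : Type} : Atom A Rel → List Var
  | Atom.eqn _ _ => []
  | Atom.rel _ ys => ys

/-- Top variables of a rule: the arguments of the head, followed by the universe variable. -/
def Program.top {A : Type u} (P : Program A) (ρ : Rule A P.Rel) : List Var :=
  ρ.args ++ [P.univVar]

/-- Bottom variables of a rule of a linear program: the arguments of the (at most one) body atom
whose symbol is mutually recursive with the head symbol; the empty tuple if there is none. -/
noncomputable def Program.bottom {A : Type u} (P : Program A) (ρ : Rule A P.Rel) : List Var :=
  (P.recursiveAtoms ρ).flatMap Atom.argList

/-- `(w, θ) ⊨ pe(ρ)`: all pattern equations in the body of `ρ` hold. -/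
def Rule.SatEqns {A : Type u} {Rel : Type} (ρ : Rule A Rel) (w : List A) (θ : Var → List A) :
    Prop :=
  ∀ x α, Atom.eqn x α ∈ ρ.body → (Atom.eqn x α : Atom A Rel).Sat w θ ∅

/-- The relation `W_ρ` between top tuples and bottom tuples, for the input word `w`. -/
def Program.W {A : Type u} (P : Program A) (w : List A) (ρ : Rule A P.Rel) :
    Set (List (List A) × List (List A)) :=
  {p | ∃ θ : Var → List A, P.IsWSubst ρ w θ ∧ ρ.SatEqns w θ ∧
    p = ((P.top ρ).map θ, (P.bottom ρ).map θ)}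

/-- For each rule and input word, the relation `W_ρ` is a partial function. -/
def Program.LocallyDeterministic {A : Type u} (P : Program A) : Prop :=
  ∀ w : List A, ∀ ρ ∈ P.rules, ∀ t b b', (t, b) ∈ P.W w ρ → (t, b') ∈ P.W w ρ → b = b'

/-- No top tuple fits two distinct rules with the same head symbol. -/
def Program.GloballyDeterministic {A : Type u} (P : Program A) : Prop :=
  ∀ w : List A, ∀ ρ ∈ P.rules, ∀ χ ∈ P.rules, ρ.head = χ.head → ρ ≠ χ →
    ¬ ∃ t b b', (t, b) ∈ P.W w ρ ∧ (t, b') ∈ P.W w χ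

/-- Deterministic linear FC-Datalog over the terminal alphabet `A`. -/
def deterministicLinear (A : Type u) : Set (Program A) :=
  {P | P.IsLinear ∧ P.LocallyDeterministic ∧ P.GloballyDeterministic}

/-- A fragment `F` captures a class `C` of languages if `C` consists exactly of the languages of
the (Boolean) programs in `F`. -/
def Captures {A : Type u} (F : Set (Program A)) (C : Set (Language A)) : Prop :=
  C = {L | ∃ P ∈ F, P.IsBoolean ∧ P.language = L}

end FCDatalog

/-! ### Deterministic logarithmic space -/

namespace SpaceComplexity

/-- Head movements. -/
inductive Move : Type
  | left | stay | right

/-- A head movement on a one-way infinite tape; moving left from cell `0` has no effect. -/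
def Move.apply : Move → ℕ → ℕ
  | Move.left, i => i - 1
  | Move.stay, i => i
  | Move.right, i => i + 1

/-- Symbols on the input tape: the letters and two endmarkers. -/
inductive InputSymbol (A : Type u) : Type u
  | leftEnd : InputSymbol A
  | letter (a : A) : InputSymbol A
  | rightEnd : InputSymbol A

/-- The input tape holds the left endmarker, the word `w`, and the right endmarker, in the cells
`0, 1, …, |w|, |w| + 1`. -/
def inputAt {A : Type u} (w : List A) : ℕ → InputSymbol A
  | 0 => InputSymbol.leftEnd
  | i + 1 => match w[i]? with
    | some a => InputSymbol.letter a
    | none => InputSymbol.rightEnd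

/-- A deterministic Turing machine with a two-way read-only input tape and finitely many
read/write work tapes. The transition function yields the new state, the movement of the input
head, and for each work tape the symbol to write and the movement of the head; the machine halts
if the value is `none`. -/
structure Machine (A : Type u) : Type (max u 1) where
  numTapes : ℕ
  State : Type
  finiteState : Finite State
  Symbol : Type
  finiteSymbol : Finite Symbol
  blank : Symbol
  start : State
  accept : Set State
  trans : State → InputSymbol A → (Fin numTapes → Symbol) →
    Option (State × Move × (Fin numTapes → Symbol × Move))

/-- Configurations: state, position of the input head, contents of the (one-way infinite) work
tapes, and positions of the work heads. -/
structure Cfg {A : Type u} (M : Machine A) : Type where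
  state : M.State
  inputHead : ℕ
  tape : Fin M.numTapes → ℕ → M.Symbol
  head : Fin M.numTapes → ℕ

/-- The initial configuration: blank work tapes and all heads on the leftmost cells. -/
def Machine.init {A : Type u} (M : Machine A) : Cfg M where
  state := M.start
  inputHead := 0
  tape := fun _ _ => M.blank
  head := fun _ => 0

/-- One computation step on input `w`; `none` if the machine has halted. The input head cannot
leave the cells `0, …, |w| + 1`. -/
def Machine.step {A : Type u} (M : Machine A) (w : List A) (c : Cfg M) : Option (Cfg M) :=
  (M.trans c.state (inputAt w c.inputHead) (fun i => c.tape i (c.head i))).map fun r =>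
    { state := r.1
      inputHead := min (r.2.1.apply c.inputHead) (w.length + 1)
      tape := fun i => Function.update (c.tape i) (c.head i) (r.2.2 i).1
      head := fun i => (r.2.2 i).2.apply (c.head i) }

/-- `c` occurs in the computation of `M` on input `w`. -/
def Machine.Reaches {A : Type u} (M : Machine A) (w : List A) (c : Cfg M) : Prop :=
  Relation.ReflTransGen (fun c₁ c₂ => M.step w c₁ = some c₂) M.init c

/-- `M` halts on every input, and it halts in an accepting state exactly on the words of `L`. -/
def Machine.Decides {A : Type u} (M : Machine A) (L : Language A) : Prop :=
  ∀ w : List A, ∃ c, M.Reaches w c ∧ M.step w c = none ∧ (c.state ∈ M.accept ↔ w ∈ L)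

/-- On every input of length `n`, the machine visits only the first `s n` cells of each of its
work tapes. -/
def Machine.RunsInSpace {A : Type u} (M : Machine A) (s : ℕ → ℕ) : Prop :=
  ∀ (w : List A) (c : Cfg M), M.Reaches w c → ∀ i, c.head i < s w.length

/-- `LOGSPACE`: the languages over `A` that are decided by a deterministic Turing machine whose
work space is at most a constant times `log₂ n + 1`. -/
def LOGSPACE (A : Type u) : Set (Language A) :=
  {L | ∃ (M : Machine A) (C : ℕ), M.Decides L ∧ M.RunsInSpace fun n => C * (Nat.log 2 n + 1)}

end SpaceComplexity

/-! Both inclusions pass through one intermediate model: while programs with a finite control and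
finitely many registers holding numbers up to `n = |w|`, which can read the letter at the position
stored in a register (`CounterDecidable`). A register value is a position of `w`: it costs `O(log
n)` bits on a work tape, and, read as a prefix of `w`, it is a possible value of an FC-Datalog
variable.

Counter programs and `LOGSPACE`. A counter program runs on a Turing machine with one binary counter
per work tape (`CounterDecidable.mem_logspace`). Conversely, a work tape with `C * (log₂ n + 1)`
cells over `g` symbols is cut at the head into two stacks; written in base `g + 1`, these are
numbers polynomial in `n` (`pow_log_bound`), and such a number is a fixed count of digits in base `n
+ 1` (`exists_digitRun`).

From counter programs to Datalog (`CounterDecidable.exists_datalog`). There is one relation symbol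
per control point, with the registers as arguments. A computation step from `q` to `q'` becomes a
rule with head `q` and recursive atom `q'`, guarded by pattern equations. A fact thus says that an
accepting halt is reachable from a configuration, and facts are derived backwards along the
computation. The guards leaving a control point are mutually exclusive and determine the new
registers, which gives both kinds of determinism.

From Datalog to counter programs (`decFacts`). Suppose that the facts of all strictly lower
components of the dependency graph are decidable. By linearity, the derivation of a fact is then a
path of recursive calls that ends in a rule without such a call (`mem_facts_iff`). By local and
global determinism the next fact on the path is unique (`Leads.unique`). Facts consist of factors of
`w`, given by pairs of positions, so there are polynomially many codes. The path is followed with a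
clock that ticks once per code; if no end is met by then, none ever is (`Dec.dtc`). -/

/-! ### While programs over abstract actions and tests -/

namespace Logspace

/-- While programs with actions `α` and tests `β`. -/
inductive Prog (α β : Type) : Type
  | skip : Prog α β
  | act (a : α) : Prog α β
  | seq (p q : Prog α β) : Prog α β
  | ite (t : β) (p q : Prog α β) : Prog α β
  | loop (t : β) (p : Prog α β) : Prog α β

/-- An interpretation of actions and tests on stores. -/
structure Sem (α β S : Type) where
  act : α → S → S → Prop
  test : β → S → Prop

/-- Big-step semantics. -/
inductive Sem.Run {α β S : Type} (M : Sem α β S) : Prog α β → S → S → Prop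
  | skip (s : S) : M.Run .skip s s
  | act {a : α} {s s' : S} : M.act a s s' → M.Run (.act a) s s'
  | seq {p q : Prog α β} {s s' s'' : S} : M.Run p s s' → M.Run q s' s'' → M.Run (.seq p q) s s''
  | iteTrue {t : β} {p q : Prog α β} {s s' : S} :
      M.test t s → M.Run p s s' → M.Run (.ite t p q) s s'
  | iteFalse {t : β} {p q : Prog α β} {s s' : S} :
      ¬ M.test t s → M.Run q s s' → M.Run (.ite t p q) s s'
  | loopTrue {t : β} {p : Prog α β} {s s' s'' : S} :
      M.test t s → M.Run p s s' → M.Run (.loop t p) s' s'' → M.Run (.loop t p) s s''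
  | loopFalse {t : β} {p : Prog α β} {s : S} : ¬ M.test t s → M.Run (.loop t p) s s

/-- Small-step semantics on pairs of a continuation and a store. -/
inductive Sem.Small {α β S : Type} (M : Sem α β S) :
    List (Prog α β) × S → List (Prog α β) × S → Prop
  | skip {k : List (Prog α β)} {s : S} : M.Small (.skip :: k, s) (k, s)
  | act {k : List (Prog α β)} {a : α} {s s' : S} : M.act a s s' → M.Small (.act a :: k, s) (k, s')
  | seq {k : List (Prog α β)} {p q : Prog α β} {s : S} :
      M.Small (.seq p q :: k, s) (p :: q :: k, s)
  | iteTrue {k : List (Prog α β)} {t : β} {p q : Prog α β} {s : S} :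
      M.test t s → M.Small (.ite t p q :: k, s) (p :: k, s)
  | iteFalse {k : List (Prog α β)} {t : β} {p q : Prog α β} {s : S} :
      ¬ M.test t s → M.Small (.ite t p q :: k, s) (q :: k, s)
  | loopTrue {k : List (Prog α β)} {t : β} {p : Prog α β} {s : S} :
      M.test t s → M.Small (.loop t p :: k, s) (p :: .loop t p :: k, s)
  | loopFalse {k : List (Prog α β)} {t : β} {p : Prog α β} {s : S} :
      ¬ M.test t s → M.Small (.loop t p :: k, s) (k, s)

/-- A run never inspects the continuation beneath it, so runs of subprograms can be composed under
an arbitrary `k`. -/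
theorem Sem.Run.small {α β S : Type} {M : Sem α β S} {p : Prog α β} {s s' : S}
    (h : M.Run p s s') (k : List (Prog α β)) :
    Relation.ReflTransGen M.Small (p :: k, s) (k, s') := by
  induction h generalizing k with
  | skip s => exact .single .skip
  | act h => exact .single (.act h)
  | seq _ _ ih₁ ih₂ => exact .head .seq ((ih₁ _).trans (ih₂ _))
  | iteTrue h _ ih => exact .head (.iteTrue h) (ih _)
  | iteFalse h _ ih => exact .head (.iteFalse h) (ih _)
  | loopTrue h _ _ ih₁ ih₂ => exact .head (.loopTrue h) ((ih₁ _).trans (ih₂ _))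
  | loopFalse h => exact .single (.loopFalse h)

/-- The continuations that can occur while `p` is executed with continuation `k`. -/
def Prog.conts {α β : Type} : Prog α β → List (Prog α β) → Set (List (Prog α β))
  | .skip, k => {.skip :: k, k}
  | .act a, k => {.act a :: k, k}
  | .seq p q, k => {.seq p q :: k} ∪ (p.conts (q :: k) ∪ q.conts k)
  | .ite t p q, k => {.ite t p q :: k} ∪ (p.conts k ∪ q.conts k)
  | .loop t p, k => {.loop t p :: k, k} ∪ p.conts (.loop t p :: k)

theorem Prog.conts_finite {α β : Type} (p : Prog α β) (k : List (Prog α β)) :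
    (p.conts k).Finite := by
  induction p generalizing k with
  | skip => exact Set.toFinite {_, _}
  | act a => exact Set.toFinite {_, _}
  | seq p q ihp ihq => exact (Set.toFinite _).union ((ihp _).union (ihq _))
  | ite t p q ihp ihq => exact (Set.toFinite _).union ((ihp _).union (ihq _))
  | loop t p ih => exact (Set.toFinite _).union (ih _)

theorem Prog.self_mem_conts {α β : Type} (p : Prog α β) (k : List (Prog α β)) :
    p :: k ∈ p.conts k := by
  cases p <;> simp [Prog.conts]

/-- The continuations that can follow a given one. -/
inductive Next {α β : Type} : List (Prog α β) → List (Prog α β) → Prop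
  | skip {k} : Next (.skip :: k) k
  | act {a k} : Next (.act a :: k) k
  | seq {p q k} : Next (.seq p q :: k) (p :: q :: k)
  | iteTrue {t p q k} : Next (.ite t p q :: k) (p :: k)
  | iteFalse {t p q k} : Next (.ite t p q :: k) (q :: k)
  | loopTrue {t p k} : Next (.loop t p :: k) (p :: .loop t p :: k)
  | loopFalse {t p k} : Next (.loop t p :: k) k

/-- The set is left only by executing `k` itself, which `hk` excludes. The end point `q :: k` of the
first half of a sequence is the initial point of the second half, and a finished loop body returns
to the loop. For `k = []` nothing can follow `k`, so the finite set is closed and can serve as the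
control of a machine. -/
theorem Prog.conts_next {α β : Type} (p : Prog α β) (k l l' : List (Prog α β))
    (hl : l ∈ p.conts k) (h : Next l l') (hk : l ≠ k) : l' ∈ p.conts k := by
  induction p generalizing k with
  | skip =>
    rcases hl with rfl | rfl
    · cases h; simp [Prog.conts]
    · exact absurd rfl hk
  | act a =>
    rcases hl with rfl | rfl
    · cases h; simp [Prog.conts]
    · exact absurd rfl hk
  | seq p q ihp ihq =>
    rcases hl with rfl | hl | hl
    · cases h
      exact .inr (.inl (p.self_mem_conts _))
    · by_cases hq : l = q :: k
      · subst hq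
        exact .inr (.inr (ihq k (q.self_mem_conts _) hk))
      · exact .inr (.inl (ihp _ hl hq))
    · exact .inr (.inr (ihq _ hl hk))
  | ite t p q ihp ihq =>
    rcases hl with rfl | hl | hl
    · cases h
      · exact .inr (.inl (p.self_mem_conts _))
      · exact .inr (.inr (q.self_mem_conts _))
    · exact .inr (.inl (ihp _ hl hk))
    · exact .inr (.inr (ihq _ hl hk))
  | loop t p ih =>
    rcases hl with (rfl | rfl) | hl
    · cases h
      · exact .inr (p.self_mem_conts _)
      · exact .inl (.inr rfl)
    · exact absurd rfl hk
    · by_cases hq : l = .loop t p :: k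
      · subst hq
        cases h
        · exact .inr (p.self_mem_conts _)
        · exact .inl (.inr rfl)
      · exact .inr (ih _ hl hq)

theorem Prog.conts_nil_next {α β : Type} (p : Prog α β) {l l' : List (Prog α β)}
    (hl : l ∈ p.conts []) (h : Next l l') : l' ∈ p.conts [] :=
  p.conts_next [] l l' hl h (by rintro rfl; cases h)

/-! ### Simulation of while programs -/

/-- All actions of a program satisfy `P` and all its tests satisfy `Q`. -/
def Prog.Forall {α β : Type} (P : α → Prop) (Q : β → Prop) : Prog α β → Prop
  | .skip => True
  | .act a => P a
  | .seq p q => p.Forall P Q ∧ q.Forall P Q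
  | .ite t p q => Q t ∧ p.Forall P Q ∧ q.Forall P Q
  | .loop t p => Q t ∧ p.Forall P Q

theorem Prog.forall_of {α β : Type} {P : α → Prop} {Q : β → Prop} (hP : ∀ a, P a) (hQ : ∀ t, Q t)
    (p : Prog α β) : p.Forall P Q := by
  induction p with
  | skip => trivial
  | act a => exact hP a
  | seq p q ihp ihq => exact ⟨ihp, ihq⟩
  | ite t p q ihp ihq => exact ⟨hQ t, ihp, ihq⟩
  | loop t p ih => exact ⟨hQ t, ih⟩

/-- Replace every action by a program, and every test by a program followed by a test. -/
def Prog.bind {α β α' β' : Type} (f : α → Prog α' β') (pre : β → Prog α' β') (g : β → β') :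
    Prog α β → Prog α' β'
  | .skip => .skip
  | .act a => f a
  | .seq p q => .seq (p.bind f pre g) (q.bind f pre g)
  | .ite t p q => .seq (pre t) (.ite (g t) (p.bind f pre g) (q.bind f pre g))
  | .loop t p => .seq (pre t) (.loop (g t) (.seq (p.bind f pre g) (pre t)))

/-- Forward simulation along `R`; one simulating run is enough, since the verdict is read off its
final store. A loop test is prepared before the loop and again at the end of each round, so the loop
case carries the additional invariant that the prepared test agrees with the original one. The outer
induction is on the program, the inner one on the run of the loop. -/
theorem Sem.Run.bind {α β S α' β' S' : Type} {M : Sem α β S} {M' : Sem α' β' S'}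
    {f : α → Prog α' β'} {pre : β → Prog α' β'} {g : β → β'} {P : α → Prop} {Q : β → Prop}
    (R : S → S' → Prop)
    (hact : ∀ a, P a → ∀ s s' u, M.act a s s' → R s u → ∃ u', M'.Run (f a) u u' ∧ R s' u')
    (hpre : ∀ t, Q t → ∀ s u, R s u →
      ∃ u', M'.Run (pre t) u u' ∧ R s u' ∧ (M'.test (g t) u' ↔ M.test t s))
    (p : Prog α β) (hp : p.Forall P Q) {s s' : S} (h : M.Run p s s') {u : S'} (hu : R s u) :
    ∃ u', M'.Run (p.bind f pre g) u u' ∧ R s' u' := by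
  induction p generalizing s s' u with
  | skip =>
    cases h
    exact ⟨u, .skip u, hu⟩
  | act a =>
    cases h with
    | act h => exact hact a hp _ _ _ h hu
  | seq p q ihp ihq =>
    cases h with
    | seq h₁ h₂ =>
      obtain ⟨u₁, hr₁, hu₁⟩ := ihp hp.1 h₁ hu
      obtain ⟨u₂, hr₂, hu₂⟩ := ihq hp.2 h₂ hu₁
      exact ⟨u₂, .seq hr₁ hr₂, hu₂⟩
  | ite t p q ihp ihq =>
    obtain ⟨u₁, hr₁, hu₁, ht⟩ := hpre t hp.1 s u hu
    cases h with
    | iteTrue h hr =>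
      obtain ⟨u₂, hr₂, hu₂⟩ := ihp hp.2.1 hr hu₁
      exact ⟨u₂, .seq hr₁ (.iteTrue (ht.2 h) hr₂), hu₂⟩
    | iteFalse h hr =>
      obtain ⟨u₂, hr₂, hu₂⟩ := ihq hp.2.2 hr hu₁
      exact ⟨u₂, .seq hr₁ (.iteFalse (fun h' => h (ht.1 h')) hr₂), hu₂⟩
  | loop t p ih =>
    have key : ∀ s s' u, M.Run (.loop t p) s s' → R s u → (M'.test (g t) u ↔ M.test t s) →
        ∃ u', M'.Run (.loop (g t) (.seq (p.bind f pre g) (pre t))) u u' ∧ R s' u' := by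
      clear h hu
      intro s s' u h hu ht
      generalize hq : Prog.loop t p = q at h
      induction h generalizing u with
      | loopTrue h hr _ _ ih₂ =>
        cases hq
        obtain ⟨u₁, hr₁, hu₁⟩ := ih hp.2 hr hu
        obtain ⟨u₂, hr₂, hu₂, ht₂⟩ := hpre t hp.1 _ _ hu₁
        obtain ⟨u₃, hr₃, hu₃⟩ := ih₂ u₂ hu₂ ht₂ rfl
        exact ⟨u₃, .loopTrue (ht.2 h) (.seq hr₁ hr₂) hr₃, hu₃⟩
      | loopFalse h =>
        cases hq
        exact ⟨u, .loopFalse (fun h' => h (ht.1 h')), hu⟩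
      | _ => cases hq
    obtain ⟨u₁, hr₁, hu₁, ht⟩ := hpre t hp.1 s u hu
    obtain ⟨u₂, hr₂, hu₂⟩ := key s s' u₁ h hu₁ ht
    exact ⟨u₂, .seq hr₁ hr₂, hu₂⟩

/-! ### Counter programs -/

/-- Actions on registers `ι` and on a control value of type `F`. The action `read i g` updates the
control value using the letter of the input word at the position stored in register `i`. -/
inductive Act (ι F : Type) (m : ℕ) : Type
  | inc (i : ι) : Act ι F m
  | dec (i : ι) : Act ι F m
  | upd (g : F → F) : Act ι F m
  | read (i : ι) (g : F → Option (Fin m) → F) : Act ι F m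

/-- Tests on registers and on the control value. -/
inductive Tst (ι F : Type) : Type
  | pos (i : ι) : Tst ι F
  | flag (b : F → Prop) : Tst ι F

/-- Stores of counter programs. -/
structure Store (ι F : Type) : Type where
  ctl : F
  reg : ι → ℕ

/-- Semantics of actions on the input word `x`, with registers bounded by `B`. -/
inductive ActStep {ι F : Type} [DecidableEq ι] {m : ℕ} (B : ℕ) (x : List (Fin m)) :
    Act ι F m → Store ι F → Store ι F → Prop
  | inc {i : ι} {s : Store ι F} : s.reg i < B →
      ActStep B x (.inc i) s ⟨s.ctl, Function.update s.reg i (s.reg i + 1)⟩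
  | dec {i : ι} {s : Store ι F} : 0 < s.reg i →
      ActStep B x (.dec i) s ⟨s.ctl, Function.update s.reg i (s.reg i - 1)⟩
  | upd {g : F → F} {s : Store ι F} : ActStep B x (.upd g) s ⟨g s.ctl, s.reg⟩
  | read {i : ι} {g : F → Option (Fin m) → F} {s : Store ι F} : s.reg i ≤ x.length →
      ActStep B x (.read i g) s ⟨g s.ctl x[s.reg i]?, s.reg⟩

/-- Semantics of tests. -/
def Tst.Holds {ι F : Type} : Tst ι F → Store ι F → Prop
  | .pos i, s => s.reg i ≠ 0
  | .flag b, s => b s.ctl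

/-- Semantics of counter programs on the input word `x`, with registers bounded by `B`. -/
def sem {ι F : Type} [DecidableEq ι] {m : ℕ} (B : ℕ) (x : List (Fin m)) :
    Sem (Act ι F m) (Tst ι F) (Store ι F) where
  act := ActStep B x
  test := Tst.Holds

/-- Counter programs. -/
abbrev CProg (ι F : Type) (m : ℕ) : Type := Prog (Act ι F m) (Tst ι F)

/-- `L` is decided by a counter program whose registers are bounded by the length of the input. -/
def CounterDecidable {A : Type*} {m : ℕ} (e : A ≃ Fin m) (L : Language A) : Prop :=
  ∃ (k : ℕ) (F : Type) (_ : Finite F) (f₀ : F) (acc : Set F) (p : CProg (Fin k) F m),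
    ∀ w : List A, ∃ s : Store (Fin k) F,
      (sem w.length (w.map e)).Run p ⟨f₀, fun _ => 0⟩ s ∧ (s.ctl ∈ acc ↔ w ∈ L)

/-- The action uses only registers in `U`. -/
def Act.Uses {ι F : Type} {m : ℕ} (U : Set ι) : Act ι F m → Prop
  | .inc i => i ∈ U
  | .dec i => i ∈ U
  | .upd _ => True
  | .read i _ => i ∈ U

/-- The test uses only registers in `U`. -/
def Tst.Uses {ι F : Type} (U : Set ι) : Tst ι F → Prop
  | .pos i => i ∈ U
  | .flag _ => True

/-- Rename the register of an action. -/
def Act.rename {ι κ F : Type} {m : ℕ} (r : ι → κ) : Act ι F m → Act κ F m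
  | .inc i => .inc (r i)
  | .dec i => .dec (r i)
  | .upd g => .upd g
  | .read i g => .read (r i) g

/-- Rename the register of a test. -/
def Tst.rename {ι κ F : Type} (r : ι → κ) : Tst ι F → Tst κ F
  | .pos i => .pos (r i)
  | .flag b => .flag b

/-- The simulation relation is restriction of the store along `τ`. As `τ` is injective, updating a
register in its range commutes with restriction, and no other register is used. -/
theorem Sem.Run.rename {ι κ F : Type} [DecidableEq ι] [DecidableEq κ] {m : ℕ} {τ : κ → ι}
    {r : ι → κ} (hr : Function.LeftInverse r τ) {p : CProg ι F m}
    (hp : p.Forall (Act.Uses (Set.range τ)) (Tst.Uses (Set.range τ))) {B : ℕ} {x : List (Fin m)}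
    {s s' : Store ι F} (h : (sem B x).Run p s s') :
    (sem B x).Run (p.bind (fun a => .act (a.rename r)) (fun _ => .skip) (Tst.rename r))
      ⟨s.ctl, s.reg ∘ τ⟩ ⟨s'.ctl, s'.reg ∘ τ⟩ := by
  have hupd : ∀ (v : ι → ℕ) (j : κ) (y : ℕ),
      Function.update v (τ j) y ∘ τ = Function.update (v ∘ τ) j y := fun v j y =>
    Function.update_comp_eq_of_injective v hr.injective j y
  obtain ⟨u, hu, rfl⟩ := Sem.Run.bind (M' := sem B x) (f := fun a => .act (a.rename r))
    (pre := fun _ => .skip) (g := Tst.rename r)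
    (fun (s : Store ι F) (u : Store κ F) => u = ⟨s.ctl, s.reg ∘ τ⟩)
    (fun a ha s s' u h hu => by
      subst hu
      refine ⟨_, .act ?_, rfl⟩
      cases h with
      | inc h =>
        obtain ⟨j, rfl⟩ := ha
        simp only [Act.rename, hr j, hupd]
        exact .inc (s := ⟨s.ctl, s.reg ∘ τ⟩) h
      | dec h =>
        obtain ⟨j, rfl⟩ := ha
        simp only [Act.rename, hr j, hupd]
        exact .dec (s := ⟨s.ctl, s.reg ∘ τ⟩) h
      | upd => exact .upd (s := ⟨s.ctl, s.reg ∘ τ⟩)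
      | read h =>
        obtain ⟨j, rfl⟩ := ha
        simp only [Act.rename, hr j]
        exact .read (s := ⟨s.ctl, s.reg ∘ τ⟩) h)
    (fun t ht s u hu => by
      refine ⟨u, .skip _, hu, ?_⟩
      subst hu
      cases t with
      | pos i =>
        obtain ⟨j, rfl⟩ := ht
        simp [sem, Tst.Holds, Tst.rename, hr j]
      | flag b => rfl) p hp h rfl
  exact hu

theorem exists_forall_uses {F : Type} {m : ℕ} (p : CProg ℕ F m) :
    ∃ k, ∀ l ≥ k, p.Forall (Act.Uses {i | i < l}) (Tst.Uses {i | i < l}) := by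
  induction p with
  | skip => exact ⟨0, fun _ _ => trivial⟩
  | act a =>
    cases a with
    | inc i => exact ⟨i + 1, fun l hl => show i < l by omega⟩
    | dec i => exact ⟨i + 1, fun l hl => show i < l by omega⟩
    | upd g => exact ⟨0, fun _ _ => trivial⟩
    | read i g => exact ⟨i + 1, fun l hl => show i < l by omega⟩
  | seq p q ihp ihq =>
    obtain ⟨a, ha⟩ := ihp
    obtain ⟨b, hb⟩ := ihq
    exact ⟨max a b, fun l hl => ⟨ha l (by omega), hb l (by omega)⟩⟩
  | ite t p q ihp ihq =>
    obtain ⟨a, ha⟩ := ihp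
    obtain ⟨b, hb⟩ := ihq
    cases t with
    | pos i =>
      exact ⟨max (i + 1) (max a b), fun l hl => ⟨show i < l by omega, ha l (by omega),
        hb l (by omega)⟩⟩
    | flag c => exact ⟨max a b, fun l hl => ⟨trivial, ha l (by omega), hb l (by omega)⟩⟩
  | loop t p ih =>
    obtain ⟨a, ha⟩ := ih
    cases t with
    | pos i => exact ⟨max (i + 1) a, fun l hl => ⟨show i < l by omega, ha l (by omega)⟩⟩
    | flag c => exact ⟨a, fun l hl => ⟨trivial, ha l (by omega)⟩⟩

/-- Registers may be indexed by natural numbers. -/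
theorem CounterDecidable.of_nat {A : Type*} {m : ℕ} {e : A ≃ Fin m} {L : Language A} {F : Type}
    [Finite F] (f₀ : F) (acc : Set F) (p : CProg ℕ F m)
    (h : ∀ w : List A, ∃ s : Store ℕ F,
      (sem w.length (w.map e)).Run p ⟨f₀, fun _ => 0⟩ s ∧ (s.ctl ∈ acc ↔ w ∈ L)) :
    CounterDecidable e L := by
  obtain ⟨k, hk⟩ := exists_forall_uses p
  have hr : Function.LeftInverse (fun i : ℕ => Fin.ofNat (k + 1) i) Fin.val := fun i =>
    Fin.ext (by simp)
  refine ⟨k + 1, F, inferInstance, f₀, acc,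
    p.bind (fun a => .act (a.rename (Fin.ofNat (k + 1)))) (fun _ => .skip)
      (Tst.rename (Fin.ofNat (k + 1))), fun w => ?_⟩
  obtain ⟨s, hs, hs'⟩ := h w
  refine ⟨_, hs.rename hr ?_, hs'⟩
  have := hk (k + 1) (by omega)
  rwa [show {i | i < k + 1} = Set.range (Fin.val : Fin (k + 1) → ℕ) by
    rw [Fin.range_val]; rfl] at this

/-- Registers may be indexed by any finite type. -/
theorem CounterDecidable.of_finite {A : Type*} {m : ℕ} {e : A ≃ Fin m} {L : Language A}
    {ι F : Type} [DecidableEq ι] [Finite ι] [Finite F] (f₀ : F) (acc : Set F) (p : CProg ι F m)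
    (h : ∀ w : List A, ∃ s : Store ι F,
      (sem w.length (w.map e)).Run p ⟨f₀, fun _ => 0⟩ s ∧ (s.ctl ∈ acc ↔ w ∈ L)) :
    CounterDecidable e L := by
  obtain ⟨k, ⟨τ⟩⟩ := Finite.exists_equiv_fin ι
  refine ⟨k, F, inferInstance, f₀, acc,
    p.bind (fun a => .act (a.rename τ)) (fun _ => .skip) (Tst.rename τ), fun w => ?_⟩
  obtain ⟨s, hs, hs'⟩ := h w
  exact ⟨_, hs.rename (τ := τ.symm) τ.apply_symm_apply (Prog.forall_of
    (fun a => by cases a <;> simp [Act.Uses]) (fun t => by cases t <;> simp [Tst.Uses]) p), hs'⟩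

end Logspace

/-! ### While programs on Turing machine tapes -/

namespace Logspace

open SpaceComplexity

/-- Actions of while programs on tapes: one transition of a Turing machine. -/
abbrev TAct (F Γ : Type) (k m : ℕ) : Type :=
  F → InputSymbol (Fin m) → (Fin k → Γ) → F × Move × (Fin k → Γ × Move)

/-- Tests of while programs on tapes. -/
abbrev TTst (F Γ : Type) (k m : ℕ) : Type := F → InputSymbol (Fin m) → (Fin k → Γ) → Prop

/-- Stores of while programs on tapes. -/
@[ext]
structure TStore (F Γ : Type) (k : ℕ) : Type where
  ctl : F
  pos : ℕ
  tape : Fin k → ℕ → Γ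
  head : Fin k → ℕ

/-- The effect of a transition. -/
def TStore.next {F Γ : Type} {k m : ℕ} (x : List (Fin m)) (a : TAct F Γ k m) (s : TStore F Γ k) :
    TStore F Γ k :=
  let r := a s.ctl (inputAt x s.pos) (fun i => s.tape i (s.head i))
  { ctl := r.1
    pos := min (r.2.1.apply s.pos) (x.length + 1)
    tape := fun i => Function.update (s.tape i) (s.head i) (r.2.2 i).1
    head := fun i => (r.2.2 i).2.apply (s.head i) }

/-- Semantics of while programs on tapes, with work heads bounded by `b`. -/
def tsem {F Γ : Type} {k m : ℕ} (b : ℕ) (x : List (Fin m)) :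
    Sem (TAct F Γ k m) (TTst F Γ k m) (TStore F Γ k) where
  act a s s' := s' = s.next x a ∧ ∀ i, s'.head i < b
  test t s := t s.ctl (inputAt x s.pos) (fun i => s.tape i (s.head i))

/-- While programs on tapes. -/
abbrev TProg (F Γ : Type) (k m : ℕ) : Type := Prog (TAct F Γ k m) (TTst F Γ k m)

/-- Rename the letters of input symbols. -/
def mapInput {A B : Type*} (e : A → B) : InputSymbol A → InputSymbol B
  | .leftEnd => .leftEnd
  | .letter a => .letter (e a)
  | .rightEnd => .rightEnd

theorem mapInput_inputAt {A B : Type*} (e : A → B) (w : List A) (i : ℕ) :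
    mapInput e (inputAt w i) = inputAt (w.map e) i := by
  cases i with
  | zero => rfl
  | succ i =>
    simp only [inputAt, List.getElem?_map]
    cases w[i]? <;> rfl

open Classical in
/-- One step of a while program on tapes, as a transition. -/
noncomputable def tstep {F Γ : Type} {k m : ℕ} :
    List (TProg F Γ k m) → F → InputSymbol (Fin m) → (Fin k → Γ) →
      Option (List (TProg F Γ k m) × (F × Move × (Fin k → Γ × Move)))
  | [], _, _, _ => none
  | .skip :: l, f, _, y => some (l, f, .stay, fun i => (y i, .stay))
  | .act a :: l, f, c, y => some (l, a f c y)
  | .seq p q :: l, f, _, y => some (p :: q :: l, f, .stay, fun i => (y i, .stay))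
  | .ite t p q :: l, f, c, y =>
    some (if t f c y then p :: l else q :: l, f, .stay, fun i => (y i, .stay))
  | .loop t p :: l, f, c, y =>
    some (if t f c y then p :: .loop t p :: l else l, f, .stay, fun i => (y i, .stay))

theorem next_of_tstep {F Γ : Type} {k m : ℕ} {l : List (TProg F Γ k m)} {f : F}
    {c : InputSymbol (Fin m)} {y : Fin k → Γ} {r} (h : tstep l f c y = some r) : Next l r.1 := by
  rcases l with _ | ⟨_ | a | ⟨p, q⟩ | ⟨t, p, q⟩ | ⟨t, p⟩, l⟩ <;>
    simp only [tstep, Option.some.injEq, reduceCtorEq] at h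
  · subst h; exact .skip
  · subst h; exact .act
  · subst h; exact .seq
  · subst h
    by_cases ht : t f c y
    · simpa only [if_pos ht] using .iteTrue
    · simpa only [if_neg ht] using .iteFalse
  · subst h
    by_cases ht : t f c y
    · simpa only [if_pos ht] using .loopTrue
    · simpa only [if_neg ht] using .loopFalse

open Classical in
/-- The Turing machine that executes a while program on tapes. -/
noncomputable def tmachine {A : Type*} {F Γ : Type} [Finite F] [Finite Γ] {k m : ℕ}
    (e : A → Fin m) (p : TProg F Γ k m) (blank : Γ) (f₀ : F) (acc : Set F) : Machine A where
  numTapes := k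
  State := {l // l ∈ p.conts []} × F
  finiteState := by
    have : Finite {l // l ∈ p.conts []} := p.conts_finite []
    infer_instance
  Symbol := Γ
  finiteSymbol := inferInstance
  blank := blank
  start := (⟨[p], p.self_mem_conts []⟩, f₀)
  accept := {q | q.2 ∈ acc}
  trans q c y := (tstep q.1.1 q.2 (mapInput e c) y).map fun r =>
    ((if h : r.1 ∈ p.conts [] then ⟨r.1, h⟩ else q.1, r.2.1), r.2.2)

/-- A configuration of the machine represents a continuation and a store. -/
structure TSim {A : Type*} {F Γ : Type} [Finite F] [Finite Γ] {k m : ℕ} {e : A → Fin m}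
    {p : TProg F Γ k m} {blank : Γ} {f₀ : F} {acc : Set F} (c : Cfg (tmachine e p blank f₀ acc))
    (l : List (TProg F Γ k m)) (s : TStore F Γ k) : Prop where
  cont : c.state.1.1 = l
  ctl : c.state.2 = s.ctl
  pos : c.inputHead = s.pos
  tape : c.tape = s.tape
  head : c.head = s.head

section Machine

variable {A : Type*} {F Γ : Type} [Finite F] [Finite Γ] {k m : ℕ} {e : A → Fin m}
  {p : TProg F Γ k m} {blank : Γ} {f₀ : F} {acc : Set F}

theorem TSim.step_eq_none {c : Cfg (tmachine e p blank f₀ acc)} {s : TStore F Γ k}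
    (h : TSim c [] s) (w : List A) : Machine.step _ w c = none := by
  have : tstep c.state.1.1 c.state.2 (mapInput e (inputAt w c.inputHead))
      (fun i => c.tape i (c.head i)) = none := by
    rw [h.cont]
    rfl
  simp only [Machine.step, tmachine] at this ⊢
  rw [this]
  rfl

/-- Steps that only rearrange the continuation become transitions that write back what they scan and
move no head. The bound `hpos` makes the clamping of the input head harmless in these steps. -/
theorem TSim.step {c : Cfg (tmachine e p blank f₀ acc)} {s s' : TStore F Γ k}
    {l l' : List (TProg F Γ k m)} (h : TSim c l s) (w : List A) (hpos : s.pos ≤ w.length + 1)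
    {b : ℕ} (hs : (tsem b (w.map e)).Small (l, s) (l', s')) :
    ∃ c', Machine.step _ w c = some c' ∧ TSim c' l' s' := by
  obtain ⟨r, hr, hs'⟩ : ∃ r, tstep l s.ctl (inputAt (w.map e) s.pos)
      (fun i => s.tape i (s.head i)) = some (l', r) ∧
      s' = s.next (w.map e) (fun _ _ _ => r) := by
    have hstay : s = s.next (w.map e)
        (fun _ _ _ => (s.ctl, .stay, fun i => (s.tape i (s.head i), .stay))) := by
      ext
      · rfl
      · simp [TStore.next, Move.apply, hpos]
      · simp [TStore.next]
      · simp [TStore.next, Move.apply]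
    cases hs with
    | skip => exact ⟨_, rfl, hstay⟩
    | act h => exact ⟨_, rfl, h.1⟩
    | seq => exact ⟨_, rfl, hstay⟩
    | iteTrue ht =>
      refine ⟨_, ?_, hstay⟩
      simp only [tsem] at ht
      simp only [tstep, ht, if_true]
    | iteFalse ht =>
      refine ⟨_, ?_, hstay⟩
      simp only [tsem] at ht
      simp only [tstep, ht, if_false]
    | loopTrue ht =>
      refine ⟨_, ?_, hstay⟩
      simp only [tsem] at ht
      simp only [tstep, ht, if_true]
    | loopFalse ht =>
      refine ⟨_, ?_, hstay⟩
      simp only [tsem] at ht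
      simp only [tstep, ht, if_false]
  -- Closure of the continuations shows that the default branch in the transition function of
  -- `tmachine` is never taken.
  have hmem : l' ∈ p.conts [] := by
    have := next_of_tstep hr
    rw [← h.cont] at this
    exact p.conts_nil_next c.state.1.2 this
  have htr : (tmachine e p blank f₀ acc).trans c.state (inputAt w c.inputHead)
      (fun i => c.tape i (c.head i)) = some ((⟨l', hmem⟩, r.1), r.2) := by
    have hr' : tstep c.state.1.1 c.state.2 (mapInput e (inputAt w c.inputHead))
        (fun i => c.tape i (c.head i)) = some (l', r) := by
      rw [mapInput_inputAt, h.cont, h.ctl, h.pos, h.tape, h.head, hr]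
    simp only [tmachine] at hr' ⊢
    rw [hr']
    simp [hmem]
  refine ⟨_, by rw [Machine.step, htr]; rfl, ?_⟩
  subst hs'
  constructor
  · rfl
  · rfl
  · simp [TStore.next, h.pos]
  · simp only [TStore.next, h.tape, h.head]
    rfl
  · simp only [TStore.next, h.head]
    rfl

end Machine

/-- Actions are defined only if all work heads stay below `b`, and other steps keep the store. A run
of a while program therefore certifies its own space bound. -/
theorem tsem_small_bounds {F Γ : Type} {k m b : ℕ} {x : List (Fin m)}
    {z z' : List (TProg F Γ k m) × TStore F Γ k}
    (h : Relation.ReflTransGen (tsem b x).Small z z')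
    (hz : z.2.pos ≤ x.length + 1 ∧ ∀ i, z.2.head i < b) :
    z'.2.pos ≤ x.length + 1 ∧ ∀ i, z'.2.head i < b := by
  induction h with
  | refl => exact hz
  | tail _ h ih =>
    cases h with
    | act h =>
      obtain ⟨rfl, h'⟩ := h
      exact ⟨min_le_right _ _, h'⟩
    | _ => exact ih

/-- Languages decided by while programs on tapes in logarithmic space are in `LOGSPACE`. -/
theorem mem_logspace_of_tprog {A : Type*} {m : ℕ} (e : A → Fin m) {L : Language A} {F Γ : Type}
    [Finite F] [Finite Γ] {k : ℕ} (p : TProg F Γ k m) (blank : Γ) (f₀ : F) (acc : Set F) (C : ℕ)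
    (hC : 0 < C)
    (h : ∀ w : List A, ∃ s : TStore F Γ k,
      (tsem (C * (Nat.log 2 w.length + 1)) (w.map e)).Run p
        ⟨f₀, 0, fun _ _ => blank, fun _ => 0⟩ s ∧ (s.ctl ∈ acc ↔ w ∈ L)) :
    L ∈ LOGSPACE A := by
  refine ⟨tmachine e p blank f₀ acc, C, ?_⟩
  have key : ∀ w : List A, ∃ (c : Cfg (tmachine e p blank f₀ acc)) (s : TStore F Γ k),
      Machine.Reaches _ w c ∧ TSim c [] s ∧ (s.ctl ∈ acc ↔ w ∈ L) ∧
      ∀ c', Machine.Reaches (tmachine e p blank f₀ acc) w c' →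
        ∀ i, c'.head i < C * (Nat.log 2 w.length + 1) := by
    intro w
    obtain ⟨s, hs, hL⟩ := h w
    set s₀ : TStore F Γ k := ⟨f₀, 0, fun _ _ => blank, fun _ => 0⟩ with hs₀
    set b := C * (Nat.log 2 w.length + 1) with hb
    have hb0 : 0 < b := Nat.mul_pos hC (Nat.succ_pos _)
    have hrun := hs.small []
    have hinit : TSim (Machine.init (tmachine e p blank f₀ acc)) [p] s₀ := ⟨rfl, rfl, rfl, rfl, rfl⟩
    have hz₀ : s₀.pos ≤ (w.map e).length + 1 ∧ ∀ i, s₀.head i < b :=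
      ⟨Nat.zero_le _, fun _ => hb0⟩
    have hreach : ∃ c, Machine.Reaches (tmachine e p blank f₀ acc) w c ∧ TSim c [] s := by
      have : ∀ z, Relation.ReflTransGen (tsem b (w.map e)).Small ([p], s₀) z →
          ∃ c, Machine.Reaches (tmachine e p blank f₀ acc) w c ∧ TSim c z.1 z.2 := by
        intro z hz
        induction hz with
        | refl => exact ⟨_, .refl, hinit⟩
        | tail hz h ih =>
          obtain ⟨c, hc, hc'⟩ := ih
          obtain ⟨c', hc₁, hc₂⟩ := hc'.step w
            (by simpa using (tsem_small_bounds hz hz₀).1) h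
          exact ⟨c', .tail hc hc₁, hc₂⟩
      exact this _ hrun
    obtain ⟨c, hc, hc'⟩ := hreach
    refine ⟨c, s, hc, hc', hL, fun c' hc'' => ?_⟩
    -- The machine is deterministic, so each reachable configuration represents a point of the
    -- simulated run. The last conjunct keeps the rest of that run, which dictates the next step or,
    -- at its end, excludes one.
    have : ∃ z, TSim c' z.1 z.2 ∧ Relation.ReflTransGen (tsem b (w.map e)).Small ([p], s₀) z ∧
        Relation.ReflTransGen (tsem b (w.map e)).Small z ([], s) := by
      induction hc'' with
      | refl => exact ⟨_, hinit, .refl, hrun⟩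
      | tail _ h ih =>
        obtain ⟨z, hz₁, hz₂, hz₃⟩ := ih
        rcases hz₃.cases_head with rfl | ⟨z', hz', hz''⟩
        · rw [hz₁.step_eq_none] at h
          cases h
        · obtain ⟨c₂, hc₂, hsim⟩ := hz₁.step w
            (by simpa using (tsem_small_bounds hz₂ hz₀).1) hz'
          rw [hc₂] at h
          cases h
          exact ⟨z', hsim, .tail hz₂ hz', hz''⟩
    obtain ⟨z, hz₁, hz₂, -⟩ := this
    rw [hz₁.head]
    exact (tsem_small_bounds hz₂ hz₀).2
  constructor
  · intro w
    obtain ⟨c, s, hc, hsim, hL, -⟩ := key w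
    refine ⟨c, hc, hsim.step_eq_none w, ?_⟩
    rw [← hL, ← hsim.ctl]
    rfl
  · intro w c hc
    obtain ⟨-, -, -, -, -, h⟩ := key w
    exact h c hc

end Logspace

/-! ### Binary counters on work tapes -/

namespace Logspace

open SpaceComplexity

/-- Symbols of counter tapes: blank, the marker of cell `0`, and bits. -/
abbrev CSym : Type := Option (Option Bool)

/-- Stores of programs on a single tape. -/
structure SStore : Type where
  tape : ℕ → CSym
  head : ℕ

/-- Semantics of programs on a single tape, with the head bounded by `b`. -/
def ssem (b : ℕ) : Sem (CSym → CSym × Move) (CSym → Prop) SStore where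
  act g s s' := s' = ⟨Function.update s.tape s.head (g (s.tape s.head)).1,
    (g (s.tape s.head)).2.apply s.head⟩ ∧ s'.head < b
  test t s := t (s.tape s.head)

/-- Run a program for a single tape on tape `i`. -/
def onTape {F : Type} {k : ℕ} (m : ℕ) (i : Fin k) :
    Prog (CSym → CSym × Move) (CSym → Prop) → TProg F CSym k m :=
  Prog.bind (fun g => .act fun f _ y =>
    (f, .stay, fun j => if j = i then g (y i) else (y j, .stay))) (fun _ => .skip)
    (fun t _ _ y => t (y i))

theorem run_onTape {F : Type} {k m b : ℕ} {x : List (Fin m)} {i : Fin k}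
    {p : Prog (CSym → CSym × Move) (CSym → Prop)} {s s' : SStore} (h : (ssem b).Run p s s')
    (f : F) {pos : ℕ} (hpos : pos ≤ x.length + 1) (T : Fin k → ℕ → CSym) (H : Fin k → ℕ)
    (hH : ∀ j, H j < b) :
    (tsem b x).Run (onTape m i p)
      ⟨f, pos, Function.update T i s.tape, Function.update H i s.head⟩
      ⟨f, pos, Function.update T i s'.tape, Function.update H i s'.head⟩ := by
  obtain ⟨u, hu, rfl⟩ := Sem.Run.bind (M' := tsem (F := F) b x)
    (f := fun g => .act fun f _ y =>
      (f, .stay, fun j => if j = i then g (y i) else (y j, .stay)))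
    (pre := fun _ => .skip) (g := fun t _ _ y => t (y i))
    (fun (s : SStore) u => u = ⟨f, pos, Function.update T i s.tape, Function.update H i s.head⟩)
    (fun g _ s s' u hg hu => by
      obtain ⟨rfl, hb⟩ := hg
      subst hu
      refine ⟨_, .act ⟨?_, ?_⟩, rfl⟩
      · ext1
        · rfl
        · simp [TStore.next, Move.apply, hpos]
        · funext j
          by_cases hj : j = i
          · subst hj; simp [TStore.next]
          · simp [TStore.next, hj]
        · funext j
          by_cases hj : j = i
          · subst hj; simp [TStore.next]
          · simp [TStore.next, hj, Move.apply]
      · intro j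
        by_cases hj : j = i
        · subst hj; simpa using hb
        · simpa [hj] using hH j)
    (fun t _ s u hu => ⟨u, .skip _, hu, by subst hu; simp [tsem, ssem]⟩)
    p (Prog.forall_of (fun _ => trivial) (fun _ => trivial) p) h rfl
  exact hu

/-- The tape that holds a marker followed by bits. -/
def ctape (l : List Bool) : ℕ → CSym
  | 0 => some none
  | j + 1 => l[j]?.map some

/-- The value of a list of bits, least significant bit first. -/
def bval : List Bool → ℕ
  | [] => 0
  | c :: l => c.toNat + 2 * bval l

/-- Replace the longest prefix of bits `c` by bits `!c`, and the next bit by `c`. -/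
def flipBits (c : Bool) : List Bool → List Bool
  | [] => [c]
  | d :: l => if d = c then (!c) :: flipBits c l else c :: l

/-- Flipping the low-order ones and then the next bit is the carry of binary addition; with the
roles of the bits exchanged it is the borrow of subtraction. -/
theorem bval_flipBits_true (l : List Bool) : bval (flipBits true l) = bval l + 1 := by
  induction l with
  | nil => rfl
  | cons d l ih => cases d <;> simp [flipBits, bval, ih] <;> omega

theorem bval_flipBits_false (l : List Bool) (h : 0 < bval l) :
    bval (flipBits false l) + 1 = bval l ∧ (flipBits false l).length = l.length := by
  induction l with
  | nil => simp [bval] at h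
  | cons d l ih =>
    cases d
    · have := ih (by simpa [bval] using h)
      simp [flipBits, bval, this.2]
      omega
    · simp [flipBits, bval]
      omega

/-- A new bit is needed only if all bits are ones, that is, if the value is `2 ^ l.length - 1`. -/
theorem length_flipBits_true (l : List Bool) : (flipBits true l).length = l.length ∨
    ((flipBits true l).length = l.length + 1 ∧ 2 ^ l.length = bval l + 1) := by
  induction l with
  | nil => simp [flipBits, bval]
  | cons d l ih =>
    cases d
    · simp [flipBits]
    · rcases ih with h | ⟨h, h'⟩
      · simp [flipBits, h]
      · right
        simp [flipBits, h, bval, pow_succ, h']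
        omega

/-- High-order zeros are never removed, so the bound on the length is an invariant of its own. The
length grows only if `2 ^ l.length ≤ B`, and then there is still room. -/
theorem length_flipBits_true_le {l : List Bool} {B : ℕ} (h : l.length ≤ Nat.log 2 B + 1)
    (hB : bval l < B) : (flipBits true l).length ≤ Nat.log 2 B + 1 := by
  rcases length_flipBits_true l with h' | ⟨h', h''⟩
  · omega
  · have : l.length ≤ Nat.log 2 B := Nat.le_log_of_pow_le (by norm_num) (by omega)
    omega

theorem update_ctape_append (l r : List Bool) (c d : Bool) :
    Function.update (ctape (l ++ d :: r)) (l.length + 1) (some (some c)) =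
      ctape (l ++ c :: r) := by
  funext j
  rcases j with _ | j
  · simp [ctape]
  · by_cases hj : j = l.length
    · subst hj; simp [ctape]
    · rw [Function.update_of_ne (by omega)]
      simp only [ctape, List.getElem?_append, List.getElem?_cons]
      split_ifs <;> first | rfl | omega

theorem update_ctape_concat (l : List Bool) (c : Bool) :
    Function.update (ctape l) (l.length + 1) (some (some c)) = ctape (l ++ [c]) := by
  funext j
  rcases j with _ | j
  · simp [ctape]
  · by_cases hj : j = l.length
    · subst hj; simp [ctape]
    · rw [Function.update_of_ne (by omega)]
      simp only [ctape, List.getElem?_append, List.getElem?_cons]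
      split_ifs
      · rfl
      · omega
      · rw [List.getElem?_eq_none (by omega)]
        simp

/-- Move the head to the marker. -/
def goHome : Prog (CSym → CSym × Move) (CSym → Prop) :=
  .loop (· ≠ some none) (.act fun c => (c, .left))

theorem run_goHome (b : ℕ) (l : List Bool) (h : ℕ) (hb : h < b) :
    (ssem b).Run goHome ⟨ctape l, h⟩ ⟨ctape l, 0⟩ := by
  unfold goHome
  induction h with
  | zero => exact .loopFalse (by simp [ssem, ctape])
  | succ h ih =>
    refine .loopTrue ?_ (.act (s' := ⟨ctape l, h⟩) ⟨?_, by simp; omega⟩) (ih (by omega))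
    · cases hj : l[h]? <;> simp [ssem, ctape, hj]
    · simp [Move.apply]

/-- Increment (`c = true`) or decrement (`c = false`) a counter. -/
def flipProg (c : Bool) : Prog (CSym → CSym × Move) (CSym → Prop) :=
  .seq (.act fun d => (d, .right)) (.seq
    (.loop (· = some (some c)) (.act fun _ => (some (some !c), .right)))
    (.seq (.act fun _ => (some (some c), .stay)) goHome))

/-- Here `l` is the part that the head has already passed. The induction hypothesis is a run of the
whole sequence; it is taken apart so that its loop can be extended by one round in front. -/
theorem run_flip_aux (b : ℕ) (c : Bool) (l r : List Bool)
    (hb : (l ++ flipBits c r).length < b) :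
    (ssem b).Run (.seq (.loop (· = some (some c)) (.act fun _ => (some (some !c), .right)))
      (.seq (.act fun _ => (some (some c), .stay)) goHome))
      ⟨ctape (l ++ r), l.length + 1⟩ ⟨ctape (l ++ flipBits c r), 0⟩ := by
  induction r generalizing l with
  | nil =>
    simp [flipBits] at hb
    refine .seq (.loopFalse ?_) (.seq (.act (s' := ⟨ctape (l ++ [c]), l.length + 1⟩) ⟨?_, ?_⟩) ?_)
    · simp [ssem, ctape]
    · simp [Move.apply, update_ctape_concat]
    · simpa using hb
    · exact run_goHome b _ _ hb
  | cons d r ih =>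
    by_cases hd : d = c
    · subst hd
      have := ih (l ++ [!d]) (by simpa [flipBits] using hb)
      cases this with
      | seq h₁ h₂ =>
        simp only [flipBits, if_true]
        rw [List.append_assoc] at h₂
        refine .seq (.loopTrue ?_ (.act (s' := ⟨ctape (l ++ [!d] ++ r), (l ++ [!d]).length + 1⟩)
          ⟨?_, ?_⟩) h₁) h₂
        · simp [ssem, ctape]
        · simp [Move.apply, update_ctape_append]
        · simp [flipBits] at hb ⊢
          have : 0 < (flipBits d r).length := by
            cases r with
            | nil => simp [flipBits]
            | cons a r => simp only [flipBits]; split_ifs <;> simp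
          omega
    · simp only [flipBits, if_neg hd] at hb ⊢
      refine .seq (.loopFalse ?_) (.seq
        (.act (s' := ⟨ctape (l ++ c :: r), l.length + 1⟩) ⟨?_, ?_⟩) ?_)
      · simp [ssem, ctape, hd]
      · simp [Move.apply, update_ctape_append]
      · simp at hb ⊢; omega
      · exact run_goHome b _ _ (by simp at hb; omega)

theorem run_flipProg (b : ℕ) (c : Bool) (l : List Bool) (hb : (flipBits c l).length < b) :
    (ssem b).Run (flipProg c) ⟨ctape l, 0⟩ ⟨ctape (flipBits c l), 0⟩ := by
  refine .seq (.act (s' := ⟨ctape l, 1⟩) ⟨?_, ?_⟩) (run_flip_aux b c [] l hb)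
  · simp [Move.apply]
  · have : 0 < (flipBits c l).length := by
      cases l with
      | nil => simp [flipBits]
      | cons a r => simp only [flipBits]; split_ifs <;> simp
    show 1 < b
    omega

/-- Move the head to the first cell that does not hold a marker or a zero. -/
def scanZeros : Prog (CSym → CSym × Move) (CSym → Prop) :=
  .seq (.act fun d => (d, .right)) (.loop (· = some (some false)) (.act fun d => (d, .right)))

/-- Because of high-order zeros, zero has many representations. The scan stops at the first one bit,
or on the blank behind the last bit exactly if the value is `0`. -/
theorem run_scanZeros (b : ℕ) (l : List Bool) (hb : l.length + 1 < b) :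
    ∃ h < b, (ssem b).Run scanZeros ⟨ctape l, 0⟩ ⟨ctape l, h⟩ ∧
      (ctape l h = none ↔ bval l = 0) := by
  have key : ∀ r t : List Bool, l = t ++ r → ∃ h < b,
      (ssem b).Run (.loop (· = some (some false)) (.act fun d => (d, .right)))
        ⟨ctape l, t.length + 1⟩ ⟨ctape l, h⟩ ∧ (ctape l h = none ↔ bval r = 0) := by
    intro r
    induction r with
    | nil =>
      rintro t rfl
      simp only [List.append_nil] at hb ⊢
      exact ⟨t.length + 1, hb, .loopFalse (by simp [ssem, ctape]), by simp [ctape, bval]⟩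
    | cons d r ih =>
      rintro t rfl
      cases d
      · obtain ⟨h, hh, hr, hz⟩ := ih (t ++ [false]) (by simp)
        refine ⟨h, hh, .loopTrue (by simp [ssem, ctape]) (.act ⟨?_, ?_⟩) hr,
          by simpa [bval] using hz⟩
        · simp [Move.apply]
        · simp at hb ⊢; omega
      · exact ⟨t.length + 1, by simp at hb; omega, .loopFalse (by simp [ssem, ctape]),
          by simp [ctape, bval]⟩
  obtain ⟨h, hh, hr, hz⟩ := key l [] rfl
  refine ⟨h, hh, .seq (.act ⟨?_, ?_⟩) hr, hz⟩
  · simp [Move.apply]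
  · simp; omega

/-! ### Counters as tapes -/

/-- Every tape holds a counter with the value given by `v`, and all heads are on the markers. -/
def View {F : Type} {k : ℕ} (B : ℕ) (v : Fin k → ℕ) (u : TStore F CSym k) : Prop :=
  ∃ l : Fin k → List Bool, u.tape = (fun i => ctape (l i)) ∧ u.head = (fun _ => 0) ∧
    ∀ i, (l i).length ≤ Nat.log 2 B + 1 ∧ bval (l i) = v i

section View

variable {F : Type} {k m B b : ℕ} {x : List (Fin m)} {v : Fin k → ℕ}

/-- A counter takes the marker cell and at most `log₂ B + 1` bits, and a scan may visit the blank
behind them; hence the requirement `log₂ B + 2 < b` here and below. -/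
theorem View.flip {u : TStore F CSym k} (hu : View B v u) (hpos : u.pos ≤ x.length + 1)
    (hb : Nat.log 2 B + 2 < b) (i : Fin k) (c : Bool) (y : ℕ)
    (h : ∀ l : List Bool, l.length ≤ Nat.log 2 B + 1 → bval l = v i →
      (flipBits c l).length ≤ Nat.log 2 B + 1 ∧ bval (flipBits c l) = y) :
    ∃ u', (tsem b x).Run (onTape m i (flipProg c)) u u' ∧ View B (Function.update v i y) u' ∧
      u'.ctl = u.ctl ∧ u'.pos = u.pos := by
  obtain ⟨f, pos, T, H⟩ := u
  obtain ⟨l, rfl, rfl, hl⟩ := hu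
  have h' := h (l i) (hl i).1 (hl i).2
  have := run_onTape (x := x) (i := i) (run_flipProg b c (l i) (by omega)) f hpos
    (fun i => ctape (l i)) (fun _ => 0) (fun _ => by omega)
  simp only [Function.update_eq_self] at this
  refine ⟨_, this, ⟨Function.update l i (flipBits c (l i)), ?_, rfl, ?_⟩, rfl, rfl⟩
  · funext j
    by_cases hj : j = i
    · subst hj; simp
    · simp [hj]
  · intro j
    by_cases hj : j = i
    · subst hj; simpa using h'
    · simpa [hj] using hl j

theorem View.inc {u : TStore F CSym k} (hu : View B v u) (hpos : u.pos ≤ x.length + 1)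
    (hb : Nat.log 2 B + 2 < b) (i : Fin k) (hi : v i < B) :
    ∃ u', (tsem b x).Run (onTape m i (flipProg true)) u u' ∧
      View B (Function.update v i (v i + 1)) u' ∧ u'.ctl = u.ctl ∧ u'.pos = u.pos :=
  hu.flip hpos hb i true _ fun l hl hv =>
    ⟨length_flipBits_true_le hl (by omega), by rw [bval_flipBits_true, hv]⟩

theorem View.dec {u : TStore F CSym k} (hu : View B v u) (hpos : u.pos ≤ x.length + 1)
    (hb : Nat.log 2 B + 2 < b) (i : Fin k) (hi : 0 < v i) :
    ∃ u', (tsem b x).Run (onTape m i (flipProg false)) u u' ∧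
      View B (Function.update v i (v i - 1)) u' ∧ u'.ctl = u.ctl ∧ u'.pos = u.pos :=
  hu.flip hpos hb i false _ fun l hl hv => by
    have := bval_flipBits_false l (by omega)
    omega

open Classical in
/-- Store in the flag whether the counter on tape `i` is zero. -/
noncomputable def zeroProg (m : ℕ) (i : Fin k) : TProg (F × Bool) CSym k m :=
  .seq (onTape m i scanZeros) (.seq
    (.act fun f _ y => ((f.1, decide (y i = none)), .stay, fun j => (y j, .stay)))
    (onTape m i goHome))

theorem View.zero {u : TStore (F × Bool) CSym k} (hu : View B v u)
    (hpos : u.pos ≤ x.length + 1) (hb : Nat.log 2 B + 2 < b) (i : Fin k) :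
    ∃ u', (tsem b x).Run (zeroProg m i) u u' ∧ View B v u' ∧
      u'.ctl = (u.ctl.1, decide (v i = 0)) ∧ u'.pos = u.pos := by
  obtain ⟨f, pos, T, H⟩ := u
  obtain ⟨l, rfl, rfl, hl⟩ := hu
  obtain ⟨h, hh, hr, hz⟩ := run_scanZeros b (l i) (by have := (hl i).1; omega)
  have e0 : Function.update (fun _ : Fin k => (0 : ℕ)) i 0 = fun _ => 0 :=
    Function.update_eq_self i _
  have h₁ := run_onTape (x := x) (i := i) hr f hpos
    (fun i => ctape (l i)) (fun _ => 0) (fun _ => by omega)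
  have h₂ := run_onTape (x := x) (i := i) (run_goHome b (l i) h hh) (f.1, decide (v i = 0)) hpos
    (fun i => ctape (l i)) (fun _ => 0) (fun _ => by omega)
  simp only [e0, Function.update_eq_self i (fun i => ctape (l i))] at h₁ h₂
  refine ⟨_, .seq h₁ (.seq (.act ⟨?_, ?_⟩) h₂), ⟨l, rfl, rfl, hl⟩, rfl, rfl⟩
  · ext1
    · simp [TStore.next, hz, (hl i).2]
    · have : pos ≤ x.length + 1 := hpos
      simp [TStore.next, Move.apply, this]
    · simp [TStore.next]
    · simp [TStore.next, Move.apply]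
  · intro j
    by_cases hj : j = i
    · subst hj; simpa using hh
    · simp [hj]; omega

theorem View.move {u : TStore F CSym k} (hu : View B v u) (hb : Nat.log 2 B + 2 < b)
    (g : F → InputSymbol (Fin m) → F) (d : Move) :
    ∃ u', (tsem b x).Run (.act fun f c y => (g f c, d, fun j => (y j, .stay))) u u' ∧ View B v u' ∧
      u'.ctl = g u.ctl (inputAt x u.pos) ∧ u'.pos = min (d.apply u.pos) (x.length + 1) := by
  obtain ⟨f, pos, T, H⟩ := u
  obtain ⟨l, rfl, rfl, hl⟩ := hu
  refine ⟨_, .act ⟨rfl, ?_⟩, ⟨l, ?_, ?_, hl⟩, rfl, rfl⟩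
  · intro j
    simp [TStore.next, Move.apply]; omega
  · simp [TStore.next]
  · simp [TStore.next, Move.apply]

end View

end Logspace

/-! ### Counter programs on Turing machines -/

namespace Logspace

open SpaceComplexity

/-- The letter of an input symbol. -/
def letterOf {A : Type*} : InputSymbol A → Option A
  | .letter a => some a
  | _ => none

theorem letterOf_inputAt {A : Type*} (x : List A) (i : ℕ) :
    letterOf (inputAt x (i + 1)) = x[i]? := by
  simp only [inputAt]
  cases x[i]? <;> rfl

/-- Move the input head without touching the work tapes, and update the control value. -/
def moveProg {F : Type} (k m : ℕ) (g : F → InputSymbol (Fin m) → F) (d : Move) : TProg F CSym k m :=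
  .act fun f c y => (g f c, d, fun j => (y j, .stay))

/-- Move the input head to the first letter. -/
def rewind (F : Type) (k m : ℕ) : TProg F CSym k m :=
  .seq (.loop (fun _ c _ => c ≠ .leftEnd) (moveProg k m (fun f _ => f) .left))
    (moveProg k m (fun f _ => f) .right)

/-- Transfer the counter on tape `i` to tape `j`, moving the input head in direction `d` for each
unit. -/
noncomputable def transfer {F : Type} {k m : ℕ} (i j : Fin k) (d : Move) :
    TProg (F × Bool) CSym k m :=
  .seq (zeroProg m i) (.loop (fun f _ _ => f.2 = false)
    (.seq (onTape m i (flipProg false)) (.seq (onTape m j (flipProg true))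
      (.seq (moveProg k m (fun f _ => f) d) (zeroProg m i)))))

section

variable {F : Type} {k m B b : ℕ} {x : List (Fin m)} {v : Fin k → ℕ}

theorem View.rewind {u : TStore F CSym k} (hu : View B v u) (hpos : u.pos ≤ x.length + 1)
    (hb : Nat.log 2 B + 2 < b) :
    ∃ u', (tsem b x).Run (rewind F k m) u u' ∧ View B v u' ∧ u'.ctl = u.ctl ∧ u'.pos = 1 := by
  have key : ∀ (n : ℕ) (u : TStore F CSym k), u.pos = n → View B v u → n ≤ x.length + 1 →
      ∃ u', (tsem b x).Run (.loop (fun _ c _ => c ≠ .leftEnd) (moveProg k m (fun f _ => f) .left))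
        u u' ∧ View B v u' ∧ u'.ctl = u.ctl ∧ u'.pos = 0 := by
    intro n
    induction n with
    | zero =>
      intro u hn hu _
      exact ⟨u, .loopFalse (by simp [tsem, hn, inputAt]), hu, rfl, hn⟩
    | succ n ih =>
      intro u hn hu hle
      obtain ⟨u₁, hr₁, hu₁, hc₁, hp₁⟩ := hu.move (x := x) hb (fun f _ => f) .left
      obtain ⟨u₂, hr₂, hu₂, hc₂, hp₂⟩ := ih u₁
        (by rw [hp₁, hn]; simp [Move.apply]; omega) hu₁ (by omega)
      refine ⟨u₂, .loopTrue ?_ hr₁ hr₂, hu₂, hc₂.trans hc₁, hp₂⟩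
      simp only [tsem, hn, inputAt]
      cases x[n]? <;> simp
  obtain ⟨u₁, hr₁, hu₁, hc₁, hp₁⟩ := key _ u rfl hu hpos
  obtain ⟨u₂, hr₂, hu₂, hc₂, hp₂⟩ := hu₁.move (x := x) hb (fun f _ => f) .right
  exact ⟨u₂, .seq hr₁ hr₂, hu₂, hc₂.trans hc₁, by rw [hp₂, hp₁]; simp [Move.apply]⟩

/-- Decrementing before incrementing keeps the sum of both counters within `B`. Since the input head
moves once per unit, a counter value is converted into a head position. -/
theorem View.transfer {u : TStore (F × Bool) CSym k} (hu : View B v u)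
    (hpos : u.pos ≤ x.length + 1) (hb : Nat.log 2 B + 2 < b) {i j : Fin k} (hij : i ≠ j) (d : Move)
    (hB : v i + v j ≤ B) :
    ∃ u', (tsem b x).Run (transfer i j d) u u' ∧
      View B (Function.update (Function.update v i 0) j (v j + v i)) u' ∧
      u'.ctl.1 = u.ctl.1 ∧ u'.pos = (fun p => min (d.apply p) (x.length + 1))^[v i] u.pos := by
  have key : ∀ (n : ℕ) (v : Fin k → ℕ) (u : TStore (F × Bool) CSym k), v i = n → View B v u →
      v i + v j ≤ B → u.ctl.2 = decide (v i = 0) → u.pos ≤ x.length + 1 →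
      ∃ u', (tsem b x).Run (.loop (fun f _ _ => f.2 = false)
        (.seq (onTape m i (flipProg false)) (.seq (onTape m j (flipProg true))
          (.seq (moveProg k m (fun f _ => f) d) (zeroProg m i))))) u u' ∧
        View B (Function.update (Function.update v i 0) j (v j + v i)) u' ∧
        u'.ctl.1 = u.ctl.1 ∧ u'.pos = (fun p => min (d.apply p) (x.length + 1))^[v i] u.pos := by
    intro n
    induction n with
    | zero =>
      intro v u hn hu hB hf hpos
      refine ⟨u, .loopFalse (by simp [tsem, hf, hn]), ?_, rfl, by simp [hn]⟩
      have : Function.update (Function.update v i 0) j (v j + v i) = v := by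
        have h0 : Function.update v i 0 = v := by
          rw [← hn]; exact Function.update_eq_self i v
        rw [h0, hn, add_zero, Function.update_eq_self]
      rwa [this]
    | succ n ih =>
      intro v u hn hu hB hf hpos
      obtain ⟨u₁, hr₁, hu₁, hc₁, hp₁⟩ := hu.dec hpos hb i (by omega)
      obtain ⟨u₂, hr₂, hu₂, hc₂, hp₂⟩ := hu₁.inc (x := x) (by omega) hb j
        (by rw [Function.update_of_ne hij.symm]; omega)
      obtain ⟨u₃, hr₃, hu₃, hc₃, hp₃⟩ := hu₂.move (x := x) hb (fun f _ => f) d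
      obtain ⟨u₄, hr₄, hu₄, hc₄, hp₄⟩ := hu₃.zero (x := x) (by omega) hb i
      rw [Function.update_of_ne hij.symm] at hu₄ hc₄
      obtain ⟨u₅, hr₅, hu₅, hc₅, hp₅⟩ := ih _ u₄ (by simp [hij, hn]) hu₄
        (by simp [hij]; omega) (by rw [hc₄]) (by omega)
      refine ⟨u₅, .loopTrue (by simp [tsem, hf, hn]) (.seq hr₁ (.seq hr₂ (.seq hr₃ hr₄))) hr₅,
        ?_, ?_, ?_⟩
      · convert hu₅ using 1
        funext a
        by_cases ha : a = j
        · subst ha; simp [hij]; omega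
        · by_cases ha' : a = i
          · subst ha'; simp [ha]
          · simp [ha, ha']
      · rw [hc₅, hc₄, hc₃, hc₂, hc₁]
      · rw [hp₅, hp₄, hp₃, hp₂, hp₁, hn, Function.iterate_succ_apply]
        simp [hij]
  obtain ⟨u₁, hr₁, hu₁, hc₁, hp₁⟩ := hu.zero hpos hb i
  obtain ⟨u₂, hr₂, hu₂, hc₂, hp₂⟩ := key _ v u₁ rfl hu₁ hB (by rw [hc₁]) (by omega)
  exact ⟨u₂, .seq hr₁ hr₂, hu₂, by rw [hc₂, hc₁], by rw [hp₂, hp₁]⟩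

end

/-- Update the control value using the letter at the position stored on tape `i`. Tape `j` is used
as scratch space. -/
noncomputable def fetch {F : Type} {k m : ℕ} (i j : Fin k) (g : F → Option (Fin m) → F) :
    TProg (F × Bool) CSym k m :=
  .seq (rewind _ k m) (.seq (transfer i j .right) (.seq
    (moveProg k m (fun f c => (g f.1 (letterOf c), f.2)) .stay) (transfer j i .stay)))

/-- Cell `0` holds the left endmarker, so the letter with index `v i` lies `v i` cells to the right
of the first letter. The scratch tape `j` collects the count, which is then transferred back with
the head at rest. For `v i = x.length` the right endmarker is scanned, which yields `none`. -/
theorem View.fetch {F : Type} {k m b : ℕ} {x : List (Fin m)} {v : Fin k → ℕ}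
    {u : TStore (F × Bool) CSym k} (hu : View x.length v u)
    (hpos : u.pos ≤ x.length + 1) (hb : Nat.log 2 x.length + 2 < b) {i j : Fin k} (hij : i ≠ j)
    (hi : v i ≤ x.length) (hj : v j = 0) (g : F → Option (Fin m) → F) :
    ∃ u', (tsem b x).Run (fetch i j g) u u' ∧ View x.length v u' ∧
      u'.ctl.1 = g u.ctl.1 x[v i]? ∧ u'.pos ≤ x.length + 1 := by
  obtain ⟨u₁, hr₁, hu₁, hc₁, hp₁⟩ := hu.rewind hpos hb
  obtain ⟨u₂, hr₂, hu₂, hc₂, hp₂⟩ := hu₁.transfer (x := x) (by omega) hb hij .right (by omega)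
  have hp₂' : u₂.pos = v i + 1 := by
    rw [hp₂, hp₁]
    have : ∀ n ≤ x.length,
        (fun p => min (Move.right.apply p) (x.length + 1))^[n] 1 = n + 1 := by
      intro n
      induction n with
      | zero => intro _; rfl
      | succ n ih =>
        intro hn
        rw [Function.iterate_succ_apply', ih (by omega)]
        simp [Move.apply]; omega
    exact this _ hi
  obtain ⟨u₃, hr₃, hu₃, hc₃, hp₃⟩ := hu₂.move (x := x) hb
    (fun f c => (g f.1 (letterOf c), f.2)) .stay
  have hp₃' : u₃.pos = v i + 1 := by
    rw [hp₃, hp₂']; simp [Move.apply]; omega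
  obtain ⟨u₄, hr₄, hu₄, hc₄, hp₄⟩ := hu₃.transfer (x := x) (by omega) hb hij.symm .stay
    (by simp [hij]; omega)
  refine ⟨u₄, .seq hr₁ (.seq hr₂ (.seq hr₃ hr₄)), ?_, ?_, ?_⟩
  · convert hu₄ using 1
    funext a
    by_cases ha : a = i
    · subst ha; simp [hij, hj]
    · by_cases ha' : a = j
      · subst ha'; simp [ha, hj]
      · simp [ha, ha']
  · rw [hc₄, hc₃, hp₂', letterOf_inputAt, hc₂, hc₁]
  · rw [hp₄, hp₃']
    have : ∀ n, (fun p => min (Move.stay.apply p) (x.length + 1))^[n] (v i + 1) = v i + 1 := by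
      intro n
      induction n with
      | zero => rfl
      | succ n ih =>
        rw [Function.iterate_succ_apply', ih]
        simp [Move.apply]; omega
    rw [this]; omega

/-- Translation of the actions of counter programs. -/
noncomputable def tapeAct {F : Type} {k m : ℕ} : Act (Fin k) F m → TProg (F × Bool) CSym (k + 1) m
  | .inc i => onTape m i.castSucc (flipProg true)
  | .dec i => onTape m i.castSucc (flipProg false)
  | .upd g => moveProg _ _ (fun f _ => (g f.1, f.2)) .stay
  | .read i g => fetch i.castSucc (Fin.last k) g

open Classical in
/-- Translation of the tests of counter programs: store the result in the flag. -/
noncomputable def tapeTst {F : Type} {k m : ℕ} : Tst (Fin k) F → TProg (F × Bool) CSym (k + 1) m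
  | .pos i => zeroProg m i.castSucc
  | .flag c => moveProg _ _ (fun f _ => (f.1, decide (c f.1))) .stay

/-- The translated tests inspect the flag. -/
def flagTst {F : Type} {k m : ℕ} : Tst (Fin k) F → TTst (F × Bool) CSym (k + 1) m
  | .pos _ => fun f _ _ => f.2 = false
  | .flag _ => fun f _ _ => f.2 = true

/-- The registers and the scratch register, which holds `0`. -/
abbrev padZero {k : ℕ} (v : Fin k → ℕ) : Fin (k + 1) → ℕ := Fin.snoc (α := fun _ => ℕ) v 0

theorem padZero_castSucc {k : ℕ} (v : Fin k → ℕ) (i : Fin k) : padZero v i.castSucc = v i :=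
  Fin.snoc_castSucc (α := fun _ => ℕ) _ _ _

theorem update_padZero {k : ℕ} (v : Fin k → ℕ) (i : Fin k) (y : ℕ) :
    Function.update (padZero v) i.castSucc y = padZero (Function.update v i y) :=
  (Fin.snoc_update ..).symm

theorem exists_tapeRun {F : Type} {k m b : ℕ} {x : List (Fin m)} (hb : Nat.log 2 x.length + 2 < b)
    (p : CProg (Fin k) F m) {s s' : Store (Fin k) F} (h : (sem x.length x).Run p s s')
    {u : TStore (F × Bool) CSym (k + 1)} (hu : View x.length (padZero s.reg) u)
    (hc : u.ctl.1 = s.ctl) (hp : u.pos ≤ x.length + 1) :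
    ∃ u', (tsem b x).Run (p.bind tapeAct tapeTst flagTst) u u' ∧
      u'.ctl.1 = s'.ctl := by
  obtain ⟨u', hr, hu'⟩ := Sem.Run.bind (M' := tsem b x) (f := tapeAct) (pre := tapeTst)
    (g := flagTst)
    (fun (s : Store (Fin k) F) u => View x.length (padZero s.reg) u ∧ u.ctl.1 = s.ctl ∧
      u.pos ≤ x.length + 1)
    (fun a _ s s' u h hu => by
      obtain ⟨hu, hc, hp⟩ := hu
      cases h with
      | @inc i s h =>
        obtain ⟨u', hr, hu', hc', hp'⟩ := hu.inc hp hb i.castSucc (by rwa [padZero_castSucc])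
        rw [padZero_castSucc, update_padZero] at hu'
        exact ⟨u', hr, hu', by rw [hc', hc], by omega⟩
      | @dec i s h =>
        obtain ⟨u', hr, hu', hc', hp'⟩ := hu.dec hp hb i.castSucc (by rwa [padZero_castSucc])
        rw [padZero_castSucc, update_padZero] at hu'
        exact ⟨u', hr, hu', by rw [hc', hc], by omega⟩
      | upd =>
        obtain ⟨u', hr, hu', hc', hp'⟩ := hu.move (x := x) hb _ .stay
        exact ⟨u', hr, hu', by rw [hc', hc], by rw [hp']; exact min_le_right _ _⟩
      | @read i g s h =>
        obtain ⟨u', hr, hu', hc', hp'⟩ := hu.fetch hp hb (i := i.castSucc) (j := Fin.last k)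
          (Fin.castSucc_lt_last i).ne (by rwa [padZero_castSucc])
          (Fin.snoc_last (α := fun _ => ℕ) _ _) g
        exact ⟨u', hr, hu', by rw [hc', hc, padZero_castSucc], hp'⟩)
    (fun t _ s u hu => by
      obtain ⟨hu, hc, hp⟩ := hu
      cases t with
      | pos i =>
        obtain ⟨u', hr, hu', hc', hp'⟩ := hu.zero hp hb i.castSucc
        exact ⟨u', hr, ⟨hu', by rw [hc', hc], by omega⟩, by
          simp [tsem, sem, Tst.Holds, flagTst, hc']⟩
      | flag c =>
        obtain ⟨u', hr, hu', hc', hp'⟩ := hu.move (x := x) hb _ .stay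
        exact ⟨u', hr, ⟨hu', by rw [hc', hc], by rw [hp']; exact min_le_right _ _⟩, by
          simp [tsem, sem, Tst.Holds, flagTst, hc', hc]⟩)
    p (Prog.forall_of (fun _ => trivial) (fun _ => trivial) p) h ⟨hu, hc, hp⟩
  exact ⟨u', hr, hu'.2.1⟩

theorem CounterDecidable.mem_logspace {A : Type*} {m : ℕ} {e : A ≃ Fin m} {L : Language A}
    (h : CounterDecidable e L) : L ∈ LOGSPACE A := by
  obtain ⟨k, F, _, f₀, acc, p, hp⟩ := h
  -- The first transition writes the markers and so turns blank tapes into counters with value `0`.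
  -- One tape is added as scratch space for `fetch`. The factor `3` ensures `log₂ n + 2 < 3 * (log₂
  -- n + 1)`.
  refine mem_logspace_of_tprog e (F := F × Bool) (Γ := CSym) (k := k + 1)
    (.seq (.act fun f _ _ => (f, .stay, fun _ => (some none, .stay)))
      (p.bind tapeAct tapeTst flagTst)) none (f₀, true) {f | f.1 ∈ acc} 3
    (by norm_num) fun w => ?_
  obtain ⟨s, hs, hL⟩ := hp w
  have hlen : (w.map e).length = w.length := List.length_map _
  obtain ⟨u, hu, hc⟩ := exists_tapeRun (b := 3 * (Nat.log 2 w.length + 1)) (by rw [hlen]; omega)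
    p (by rwa [hlen]) (u := ⟨(f₀, true), 0, fun _ => ctape [], fun _ => 0⟩)
    ⟨fun _ => [], rfl, rfl, fun i => ⟨Nat.zero_le _, by
      refine Fin.lastCases ?_ (fun i => ?_) i
      · simp [padZero, bval]
      · simp [bval]⟩⟩ rfl (Nat.zero_le _)
  refine ⟨u, .seq (.act ⟨?_, fun _ => by simp⟩) hu, by rw [← hL, ← hc]; rfl⟩
  ext1
  · rfl
  · simp [TStore.next, Move.apply]
  · funext i j
    rcases j with _ | j <;> simp [TStore.next, ctape]
  · simp [TStore.next, Move.apply]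

end Logspace

/-! ### Facts of FC-Datalog programs -/

namespace FCDatalog

theorem Atom.Sat.mono {A : Type*} {Rel : Type} {w : List A} {θ : Var → List A} {I J : Facts A Rel}
    (h : I ⊆ J) {φ : Atom A Rel} (hφ : φ.Sat w θ I) : φ.Sat w θ J := by
  cases φ with
  | eqn x α => exact hφ
  | rel R ys => exact ⟨h hφ.1, hφ.2⟩

namespace Program

variable {A : Type*} {P : Program A} {w : List A}

theorem stage_succ (P : Program A) (w : List A) (n : ℕ) :
    P.stage w (n + 1) = P.round w (P.stage w n) :=
  Function.iterate_succ_apply' _ _ _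

theorem stage_mono (P : Program A) (w : List A) : Monotone (P.stage w) :=
  monotone_nat_of_le_succ fun n => by
    rw [stage_succ]
    exact Set.subset_union_left

/-- The derived facts are closed under the rules: a body is a finite list, so all its atoms already
hold at a common stage. -/
theorem fact_of_rule {ρ : Rule A P.Rel} (hρ : ρ ∈ P.rules) {θ : Var → List A}
    (hθ : P.IsWSubst ρ w θ) (h : ∀ φ ∈ ρ.body, φ.Sat w θ (P.facts w)) :
    (ρ.head, ρ.args.map θ) ∈ P.facts w := by
  have key : ∀ l : List (Atom A P.Rel), (∀ φ ∈ l, φ.Sat w θ (P.facts w)) →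
      ∃ n, ∀ φ ∈ l, φ.Sat w θ (P.stage w n) := by
    intro l
    induction l with
    | nil => intro _; exact ⟨0, by simp⟩
    | cons φ l ih =>
      intro h
      obtain ⟨n, hn⟩ := ih fun ψ hψ => h ψ (List.mem_cons_of_mem _ hψ)
      obtain ⟨k, hk⟩ : ∃ k, φ.Sat w θ (P.stage w k) := by
        have := h φ List.mem_cons_self
        cases φ with
        | eqn x α => exact ⟨0, this⟩
        | rel R ys =>
          obtain ⟨⟨k, hk⟩, hy⟩ := this
          exact ⟨k, hk, hy⟩
      refine ⟨max n k, fun ψ hψ => ?_⟩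
      rcases List.mem_cons.1 hψ with rfl | hψ
      · exact hk.mono (P.stage_mono w (le_max_right _ _))
      · exact (hn ψ hψ).mono (P.stage_mono w (le_max_left _ _))
  obtain ⟨n, hn⟩ := key _ h
  refine ⟨n + 1, ?_⟩
  rw [stage_succ]
  exact .inr ⟨ρ, hρ, θ, hθ, hn, rfl⟩

theorem bottom_subset (P : Program A) (ρ : Rule A P.Rel) {x : Var} (hx : x ∈ P.bottom ρ) :
    ∃ R ys, Atom.rel R ys ∈ ρ.body ∧ x ∈ ys := by
  obtain ⟨φ, hφ, hx⟩ := List.mem_flatMap.1 hx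
  have hφ := List.mem_of_mem_filter hφ
  cases φ with
  | eqn y α => simp [Atom.argList] at hx
  | rel R ys => exact ⟨R, ys, hφ, hx⟩

end Program

end FCDatalog

/-! ### Counter programs as deterministic linear FC-Datalog programs -/

namespace Logspace

open FCDatalog

/-- Conditions on the registers under which a rule applies, and their effect. -/
inductive Guard (A : Type*) (k : ℕ)
  | always : Guard A k
  | up (i : Fin k) (a : A) : Guard A k
  | down (i : Fin k) (a : A) : Guard A k
  | peek (i : Fin k) (o : Option A) : Guard A k
  | zero (i : Fin k) : Guard A k
  | pos (i : Fin k) (a : A) : Guard A k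

instance {A : Type*} [Finite A] {k : ℕ} : Finite (Guard A k) := by
  let f : Guard A k → Fin 6 × Option (Fin k) × Option A := fun g => match g with
    | .always => (0, none, none)
    | .up i a => (1, some i, some a)
    | .down i a => (2, some i, some a)
    | .peek i o => (3, some i, o)
    | .zero i => (4, some i, none)
    | .pos i a => (5, some i, some a)
  refine Finite.of_injective f fun g g' h => ?_
  cases g <;> cases g' <;> simp [f] at h ⊢ <;> exact h

/-- The variable of a register. The variables `0`, `1`, `2` are the universe variable, an auxiliary
variable, and the new value of a register. -/
def regVar {k : ℕ} (i : Fin k) : Var := i + 3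

/-- The pattern equations that express a guard. -/
def Guard.eqns {A : Type*} {k : ℕ} : Guard A k → List (Var × Pattern A)
  | .always => [(0, [.inr 0])]
  | .up i a => [(0, [.inr (regVar i), .inl a, .inr 1]), (2, [.inr (regVar i), .inl a])]
  | .down i a => [(regVar i, [.inr 2, .inl a])]
  | .peek i (some a) => [(0, [.inr (regVar i), .inl a, .inr 1])]
  | .peek i none => [(regVar i, [.inr 0])]
  | .zero i => [(regVar i, [])]
  | .pos i a => [(regVar i, [.inl a, .inr 1])]

/-- The variables that hold the registers after an update. -/
def Guard.newVar {A : Type*} {k : ℕ} : Guard A k → Fin k → Var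
  | .up i _, j => if j = i then 2 else regVar j
  | .down i _, j => if j = i then 2 else regVar j
  | _, j => regVar j

/-- The meaning of a guard on words, with the old and the new values of the registers. -/
inductive Guard.Holds {A : Type*} {k : ℕ} (w : List A) :
    Guard A k → (Fin k → List A) → (Fin k → List A) → Prop
  | always {X} : Holds w .always X X
  | up {i a X z} : w = X i ++ a :: z → Holds w (.up i a) X (Function.update X i (X i ++ [a]))
  | down {i a X y} : X i = y ++ [a] → Holds w (.down i a) X (Function.update X i y)
  | peekSome {i a X z} : w = X i ++ a :: z → Holds w (.peek i (some a)) X X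
  | peekNone {i X} : X i = w → Holds w (.peek i none) X X
  | zero {i X} : X i = [] → Holds w (.zero i) X X
  | pos {i a X z} : X i = a :: z → Holds w (.pos i a) X X

/-- The equations force the guard whatever the auxiliary variables are. This direction yields
determinism as well as soundness of the derived facts. -/
theorem Guard.holds_of_eqns {A : Type*} {k : ℕ} {w : List A} {g : Guard A k} {θ : Var → List A}
    (hw : θ 0 = w) (h : ∀ q ∈ g.eqns, θ q.1 = Pattern.image θ q.2) :
    g.Holds w (fun i => θ (regVar i)) (fun i => θ (g.newVar i)) := by
  have hupd : ∀ i : Fin k, (fun j => θ (if j = i then 2 else regVar j)) =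
      Function.update (fun j => θ (regVar j)) i (θ 2) := by
    intro i
    funext j
    by_cases hj : j = i
    · subst hj; simp
    · simp [hj]
  cases g with
  | always => exact .always
  | up i a =>
    simp [eqns, Pattern.image, symbolImage, hw] at h
    simp only [newVar, hupd, h.2]
    exact .up h.1
  | down i a =>
    simp [eqns, Pattern.image, symbolImage] at h
    simp only [newVar, hupd]
    exact .down h
  | peek i o =>
    cases o with
    | some a =>
      simp [eqns, Pattern.image, symbolImage, hw] at h
      exact .peekSome h
    | none =>
      simp [eqns, Pattern.image, symbolImage, hw] at h
      exact .peekNone h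
  | zero i =>
    simp [eqns, Pattern.image] at h
    exact .zero h
  | pos i a =>
    simp [eqns, Pattern.image, symbolImage] at h
    exact .pos h

/-- The substitution with given values. -/
def valuation {A : Type*} {k : ℕ} (w z y : List A) (X : Fin k → List A) : Var → List A
  | 0 => w
  | 1 => z
  | 2 => y
  | v + 3 => if h : v < k then X ⟨v, h⟩ else []

theorem valuation_regVar {A : Type*} {k : ℕ} (w z y : List A) (X : Fin k → List A) (i : Fin k) :
    valuation w z y X (regVar i) = X i := by
  simp [valuation, regVar]

theorem valuation_aux {A : Type*} {k : ℕ} (w z y : List A) (X : Fin k → List A) :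
    valuation w z y X 0 = w ∧ valuation w z y X 1 = z ∧ valuation w z y X 2 = y :=
  ⟨rfl, rfl, rfl⟩

theorem valuation_infix {A : Type*} {k : ℕ} {w z y : List A} {X : Fin k → List A}
    (hz : z <:+: w) (hy : y <:+: w) (hX : ∀ i, X i <:+: w) (v : Var) :
    valuation w z y X v <:+: w := by
  rcases v with _ | _ | _ | v
  · exact List.infix_rfl
  · exact hz
  · exact hy
  · simp only [valuation]
    split_ifs
    · exact hX _
    · exact List.nil_infix

/-- Variable `1` takes the rest of the word behind the inspected letter and variable `2` the new
register content; both are factors of `w`. -/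
theorem Guard.Holds.exists_valuation {A : Type*} {k : ℕ} {w : List A} {g : Guard A k}
    {X X' : Fin k → List A} (h : g.Holds w X X') (hX : ∀ i, X i <:+: w) :
    ∃ θ : Var → List A, θ 0 = w ∧ (∀ v, θ v <:+: w) ∧ (∀ i, θ (regVar i) = X i) ∧
      (∀ i, θ (g.newVar i) = X' i) ∧ ∀ q ∈ g.eqns, θ q.1 = Pattern.image θ q.2 := by
  have hnil : ([] : List A) <:+: w := List.nil_infix
  cases h with
  | always =>
    exact ⟨valuation w [] [] X, rfl, valuation_infix hnil hnil hX, valuation_regVar _ _ _ _,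
      valuation_regVar _ _ _ _, by simp [eqns, Pattern.image, symbolImage]⟩
  | @up i a _ z h =>
    refine ⟨valuation w z (X i ++ [a]) X, rfl, valuation_infix ⟨X i ++ [a], [], by simp [h]⟩
      ⟨[], z, by simp [h]⟩ hX, valuation_regVar _ _ _ _, fun j => ?_, ?_⟩
    · by_cases hj : j = i
      · subst hj; simp [newVar, valuation_aux]
      · simp [newVar, hj, valuation_regVar]
    · simp [eqns, Pattern.image, symbolImage, valuation_regVar, valuation_aux, h]
  | @down i a _ y h =>
    refine ⟨valuation w [] y X, rfl, valuation_infix hnil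
      (List.IsInfix.trans ⟨[], [a], by simp [h]⟩ (hX i)) hX, valuation_regVar _ _ _ _,
      fun j => ?_, ?_⟩
    · by_cases hj : j = i
      · subst hj; simp [newVar, valuation_aux]
      · simp [newVar, hj, valuation_regVar]
    · simp [eqns, Pattern.image, symbolImage, valuation_regVar, valuation_aux, h]
  | @peekSome i a _ z h =>
    exact ⟨valuation w z [] X, rfl, valuation_infix ⟨X i ++ [a], [], by simp [h]⟩ hnil hX,
      valuation_regVar _ _ _ _, valuation_regVar _ _ _ _, by
        simp [eqns, Pattern.image, symbolImage, valuation_regVar, valuation_aux, h]⟩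
  | @peekNone i _ h =>
    exact ⟨valuation w [] [] X, rfl, valuation_infix hnil hnil hX, valuation_regVar _ _ _ _,
      valuation_regVar _ _ _ _, by
        simp [eqns, Pattern.image, symbolImage, valuation_regVar, valuation_aux, h]⟩
  | @zero i _ h =>
    exact ⟨valuation w [] [] X, rfl, valuation_infix hnil hnil hX, valuation_regVar _ _ _ _,
      valuation_regVar _ _ _ _, by simp [eqns, Pattern.image, valuation_regVar, h]⟩
  | @pos i a _ z h =>
    refine ⟨valuation w z [] X, rfl, valuation_infix
      (List.IsInfix.trans ⟨[a], [], by simp [h]⟩ (hX i)) hnil hX, valuation_regVar _ _ _ _,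
      valuation_regVar _ _ _ _, ?_⟩
    simp [eqns, Pattern.image, symbolImage, valuation_regVar, valuation_aux, h]

/-- The steps of a counter program on its finite control, with their guards. -/
inductive Edge {A : Type*} {F : Type} {k m : ℕ} (e : A ≃ Fin m) :
    List (CProg (Fin k) F m) → F → Guard A k → List (CProg (Fin k) F m) → F → Prop
  | skip {l f} : Edge e (.skip :: l) f .always l f
  | inc {i l f} (a : A) : Edge e (.act (.inc i) :: l) f (.up i a) l f
  | dec {i l f} (a : A) : Edge e (.act (.dec i) :: l) f (.down i a) l f
  | upd {g l f} : Edge e (.act (.upd g) :: l) f .always l (g f)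
  | read {i g l f} (o : Option A) :
      Edge e (.act (.read i g) :: l) f (.peek i o) l (g f (o.map e))
  | seq {p q l f} : Edge e (.seq p q :: l) f .always (p :: q :: l) f
  | iteZero {i p q l f} : Edge e (.ite (.pos i) p q :: l) f (.zero i) (q :: l) f
  | itePos {i p q l f} (a : A) : Edge e (.ite (.pos i) p q :: l) f (.pos i a) (p :: l) f
  | iteTrue {b p q l f} : b f → Edge e (.ite (.flag b) p q :: l) f .always (p :: l) f
  | iteFalse {b p q l f} : ¬ b f → Edge e (.ite (.flag b) p q :: l) f .always (q :: l) f
  | loopZero {i p l f} : Edge e (.loop (.pos i) p :: l) f (.zero i) l f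
  | loopPos {i p l f} (a : A) :
      Edge e (.loop (.pos i) p :: l) f (.pos i a) (p :: .loop (.pos i) p :: l) f
  | loopTrue {b p l f} : b f →
      Edge e (.loop (.flag b) p :: l) f .always (p :: .loop (.flag b) p :: l) f
  | loopFalse {b p l f} : ¬ b f → Edge e (.loop (.flag b) p :: l) f .always l f

section

variable {A : Type*} {F : Type} {k m : ℕ} {e : A ≃ Fin m} {w : List A}
  {l l₁ l₂ : List (CProg (Fin k) F m)} {f f₁ f₂ : F} {g g₁ g₂ : Guard A k}
  {X X₁ X₂ : Fin k → List A}

theorem Edge.next (h : Edge e l f g l₁ f₁) : Next l l₁ := by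
  cases h <;> constructor

theorem Edge.unique (h₁ : Edge e l f g l₁ f₁) (h₂ : Edge e l f g l₂ f₂) : l₁ = l₂ ∧ f₁ = f₂ := by
  cases h₁ <;> cases h₂ <;> first | exact ⟨rfl, rfl⟩ | contradiction

theorem Guard.Holds.unique (h₁ : g.Holds w X X₁) (h₂ : g.Holds w X X₂) : X₁ = X₂ := by
  cases h₁ with
  | down h₁ =>
    cases h₂ with
    | down h₂ =>
      rw [h₁] at h₂
      rw [List.append_cancel_right h₂]
  | _ => cases h₂; rfl

/-- The content `X i` determines its first and its last letter and, being a prefix of `w`, the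
letter that follows it. Emptiness excludes a first letter, and `X i = w` excludes a following one.
This is the source of global determinism. -/
theorem Edge.guard_unique (h₁ : Edge e l f g₁ l₁ f₁) (h₂ : Edge e l f g₂ l₂ f₂)
    (hX₁ : g₁.Holds w X X₁) (hX₂ : g₂.Holds w X X₂) : g₁ = g₂ := by
  cases h₁ <;> cases h₂ <;> first
    | rfl
    | (cases hX₁ <;> cases hX₂ <;> simp_all)

theorem take_append_singleton {A : Type*} {w : List A} {n : ℕ} {a : A} (h : w[n]? = some a) :
    w.take n ++ [a] = w.take (n + 1) := by
  rw [List.take_add_one, h]; rfl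

theorem eq_take_append_iff {A : Type*} {w : List A} {n : ℕ} (hn : n ≤ w.length) {a : A} :
    (∃ z, w = w.take n ++ a :: z) ↔ w[n]? = some a := by
  constructor
  · rintro ⟨z, h⟩
    rw [h, List.getElem?_append_right (by simp)]
    simp [hn]
  · intro h
    refine ⟨w.drop (n + 1), ?_⟩
    obtain ⟨hn', rfl⟩ := List.getElem?_eq_some_iff.1 h
    rw [List.getElem_cons_drop, List.take_append_drop]

/-- The words that represent the values of the registers. -/
def regWords (w : List A) (s : Store (Fin k) F) : Fin k → List A := fun i => w.take (s.reg i)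

theorem update_regWords (w : List A) (s : Store (Fin k) F) (f : F) (i : Fin k) (y : ℕ) :
    Function.update (regWords w s) i (w.take y) =
      regWords w (⟨f, Function.update s.reg i y⟩ : Store (Fin k) F) := by
  funext j
  by_cases hj : j = i
  · subst hj; simp [regWords]
  · simp [regWords, hj]

theorem bounded_update {ι : Type} [DecidableEq ι] {B : ℕ} {v : ι → ℕ} (h : ∀ i, v i ≤ B) (i : ι)
    {y : ℕ} (hy : y ≤ B) (j : ι) : Function.update v i y j ≤ B := by
  by_cases hj : j = i
  · subst hj; simpa using hy
  · simpa [hj] using h j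

/-- Values up to `|w|` can be recovered from the prefixes that represent them, so a guard on words
amounts to the condition on numbers under which the step is possible. -/
theorem Edge.small {s : Store (Fin k) F} (hs : ∀ i, s.reg i ≤ w.length)
    (h : Edge e l s.ctl g l₁ f₁) (hX : g.Holds w (regWords w s) X₁) :
    ∃ s' : Store (Fin k) F, (sem w.length (w.map e)).Small (l, s) (l₁, s') ∧ s'.ctl = f₁ ∧
      X₁ = regWords w s' ∧ ∀ i, s'.reg i ≤ w.length := by
  have hlen : (w.map e).length = w.length := List.length_map _
  have hzero : ∀ i, regWords w s i = [] → s.reg i = 0 := by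
    intro i h
    rcases List.take_eq_nil_iff.1 h with h | rfl
    · exact h
    · simpa using hs i
  have hpos : ∀ i a z, regWords w s i = a :: z → s.reg i ≠ 0 := by
    intro i a z h h0
    simp [regWords, h0] at h
  generalize hf : s.ctl = f at h
  cases h with
  | skip => cases hX; exact ⟨s, .skip, hf, rfl, hs⟩
  | upd => cases hX; exact ⟨⟨_, s.reg⟩, .act .upd, by rw [hf], rfl, hs⟩
  | seq => cases hX; exact ⟨s, .seq, hf, rfl, hs⟩
  | @inc i _ _ a =>
    cases hX with
    | @up _ _ _ z h =>
      have ha := (eq_take_append_iff (hs i)).1 ⟨z, h⟩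
      have hlt := (List.getElem?_eq_some_iff.1 ha).1
      refine ⟨_, .act (.inc hlt), hf, ?_, bounded_update hs i hlt⟩
      rw [← update_regWords w s, ← take_append_singleton ha]
      rfl
  | @dec i _ _ a =>
    cases hX with
    | @down _ _ _ y h =>
      have h0 : 0 < s.reg i := by
        rcases Nat.eq_zero_or_pos (s.reg i) with h0 | h0
        · simp [regWords, h0] at h
        · exact h0
      refine ⟨_, .act (.dec h0), hf, ?_, bounded_update hs i ((Nat.sub_le _ _).trans (hs i))⟩
      rw [← update_regWords w s]
      congr 1
      have := congrArg List.dropLast h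
      rw [List.dropLast_concat, regWords, List.dropLast_eq_take, List.take_take, List.length_take,
        min_eq_left (hs i), min_eq_left (Nat.sub_le _ _)] at this
      exact this.symm
  | @read i _ _ _ o =>
    cases hX with
    | @peekSome _ a _ z h =>
      have ha := (eq_take_append_iff (hs i)).1 ⟨z, h⟩
      refine ⟨_, .act (.read (by rw [hlen]; exact hs i)), ?_, rfl, hs⟩
      simp [hf, ha]
    | @peekNone _ _ h =>
      refine ⟨_, .act (.read (by rw [hlen]; exact hs i)), ?_, rfl, hs⟩
      have : w.length ≤ s.reg i := List.take_eq_self_iff _ |>.1 h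
      simp [hf, this]
  | iteZero =>
    cases hX with
    | zero h => exact ⟨s, .iteFalse (not_not.2 (hzero _ h)), hf, rfl, hs⟩
  | itePos a =>
    cases hX with
    | pos h => exact ⟨s, .iteTrue (hpos _ _ _ h), hf, rfl, hs⟩
  | iteTrue hb => cases hX; exact ⟨s, .iteTrue (by rw [← hf] at hb; exact hb), hf, rfl, hs⟩
  | iteFalse hb => cases hX; exact ⟨s, .iteFalse (by rw [← hf] at hb; exact hb), hf, rfl, hs⟩
  | loopZero =>
    cases hX with
    | zero h => exact ⟨s, .loopFalse (not_not.2 (hzero _ h)), hf, rfl, hs⟩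
  | loopPos a =>
    cases hX with
    | pos h => exact ⟨s, .loopTrue (hpos _ _ _ h), hf, rfl, hs⟩
  | loopTrue hb => cases hX; exact ⟨s, .loopTrue (by rw [← hf] at hb; exact hb), hf, rfl, hs⟩
  | loopFalse hb => cases hX; exact ⟨s, .loopFalse (by rw [← hf] at hb; exact hb), hf, rfl, hs⟩

/-- The register bounds supply the letters that the guards ask for: a register that can be
incremented is followed by a letter, and a positive one is a nonempty prefix. -/
theorem exists_edge {s s' : Store (Fin k) F} (hs : ∀ i, s.reg i ≤ w.length)
    (h : (sem w.length (w.map e)).Small (l, s) (l₁, s')) :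
    ∃ g : Guard A k, Edge e l s.ctl g l₁ s'.ctl ∧ g.Holds w (regWords w s) (regWords w s') ∧
      ∀ i, s'.reg i ≤ w.length := by
  have hpos : ∀ i, s.reg i ≠ 0 → ∃ a z, regWords w s i = a :: z := by
    intro i h0
    have h1 : regWords w s i ≠ [] := by
      intro h
      rcases List.take_eq_nil_iff.1 h with h | rfl
      · exact h0 h
      · exact h0 (by simpa using hs i)
    exact List.exists_cons_of_ne_nil h1
  cases h with
  | skip => exact ⟨_, .skip, .always, hs⟩
  | seq => exact ⟨_, .seq, .always, hs⟩
  | act h =>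
    cases h with
    | @inc i _ h =>
      have ha : w[s.reg i]? = some w[s.reg i] := List.getElem?_eq_getElem h
      obtain ⟨z, hz⟩ := (eq_take_append_iff (hs i)).2 ha
      refine ⟨_, .inc w[s.reg i], ?_, bounded_update hs i h⟩
      rw [← update_regWords w s, ← take_append_singleton ha]
      exact .up hz
    | @dec i _ h =>
      have h' : s.reg i - 1 < w.length := by have := hs i; omega
      have ha : w[s.reg i - 1]? = some w[s.reg i - 1] := List.getElem?_eq_getElem h'
      refine ⟨_, .dec w[s.reg i - 1], ?_, bounded_update hs i (by omega)⟩
      rw [← update_regWords w s]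
      refine .down ?_
      rw [take_append_singleton ha, regWords, Nat.sub_add_cancel h]
    | upd => exact ⟨_, .upd, .always, hs⟩
    | @read i g _ h =>
      refine ⟨.peek i w[s.reg i]?, ?_, ?_, hs⟩
      · rw [List.getElem?_map]
        exact .read _
      · cases ha : w[s.reg i]? with
        | some a =>
          obtain ⟨z, hz⟩ := (eq_take_append_iff (hs i)).2 ha
          exact .peekSome hz
        | none => exact .peekNone (List.take_of_length_le (List.getElem?_eq_none_iff.1 ha))
  | @iteTrue _ t p q _ h =>
    cases t with
    | pos i =>
      obtain ⟨a, z, hz⟩ := hpos i h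
      exact ⟨_, .itePos a, .pos hz, hs⟩
    | flag b => exact ⟨_, .iteTrue h, .always, hs⟩
  | @iteFalse _ t p q _ h =>
    cases t with
    | pos i => exact ⟨_, .iteZero,
        .zero (i := i) (by simp [regWords, show s.reg i = 0 from not_not.1 h]), hs⟩
    | flag b => exact ⟨_, .iteFalse h, .always, hs⟩
  | @loopTrue _ t p _ h =>
    cases t with
    | pos i =>
      obtain ⟨a, z, hz⟩ := hpos i h
      exact ⟨_, .loopPos a, .pos hz, hs⟩
    | flag b => exact ⟨_, .loopTrue h, .always, hs⟩
  | @loopFalse _ t p _ h =>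
    cases t with
    | pos i => exact ⟨_, .loopZero,
        .zero (i := i) (by simp [regWords, show s.reg i = 0 from not_not.1 h]), hs⟩
    | flag b => exact ⟨_, .loopFalse h, .always, hs⟩

end

end Logspace

/-! ### The FC-Datalog program of a counter program -/

namespace Logspace

open FCDatalog

theorem _root_.FCDatalog.Program.length_recursiveAtoms_le {A : Type*} (P : Program A)
    {ρ : Rule A P.Rel} {l : List (Var × Pattern A)} {l' : List (Atom A P.Rel)} (hl' : l'.length ≤ 1)
    (h : ρ.body = (l.map fun z => Atom.eqn z.1 z.2) ++ l') : (P.recursiveAtoms ρ).length ≤ 1 := by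
  rw [Program.recursiveAtoms, h, List.filter_append, List.filter_eq_nil_iff.2, List.nil_append]
  · exact (List.length_filter_le _ _).trans hl'
  · intro φ hφ
    obtain ⟨z, -, rfl⟩ := List.mem_map.1 hφ
    exact fun h => @of_decide_eq_true _ (Classical.propDecidable _) h

theorem Sem.Small.deterministic {α β S : Type} {M : Sem α β S}
    (hM : ∀ a s s₁ s₂, M.act a s s₁ → M.act a s s₂ → s₁ = s₂) {z z₁ z₂ : List (Prog α β) × S}
    (h₁ : M.Small z z₁) (h₂ : M.Small z z₂) : z₁ = z₂ := by
  cases h₁ <;> cases h₂ <;> first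
    | rfl
    | contradiction
    | (rename_i _ h _ h'; rw [hM _ _ _ _ h h'])

theorem Sem.Small.halt_unique {α β S : Type} {M : Sem α β S}
    (hM : ∀ a s s₁ s₂, M.act a s s₁ → M.act a s s₂ → s₁ = s₂) {z : List (Prog α β) × S} {s₁ s₂ : S}
    (h₁ : Relation.ReflTransGen M.Small z ([], s₁))
    (h₂ : Relation.ReflTransGen M.Small z ([], s₂)) :
    s₁ = s₂ := by
  induction h₁ using Relation.ReflTransGen.head_induction_on with
  | refl =>
    rcases h₂.cases_head with h | ⟨z, h, -⟩
    · exact (Prod.ext_iff.1 h).2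
    · cases h
  | head h _ ih =>
    rcases h₂.cases_head with rfl | ⟨z, h', h''⟩
    · cases h
    · rw [Sem.Small.deterministic hM h' h] at h''
      exact ih h''

theorem ActStep.deterministic {ι F : Type} [DecidableEq ι] {m B : ℕ} {x : List (Fin m)}
    (a : Act ι F m) (s s₁ s₂ : Store ι F) (h₁ : ActStep B x a s s₁) (h₂ : ActStep B x a s s₂) :
    s₁ = s₂ := by
  cases h₁ <;> cases h₂ <;> rfl

section Compile

variable {A : Type*} {F : Type} {k m : ℕ} (e : A ≃ Fin m)
  (p : CProg (Fin k) F m) (f₀ : F) (acc : Set F)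

/-- The finite control of a counter program. -/
abbrev Control : Type := {l // l ∈ p.conts []} × F

/-- The variables of the registers. -/
def regVars (k : ℕ) : List Var := List.ofFn (regVar (k := k))

/-- The rule for an edge. -/
def edgeRule (q : Control p) (g : Guard A k) (q' : Control p) : Rule A (Option (Control p)) where
  head := some q
  args := regVars k
  body := (g.eqns.map fun z => .eqn z.1 z.2) ++ [.rel (some q') (List.ofFn g.newVar)]

/-- The rule for a halting configuration. -/
def haltRule (q : Control p) : Rule A (Option (Control p)) where
  head := some q
  args := regVars k
  -- The trivial equations make the head variables occur in the body; the first one keeps the body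
  -- nonempty if `k = 0`.
  body := .eqn 0 [.inr 0] :: (regVars k).map fun x => .eqn x [.inr x]

/-- The rule that derives the output. -/
def startRule : Rule A (Option (Control p)) where
  head := none
  args := []
  body := .eqn 0 [.inr 0] :: ((regVars k).map fun x => .eqn x []) ++
    [.rel (some (⟨[p], p.self_mem_conts []⟩, f₀)) (regVars k)]

/-- The rules of the program for a counter program. -/
def ruleSet : Set (Rule A (Option (Control p))) :=
  {ρ | ∃ q g q', Edge e q.1.1 q.2 g q'.1.1 q'.2 ∧ ρ = edgeRule p q g q'} ∪
    ({ρ | ∃ q : Control p, q.1.1 = [] ∧ q.2 ∈ acc ∧ ρ = haltRule p q} ∪ {startRule p f₀})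

theorem mem_regVars {x : Var} : x ∈ regVars k ↔ ∃ i : Fin k, regVar i = x := by
  simp [regVars, List.mem_ofFn]

/-- At most the updated register is missing among the arguments of the recursive call, and that one
occurs in an equation of the guard. -/
theorem edgeRule_safe (q : Control p) (g : Guard A k) (q' : Control p) (i : Fin k) :
    regVar i ∈ (edgeRule p q g q').vars := by
  have hnew : (∃ j, g.newVar j = regVar i) → regVar i ∈ (edgeRule p q g q').vars := fun h =>
    ⟨.rel (some q') (List.ofFn g.newVar), by simp [edgeRule], by
      simpa [Atom.vars, List.mem_ofFn] using h⟩
  have heqn : (∃ z ∈ g.eqns, regVar i = z.1 ∨ Sum.inr (regVar i) ∈ z.2) →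
      regVar i ∈ (edgeRule p q g q').vars := by
    rintro ⟨z, hz, h⟩
    exact ⟨.eqn z.1 z.2, by
      simp only [edgeRule, List.mem_append, List.mem_map]
      exact .inl ⟨z, hz, rfl⟩, by
      simpa [Atom.vars, Pattern.vars] using h⟩
  cases g with
  | up j a =>
    by_cases h : i = j
    · exact heqn ⟨(2, [.inr (regVar j), .inl a]), by simp [Guard.eqns], .inr (by simp [h])⟩
    · exact hnew ⟨i, by simp [Guard.newVar, h]⟩
  | down j a =>
    by_cases h : i = j
    · exact heqn ⟨(regVar j, [.inr 2, .inl a]), by simp [Guard.eqns], .inl (by simp [h])⟩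
    · exact hnew ⟨i, by simp [Guard.newVar, h]⟩
  | _ => exact hnew ⟨i, rfl⟩

theorem mem_edgeRule {q q' : Control p} {g : Guard A k} {φ : Atom A (Option (Control p))} :
    φ ∈ (edgeRule p q g q').body ↔
      (∃ z ∈ g.eqns, φ = .eqn z.1 z.2) ∨ φ = .rel (some q') (List.ofFn g.newVar) := by
  simp [edgeRule, eq_comm]

theorem mem_haltRule {q : Control p} {φ : Atom A (Option (Control p))} :
    φ ∈ (haltRule p q).body ↔
      φ = .eqn 0 [.inr 0] ∨ ∃ i : Fin k, φ = .eqn (regVar i) [.inr (regVar i)] := by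
  simp [haltRule, mem_regVars, eq_comm]

theorem mem_startRule {φ : Atom A (Option (Control p))} :
    φ ∈ (startRule p f₀).body ↔ φ = .eqn 0 [.inr 0] ∨ (∃ i : Fin k, φ = .eqn (regVar i) []) ∨
      φ = .rel (some (⟨[p], p.self_mem_conts []⟩, f₀)) (regVars k) := by
  simp [startRule, mem_regVars, eq_comm]

theorem holds_of_satEqns {w : List A} {p : CProg (Fin k) F m} {q q' : Control p} {g : Guard A k}
    {θ : Var → List A}
    (hw : θ 0 = w) (h : (edgeRule p q g q').SatEqns w θ) :
    g.Holds w (fun i => θ (regVar i)) (fun i => θ (g.newVar i)) :=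
  Guard.holds_of_eqns hw fun z hz => (h z.1 z.2
    ((mem_edgeRule _).2 (.inl ⟨z, hz, rfl⟩))).1

/-- The fact that represents a configuration. -/
def cfgFact (w : List A) {p : CProg (Fin k) F m} (q : Control p) (v : Fin k → ℕ) :
    Option (Control p) × List (List A) :=
  (some q, List.ofFn (regWords w (⟨q.2, v⟩ : Store (Fin k) F)))

theorem cfgFact_eq {w : List A} {p : CProg (Fin k) F m} (q : Control p) {v : Fin k → ℕ}
    {θ : Var → List A}
    {y : Fin k → Var} (h : ∀ i, θ (y i) = w.take (v i)) :
    cfgFact w q v = (some q, (List.ofFn y).map θ) := by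
  rw [List.map_ofFn, show θ ∘ y = regWords w ⟨q.2, v⟩ from funext h]
  rfl

variable [Finite A] [Finite F]

instance : Finite (Control p) := by
  have : Finite {l // l ∈ p.conts []} := p.conts_finite []
  infer_instance

theorem ruleSet_finite : (ruleSet e p f₀ acc).Finite := by
  refine Set.Finite.union ?_ (Set.Finite.union ?_ (Set.finite_singleton _))
  · refine (Set.finite_range fun z : Control p × Guard A k × Control p =>
      edgeRule p z.1 z.2.1 z.2.2).subset ?_
    rintro _ ⟨q, g, q', -, rfl⟩
    exact ⟨(q, g, q'), rfl⟩
  · refine (Set.finite_range fun q : Control p => haltRule (A := A) p q).subset ?_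
    rintro _ ⟨q, -, -, rfl⟩
    exact ⟨q, rfl⟩

/-- The FC-Datalog program for a counter program. -/
noncomputable def datalog : Program A where
  univVar := 0
  Rel := Option (Control p)
  finiteRel := inferInstance
  ar R := R.elim 0 fun _ => k
  Ans := none
  rules := (ruleSet_finite e p f₀ acc).toFinset
  wellFormed ρ hρ := by
    rw [Set.Finite.mem_toFinset] at hρ
    rcases hρ with ⟨q, g, q', -, rfl⟩ | ⟨q, -, -, rfl⟩ | rfl
    · refine ⟨by simp [edgeRule, regVars], fun φ hφ => ?_, by simp [edgeRule], fun x hx => ?_⟩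
      · rcases List.mem_append.1 hφ with hφ | hφ
        · obtain ⟨z, -, rfl⟩ := List.mem_map.1 hφ
          trivial
        · rw [List.mem_singleton.1 hφ]
          simp [Atom.RespectsArity]
      · obtain ⟨i, rfl⟩ := mem_regVars.1 hx
        exact edgeRule_safe p q g q' i
    · refine ⟨by simp [haltRule, regVars], fun φ hφ => ?_, by simp [haltRule], fun x hx => ?_⟩
      · rcases List.mem_cons.1 hφ with rfl | hφ
        · trivial
        · obtain ⟨z, -, rfl⟩ := List.mem_map.1 hφ
          trivial
      · exact ⟨.eqn x [.inr x], List.mem_cons_of_mem _ (List.mem_map_of_mem hx), by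
          simp [Atom.vars]⟩
    · refine ⟨by simp [startRule], fun φ hφ => ?_, by simp [startRule], by simp [startRule]⟩
      simp only [startRule, List.cons_append, List.mem_cons, List.mem_append, List.mem_map,
        List.not_mem_nil, or_false] at hφ
      rcases hφ with rfl | ⟨z, -, rfl⟩ | rfl
      · trivial
      · trivial
      · simp [Atom.RespectsArity, regVars]

theorem mem_datalog_rules {ρ : Rule A (Option (Control p))} :
    ρ ∈ (datalog e p f₀ acc).rules ↔ ρ ∈ ruleSet e p f₀ acc :=
  Set.Finite.mem_toFinset _

/-- No body has more than one relation atom, so it does not matter which symbols are mutually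
recursive. -/
theorem datalog_isLinear : (datalog e p f₀ acc).IsLinear := by
  intro ρ hρ
  rcases (mem_datalog_rules e p f₀ acc).1 hρ with ⟨q, g, q', -, rfl⟩ | ⟨q, -, -, rfl⟩ | rfl
  · exact Program.length_recursiveAtoms_le _ (l := g.eqns) le_rfl rfl
  · exact Program.length_recursiveAtoms_le _ (l := (0, [.inr 0]) :: (regVars k).map fun x =>
      (x, [.inr x])) (l' := []) (Nat.zero_le _) (by simp [haltRule]; rfl)
  · exact Program.length_recursiveAtoms_le _ (l := (0, [.inr 0]) :: (regVars k).map fun x =>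
      (x, [])) (l' := [.rel (some (⟨[p], p.self_mem_conts []⟩, f₀)) (regVars k)]) le_rfl
      (by simp [startRule]; rfl)

variable {e p f₀ acc}

theorem map_top {q : Option (Control p)} {body : List (Atom A (Option (Control p)))}
    {θ θ' : Var → List A}
    (h : ((datalog e p f₀ acc).top ⟨q, regVars k, body⟩).map θ =
      ((datalog e p f₀ acc).top ⟨q, regVars k, body⟩).map θ') (i : Fin k) :
    θ (regVar i) = θ' (regVar i) := by
  have := List.map_inj_left.1 h (regVar i)
    (List.mem_append_left _ (mem_regVars.2 ⟨i, rfl⟩))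
  exact this

/-- Bottom variables are arguments of the only relation atom. For an edge they hold the new
registers, which the guard computes from the old ones; in the start rule the equations force them to
be empty. -/
theorem datalog_locallyDeterministic : (datalog e p f₀ acc).LocallyDeterministic := by
  rintro w ρ hρ t b b' ⟨θ, hθ, hs, h⟩ ⟨θ', hθ', hs', h'⟩
  obtain ⟨rfl, rfl⟩ := Prod.ext_iff.1 h
  obtain ⟨ht, rfl⟩ := Prod.ext_iff.1 h'
  simp only at ht ⊢
  refine List.map_congr_left fun x hx => ?_
  obtain ⟨R, ys, hR, hx⟩ := Program.bottom_subset _ _ hx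
  rcases (mem_datalog_rules e p f₀ acc).1 hρ with ⟨q, g, q', -, rfl⟩ | ⟨q, -, -, rfl⟩ | rfl
  · have h₁ := holds_of_satEqns hθ.1 hs
    have h₂ := holds_of_satEqns hθ'.1 hs'
    rw [show (fun i : Fin k => θ' (regVar i)) = fun i => θ (regVar i) from
      funext fun i => (map_top ht i).symm] at h₂
    have h₃ := h₁.unique h₂
    rcases (mem_edgeRule p).1 hR with ⟨z, -, hz⟩ | hR
    · cases hz
    · cases hR
      obtain ⟨i, rfl⟩ := (List.mem_ofFn' _ _).1 hx
      exact congrFun h₃ i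
  · rcases (mem_haltRule p).1 hR with hR | ⟨i, hR⟩ <;> cases hR
  · rcases (mem_startRule p f₀).1 hR with hR | ⟨i, hR⟩ | hR
    · cases hR
    · cases hR
    · cases hR
      obtain ⟨i, rfl⟩ := mem_regVars.1 hx
      have hx' := (mem_startRule (A := A) p f₀).2 (.inr (.inl ⟨i, rfl⟩))
      rw [(hs _ _ hx').1, (hs' _ _ hx').1]
      rfl

/-- Equal heads mean equal control points. Two edges from there are told apart by their guards, and
a halting point has the empty continuation, which no edge leaves. -/
theorem datalog_globallyDeterministic : (datalog e p f₀ acc).GloballyDeterministic := by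
  rintro w ρ hρ χ hχ hhead hne ⟨t, b, b', ⟨θ, hθ, hs, h⟩, ⟨θ', hθ', hs', h'⟩⟩
  obtain ⟨rfl, rfl⟩ := Prod.ext_iff.1 h
  obtain ⟨ht, -⟩ := Prod.ext_iff.1 h'
  simp only at ht
  apply hne
  rcases (mem_datalog_rules e p f₀ acc).1 hρ with ⟨q, g, q', hE, rfl⟩ | ⟨q, hq, -, rfl⟩ | rfl <;>
  rcases (mem_datalog_rules e p f₀ acc).1 hχ with ⟨r, g', r', hE', rfl⟩ | ⟨r, hr, -, rfl⟩ | rfl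
  · cases hhead
    have h₁ := holds_of_satEqns hθ.1 hs
    have h₂ := holds_of_satEqns hθ'.1 hs'
    rw [show (fun i : Fin k => θ' (regVar i)) = fun i => θ (regVar i) from
      funext fun i => (map_top (e := e) (f₀ := f₀) (acc := acc) (q := some q) (body := []) ht
        i).symm] at h₂
    have hg := hE.guard_unique hE' h₁ h₂
    subst hg
    obtain ⟨h₃, h₄⟩ := hE.unique hE'
    rw [show q' = r' from Prod.ext (Subtype.ext h₃) h₄]
  · cases hhead
    rw [hr] at hE
    cases hE
  · cases hhead
  · cases hhead
    rw [hq] at hE'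
    cases hE'
  · cases hhead
    rfl
  · cases hhead
  · cases hhead
  · cases hhead
  · rfl

theorem datalog_mem_deterministicLinear : datalog e p f₀ acc ∈ deterministicLinear A :=
  ⟨datalog_isLinear e p f₀ acc, datalog_locallyDeterministic, datalog_globallyDeterministic⟩

/-- Facts arise in the order opposite to the computation: the halting rule supplies the last one,
and each edge rule goes back one step. Hence the induction from the end of the run. -/
theorem fact_of_accepting {w : List A} {z : List (CProg (Fin k) F m) × Store (Fin k) F}
    {s : Store (Fin k) F} (hs : s.ctl ∈ acc)
    (h : Relation.ReflTransGen (sem w.length (w.map e)).Small z ([], s))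
    (hz : z.1 ∈ p.conts []) (hb : ∀ i, z.2.reg i ≤ w.length) :
    cfgFact w (⟨z.1, hz⟩, z.2.ctl) z.2.reg ∈ (datalog e p f₀ acc).facts w := by
  induction h using Relation.ReflTransGen.head_induction_on with
  | refl =>
    have hmem : haltRule p (⟨[], hz⟩, s.ctl) ∈ (datalog e p f₀ acc).rules :=
      (mem_datalog_rules e p f₀ acc).2 (.inr (.inl ⟨_, rfl, hs, rfl⟩))
    have hfac := valuation_infix (z := []) (y := []) (w := w) List.nil_infix List.nil_infix
      (fun i => List.IsPrefix.isInfix (List.take_prefix (s.reg i) w))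
    have hself : ∀ x, Pattern.image (A := A)
        (valuation w [] [] fun i => List.take (s.reg i) w) [.inr x] =
        valuation w [] [] (fun i => List.take (s.reg i) w) x := by
      intro x
      simp [Pattern.image, symbolImage]
    have := Program.fact_of_rule hmem
      (θ := valuation w [] [] fun i => List.take (s.reg i) w) ⟨rfl, fun x _ => hfac x⟩ (by
        intro φ hφ
        rcases (mem_haltRule p).1 hφ with rfl | ⟨i, rfl⟩ <;>
          exact ⟨(hself _).symm, hfac _, by rw [hself]; exact hfac _⟩)
    rw [cfgFact_eq _ (valuation_regVar w [] [] fun i => List.take (s.reg i) w)]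
    exact this
  | @head z z' hzz' _ ih =>
    obtain ⟨l, s₀⟩ := z
    obtain ⟨l', s'⟩ := z'
    obtain ⟨g, hE, hH, hb'⟩ := exists_edge hb hzz'
    have hz' := p.conts_nil_next hz hE.next
    have ih := ih hz' hb'
    have hmem : edgeRule p (⟨l, hz⟩, s₀.ctl) g (⟨l', hz'⟩, s'.ctl) ∈ (datalog e p f₀ acc).rules :=
      (mem_datalog_rules e p f₀ acc).2 (.inl ⟨_, _, _, hE, rfl⟩)
    obtain ⟨θ, hw, hfac, hX, hX', heq⟩ := hH.exists_valuation
      (fun i => List.IsPrefix.isInfix (List.take_prefix (s₀.reg i) w))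
    have := Program.fact_of_rule hmem (θ := θ) ⟨hw, fun x _ => hfac x⟩ (by
      intro φ hφ
      rcases (mem_edgeRule p).1 hφ with ⟨x, hx, rfl⟩ | rfl
      · exact ⟨heq x hx, hfac _, by rw [← heq x hx]; exact hfac _⟩
      · refine ⟨?_, fun y _ => hfac y⟩
        rw [cfgFact_eq _ hX'] at ih
        exact ih)
    rw [cfgFact_eq _ hX]
    exact this

/-- The last rule used to derive the fact is either a halting rule or performs one computation step
towards a fact of an earlier stage. -/
theorem accepting_of_fact {w : List A} {n : ℕ} {q : Control p} {v : Fin k → ℕ}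
    (hv : ∀ i, v i ≤ w.length) (h : cfgFact w q v ∈ (datalog e p f₀ acc).stage w n) :
    ∃ s : Store (Fin k) F, s.ctl ∈ acc ∧
      Relation.ReflTransGen (sem w.length (w.map e)).Small (q.1.1, ⟨q.2, v⟩) ([], s) := by
  induction n generalizing q v with
  | zero => exact absurd h (Set.notMem_empty _)
  | succ n ih =>
    rw [Program.stage_succ] at h
    rcases h with h | ⟨ρ, hρ, θ, hθ, hsat, h⟩
    · exact ih hv h
    · rcases (mem_datalog_rules e p f₀ acc).1 hρ with ⟨r, g, r', hE, rfl⟩ | ⟨r, hr, hr', rfl⟩ | rfl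
      · obtain ⟨h₁, h₂⟩ := Prod.ext_iff.1 h
        cases h₁
        have h₃ : regWords w ⟨q.2, v⟩ = fun i => θ (regVar i) := by
          apply List.ofFn_injective
          simpa [cfgFact, edgeRule, regVars, List.map_ofFn, Function.comp_def] using h₂
        have hH := holds_of_satEqns hθ.1 fun x α hx => hsat _ hx
        rw [← h₃] at hH
        obtain ⟨s', hs', hc, hX, hb⟩ := hE.small hv hH
        have hrel := hsat _ ((mem_edgeRule p).2 (.inr rfl))
        obtain ⟨s, hs, hr⟩ := ih (q := r') hb (by
          rw [cfgFact_eq _ (congrFun hX)]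
          exact hrel.1)
        refine ⟨s, hs, .head hs' ?_⟩
        rw [← hc] at hr
        exact hr
      · obtain ⟨h₁, h₂⟩ := Prod.ext_iff.1 h
        cases h₁
        exact ⟨_, hr', by rw [hr]⟩
      · obtain ⟨h₁, h₂⟩ := Prod.ext_iff.1 h
        cases h₁

theorem CounterDecidable.exists_datalog {e : A ≃ Fin m} {L : Language A}
    (h : CounterDecidable e L) :
    ∃ P ∈ deterministicLinear A, P.IsBoolean ∧ P.language = L := by
  obtain ⟨k, F, _, f₀, acc, p, hp⟩ := h
  refine ⟨datalog e p f₀ acc, datalog_mem_deterministicLinear, rfl, ?_⟩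
  ext w
  obtain ⟨s, hs, hL⟩ := hp w
  have hrun := hs.small []
  rw [← hL]
  constructor
  · rintro ⟨n, hn⟩
    -- The start rule is the only one with head symbol `none`, and its equations set all registers
    -- to the empty prefix.
    have hstart : cfgFact w (⟨[p], p.self_mem_conts []⟩, f₀) (fun _ => 0) ∈
        (datalog e p f₀ acc).stage w n := by
      clear hp hs hL hrun s
      induction n with
      | zero => exact absurd hn (Set.notMem_empty _)
      | succ n ih =>
        apply Program.stage_mono _ w (Nat.le_succ n)
        rw [Program.stage_succ] at hn
        rcases hn with h | ⟨ρ, hρ, θ, hθ, hsat, h⟩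
        · exact ih h
        · rcases (mem_datalog_rules e p f₀ acc).1 hρ with
            ⟨r, g, r', hE, rfl⟩ | ⟨r, hr, hr', rfl⟩ | rfl
          · exact absurd (Prod.ext_iff.1 h).1 (by simp [datalog, edgeRule])
          · exact absurd (Prod.ext_iff.1 h).1 (by simp [datalog, haltRule])
          · have hrel := hsat _ ((mem_startRule p f₀).2 (.inr (.inr rfl)))
            rw [cfgFact_eq _ (θ := θ) (y := regVar) fun i =>
              (hsat _ ((mem_startRule p f₀).2 (.inr (.inl ⟨i, rfl⟩)))).1.trans
                (List.take_zero (l := w)).symm]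
            exact hrel.1
    obtain ⟨s', hs', hr'⟩ := accepting_of_fact (fun _ => Nat.zero_le _) hstart
    rwa [Sem.Small.halt_unique ActStep.deterministic hrun hr']
  · intro hacc
    have hfact := fact_of_accepting (f₀ := f₀) hacc hrun (p.self_mem_conts [])
      (fun _ => Nat.zero_le _)
    have hmem : startRule p f₀ ∈ (datalog e p f₀ acc).rules :=
      (mem_datalog_rules e p f₀ acc).2 (.inr (.inr rfl))
    have hfac := valuation_infix (z := []) (y := []) (w := w) (X := fun _ : Fin k => [])
      List.nil_infix List.nil_infix (fun _ => List.nil_infix)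
    refine Program.fact_of_rule hmem (θ := valuation w [] [] fun _ : Fin k => [])
      ⟨rfl, fun x _ => hfac x⟩ fun φ hφ => ?_
    rcases (mem_startRule p f₀).1 hφ with rfl | ⟨i, rfl⟩ | rfl
    · simp [Atom.Sat, Pattern.image, symbolImage, valuation]
    · simp [Atom.Sat, Pattern.image, valuation_regVar]
    · refine ⟨?_, fun y _ => hfac y⟩
      rw [cfgFact_eq _ (θ := valuation w [] [] fun _ : Fin k => []) (y := regVar) fun i => by
        simp [valuation_regVar]] at hfact
      exact hfact

end Compile

end Logspace

/-! ### The empty input -/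

namespace Logspace

section EmptyInput

variable {ι F : Type} [DecidableEq ι] {m : ℕ}

/-- Extend an action to optional control values. -/
def Act.lift : Act ι F m → Act ι (Option F) m
  | .inc i => .inc i
  | .dec i => .dec i
  | .upd g => .upd (Option.map g)
  | .read i g => .read i (fun f o => f.map fun f => g f o)

/-- Extend a test to optional control values. -/
def Tst.lift : Tst ι F → Tst ι (Option F)
  | .pos i => .pos i
  | .flag b => .flag fun f => ∃ a ∈ f, b a

/-- Add a control value `none`, which is reached on the empty input. -/
def guardEmpty (i : ι) (p : CProg ι F m) : CProg ι (Option F) m :=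
  .seq (.act (.read i fun f o => if o.isSome then f else none))
    (.ite (.flag fun f => f.isSome) (p.bind (fun a => .act a.lift) (fun _ => .skip) Tst.lift) .skip)

/-- On the empty word, registers bounded by the length (or by a polynomial `(n + 1) ^ c - 1`) can
only hold `0` and store no information. The verdict on that word is therefore built into the
accepting control values, where `none` stands for it. -/
theorem run_guardEmpty_nil {B : ℕ} (i : ι) (p : CProg ι F m) (f : F) :
    (sem B []).Run (guardEmpty i p) ⟨some f, fun _ => 0⟩ ⟨none, fun _ => 0⟩ :=
  .seq (.act (.read (Nat.zero_le _))) (.iteFalse (by simp [sem, Tst.Holds]) (.skip _))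

theorem run_guardEmpty {B : ℕ} {x : List (Fin m)} (hx : x ≠ []) (i : ι) {p : CProg ι F m} {f : F}
    {s : Store ι F} (h : (sem B x).Run p ⟨f, fun _ => 0⟩ s) :
    (sem B x).Run (guardEmpty i p) ⟨some f, fun _ => 0⟩ ⟨some s.ctl, s.reg⟩ := by
  have hx0 : x[0]?.isSome := by
    cases x with
    | nil => exact absurd rfl hx
    | cons a x => rfl
  refine .seq (s' := ⟨some f, fun _ => 0⟩) (.act ?_) (.iteTrue (by simp [sem, Tst.Holds]) ?_)
  · have := ActStep.read (B := B) (x := x) (i := i) (s := ⟨some f, fun _ => 0⟩)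
      (g := fun f o => if o.isSome then f else none) (Nat.zero_le _)
    simp only [hx0] at this
    exact this
  · obtain ⟨u, hu, rfl⟩ := Sem.Run.bind (M' := sem B x) (f := fun a => .act a.lift)
      (pre := fun _ => .skip) (g := Tst.lift)
      (fun (s : Store ι F) (u : Store ι (Option F)) => u = ⟨some s.ctl, s.reg⟩)
      (fun a _ s s' u h hu => by
        subst hu
        refine ⟨_, .act ?_, rfl⟩
        cases h with
        | inc h => exact .inc (s := ⟨some s.ctl, s.reg⟩) h
        | dec h => exact .dec (s := ⟨some s.ctl, s.reg⟩) h
        | upd => exact .upd (s := ⟨some s.ctl, s.reg⟩)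
        | read h => exact .read (s := ⟨some s.ctl, s.reg⟩) h)
      (fun t _ s u hu => by
        refine ⟨u, .skip _, hu, ?_⟩
        subst hu
        cases t with
        | pos i => rfl
        | flag b => simp [sem, Tst.Holds, Tst.lift]) p
      (Prog.forall_of (fun _ => trivial) (fun _ => trivial) p) h rfl
    exact hu

/-- It suffices to decide the nonempty words. -/
theorem exists_run_guardEmpty {A : Type*} {e : A ≃ Fin m} {L : Language A} {B : ℕ → ℕ}
    {p : CProg ι F m} {f₀ : F} {acc : Set F} (i : ι)
    (h : ∀ w : List A, w ≠ [] → ∃ s : Store ι F,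
      (sem (B w.length) (w.map e)).Run p ⟨f₀, fun _ => 0⟩ s ∧ (s.ctl ∈ acc ↔ w ∈ L)) (w : List A) :
    ∃ s : Store ι (Option F), (sem (B w.length) (w.map e)).Run (guardEmpty i p)
      ⟨some f₀, fun _ => 0⟩ s ∧
      (s.ctl ∈ {f : Option F | (∃ a ∈ acc, f = some a) ∨ (f = none ∧ [] ∈ L)} ↔ w ∈ L) := by
  by_cases hw : w = []
  · subst hw
    exact ⟨_, run_guardEmpty_nil i p f₀, by simp⟩
  · obtain ⟨s, hs, hL⟩ := h w hw
    exact ⟨_, run_guardEmpty (by simpa using hw) i hs, by simp [hL]⟩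

end EmptyInput

/-! ### Registers of polynomial size -/

/-- The value of a list of digits in base `b`, least significant digit first. -/
def dval {κ : Type} (b : ℕ) (v : κ → ℕ) : List κ → ℕ
  | [] => 0
  | j :: l => v j + b * dval b v l

theorem dval_congr {κ : Type} {b : ℕ} {v v' : κ → ℕ} {l : List κ} (h : ∀ j ∈ l, v j = v' j) :
    dval b v l = dval b v' l := by
  induction l with
  | nil => rfl
  | cons j l ih =>
    rw [dval, dval, h j List.mem_cons_self, ih fun i hi => h i (List.mem_cons_of_mem _ hi)]

theorem dval_zero {κ : Type} (b : ℕ) (l : List κ) : dval b (fun _ => 0) l = 0 := by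
  induction l with
  | nil => rfl
  | cons j l ih => simp [dval, ih]

section Digits

variable {ι κ F : Type} [DecidableEq ι] [DecidableEq κ] {m : ℕ}

/-- Set a register to `0`. -/
def clear (i : ι) : CProg ι F m := .loop (.pos i) (.act (.dec i))

theorem run_clear {B : ℕ} {x : List (Fin m)} (i : ι) (s : Store ι F) :
    (sem B x).Run (clear i) s ⟨s.ctl, Function.update s.reg i 0⟩ := by
  obtain ⟨f, v⟩ := s
  generalize hn : v i = n
  induction n generalizing v with
  | zero =>
    have h : Function.update v i 0 = v := by rw [← hn]; exact Function.update_eq_self i v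
    rw [h]
    exact .loopFalse (not_not.2 hn)
  | succ n ih =>
    have := ih (Function.update v i (v i - 1)) (by simp [hn])
    rw [Function.update_idem] at this
    exact .loopTrue (show v i ≠ 0 by omega) (.act (.dec (show 0 < v i by omega))) this

/-- Set a register to the length of the input. -/
def fill (i : ι) : CProg ι (F × Bool) m :=
  .seq (.act (.read i fun f o => (f.1, o.isSome))) (.loop (.flag fun f => f.2 = true)
    (.seq (.act (.inc i)) (.act (.read i fun f o => (f.1, o.isSome)))))

theorem run_fill {x : List (Fin m)} (i : ι) (s : Store ι (F × Bool)) (h : s.reg i ≤ x.length) :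
    (sem x.length x).Run (fill i) s
      ⟨(s.ctl.1, false), Function.update s.reg i x.length⟩ := by
  obtain ⟨f, v⟩ := s
  change v i ≤ x.length at h
  have key : ∀ (n : ℕ) (v : ι → ℕ), v i + n = x.length →
      (sem x.length x).Run (.loop (.flag fun f => f.2 = true)
        (.seq (.act (.inc i)) (.act (.read i fun f o => (f.1, o.isSome)))))
        ⟨(f.1, x[v i]?.isSome), v⟩ ⟨(f.1, false), Function.update v i x.length⟩ := by
    intro n
    induction n with
    | zero =>
      intro v hn
      have h : Function.update v i x.length = v := by
        rw [← hn]; exact Function.update_eq_self i v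
      have h' : x[v i]?.isSome = false := by simp; omega
      rw [h, h']
      exact .loopFalse (by simp [sem, Tst.Holds])
    | succ n ih =>
      intro v hn
      have := ih (Function.update v i (v i + 1)) (by simp; omega)
      rw [Function.update_idem] at this
      refine .loopTrue ?_ (.seq (.act (.inc (show v i < x.length by omega)))
        (.act (.read ?_))) this
      · simp [sem, Tst.Holds]; omega
      · simp; omega
  exact .seq (.act (.read h)) (key (x.length - v i) v (by omega))

/-- Increment a number given by digits. -/
def incDigits (i : ι) : List κ → CProg (ι × κ) (F × Bool) m
  | [] => .skip
  | j :: l => .seq (.act (.read (i, j) fun f o => (f.1, o.isNone)))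
      (.ite (.flag fun f => f.2 = true) (.seq (clear (i, j)) (incDigits i l)) (.act (.inc (i, j))))

/-- Decrement a number given by digits. -/
def decDigits (i : ι) : List κ → CProg (ι × κ) (F × Bool) m
  | [] => .skip
  | j :: l => .ite (.pos (i, j)) (.act (.dec (i, j))) (.seq (fill (i, j)) (decDigits i l))

/-- Store in the flag whether a number given by digits is positive. -/
def posDigits (i : ι) : List κ → CProg (ι × κ) (F × Bool) m
  | [] => .act (.upd fun f => (f.1, false))
  | j :: l => .ite (.pos (i, j)) (.act (.upd fun f => (f.1, true))) (posDigits i l)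

/-- The digits of number `i` in the list `l` change from value `y` to value `z`. -/
structure DigitStep (b : ℕ) (i : ι) (l : List κ) (t t' : Store (ι × κ) (F × Bool)) (z : ℕ) :
    Prop where
  ctl : t'.ctl.1 = t.ctl.1
  bound : ∀ r, t'.reg r < b
  val : dval b (fun j => t'.reg (i, j)) l = z
  frame : ∀ i' j, i' ≠ i ∨ j ∉ l → t'.reg (i', j) = t.reg (i', j)

theorem update_lt {α : Type} [DecidableEq α] {b : ℕ} {v : α → ℕ} (h : ∀ r, v r < b) (i : α) {y : ℕ}
    (hy : y < b) (r : α) : Function.update v i y r < b := by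
  by_cases hr : r = i
  · subst hr; simpa using hy
  · simpa [hr] using h r

theorem DigitStep.cons {b : ℕ} {i : ι} {j : κ} {l : List κ} (hj : j ∉ l) {f : F × Bool}
    {t t' : Store (ι × κ) (F × Bool)} {y z : ℕ}
    (h : DigitStep b i l ⟨f, Function.update t.reg (i, j) y⟩ t' z) (hf : f.1 = t.ctl.1) :
    DigitStep b i (j :: l) t t' (y + b * z) := by
  refine ⟨h.ctl.trans hf, h.bound, ?_, fun i' j' hij => ?_⟩
  · rw [dval, h.val, h.frame i j (.inr hj)]
    simp
  · have hne : (i', j') ≠ (i, j) := by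
      rintro ⟨⟩
      rcases hij with h | h
      · exact h rfl
      · exact h List.mem_cons_self
    rw [h.frame i' j' (hij.imp id fun h h' => h (List.mem_cons_of_mem _ h'))]
    simp [hne]

theorem DigitStep.single {b : ℕ} {i : ι} {j : κ} {l : List κ} (hj : j ∉ l) {f : F × Bool}
    {t : Store (ι × κ) (F × Bool)} (ht : ∀ r, t.reg r < b) {y : ℕ} (hy : y < b)
    (hf : f.1 = t.ctl.1) : DigitStep b i (j :: l) t ⟨f, Function.update t.reg (i, j) y⟩
      (y + b * dval b (fun j => t.reg (i, j)) l) := by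
  refine DigitStep.cons hj (f := f) ⟨rfl, update_lt ht _ hy, dval_congr fun j' hj' => ?_,
    fun _ _ _ => rfl⟩ hf
  have : (i, j') ≠ (i, j) := by
    rintro ⟨⟩; exact hj hj'
  simp [this]

/-- A digit in base `x.length + 1` is maximal exactly if no letter is found at that position, so
reading the input detects the carry. By `h` the carry does not run past the most significant digit.
-/
theorem run_incDigits {x : List (Fin m)} (i : ι) {l : List κ} (hl : l.Nodup)
    (t : Store (ι × κ) (F × Bool)) (ht : ∀ r, t.reg r < x.length + 1)
    (h : dval (x.length + 1) (fun j => t.reg (i, j)) l + 1 < (x.length + 1) ^ l.length) :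
    ∃ t', (sem x.length x).Run (incDigits i l) t t' ∧
      DigitStep (x.length + 1) i l t t' (dval (x.length + 1) (fun j => t.reg (i, j)) l + 1) := by
  induction l generalizing t with
  | nil => simp [dval] at h
  | cons j l ih =>
    rw [List.nodup_cons] at hl
    obtain ⟨f, v⟩ := t
    simp only [dval, List.length_cons, pow_succ] at h ⊢
    have hv : v (i, j) < x.length + 1 := ht (i, j)
    have hread := ActStep.read (B := x.length) (x := x) (i := (i, j)) (s := ⟨f, v⟩)
      (g := fun f o => (f.1, o.isNone)) (by simp; omega)
    by_cases hvj : v (i, j) = x.length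
    · have hlow : dval (x.length + 1) (fun j' => Function.update v (i, j) 0 (i, j')) l =
          dval (x.length + 1) (fun j => v (i, j)) l := dval_congr fun j' hj' => by
        have : (i, j') ≠ (i, j) := by
          rintro ⟨⟩; exact hl.1 hj'
        simp [this]
      obtain ⟨t', hr, hd⟩ := ih hl.2 ⟨(f.1, true), Function.update v (i, j) 0⟩
        (update_lt ht _ (by omega)) (by
          simp only [hlow]
          rw [hvj] at h
          by_contra hc
          have := Nat.mul_le_mul_left (x.length + 1) (not_lt.1 hc)
          rw [mul_comm (_ ^ _)] at h
          linarith)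
      refine ⟨t', .seq (.act hread) (.iteTrue ?_ (.seq (run_clear _ _) ?_)), ?_⟩
      · simp [sem, Tst.Holds, hvj]
      · simpa [hvj] using hr
      · have := DigitStep.cons (t := ⟨f, v⟩) hl.1 hd rfl
        simp only [hlow] at this
        convert this using 1
        rw [hvj]; ring
    · refine ⟨_, .seq (.act hread) (.iteFalse ?_ (.act (.inc (by simp; omega)))), ?_⟩
      · simp [sem, Tst.Holds]; omega
      · have := DigitStep.single (t := ⟨f, v⟩) (f := (f.1, x[v (i, j)]?.isNone)) (i := i) hl.1 ht
          (y := v (i, j) + 1) (by omega) rfl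
        convert this using 1
        simp; ring

/-- A zero digit borrows: it becomes the maximal digit `x.length`, and positivity of the value
passes to the higher digits. -/
theorem run_decDigits {x : List (Fin m)} (i : ι) {l : List κ} (hl : l.Nodup)
    (t : Store (ι × κ) (F × Bool)) (ht : ∀ r, t.reg r < x.length + 1)
    (h : 0 < dval (x.length + 1) (fun j => t.reg (i, j)) l) :
    ∃ t', (sem x.length x).Run (decDigits i l) t t' ∧
      DigitStep (x.length + 1) i l t t' (dval (x.length + 1) (fun j => t.reg (i, j)) l - 1) := by
  induction l generalizing t with
  | nil => simp [dval] at h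
  | cons j l ih =>
    rw [List.nodup_cons] at hl
    obtain ⟨f, v⟩ := t
    simp only [dval] at h ⊢
    have hv : v (i, j) < x.length + 1 := ht (i, j)
    rcases Nat.eq_zero_or_pos (v (i, j)) with hvj | hvj
    · have hlow : dval (x.length + 1) (fun j' => Function.update v (i, j) x.length (i, j')) l =
          dval (x.length + 1) (fun j => v (i, j)) l := dval_congr fun j' hj' => by
        have : (i, j') ≠ (i, j) := by
          rintro ⟨⟩; exact hl.1 hj'
        simp [this]
      have hpos : 0 < dval (x.length + 1) (fun j => v (i, j)) l := by
        rw [hvj, zero_add] at h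
        exact Nat.pos_of_mul_pos_left h
      obtain ⟨t', hr, hd⟩ := ih hl.2 ⟨(f.1, false), Function.update v (i, j) x.length⟩
        (update_lt ht _ (by omega)) (by simpa only [hlow] using hpos)
      refine ⟨t', .iteFalse (not_not.2 hvj) (.seq (run_fill _ _ (by simp; omega)) hr), ?_⟩
      have := DigitStep.cons (t := ⟨f, v⟩) hl.1 hd rfl
      simp only [hlow] at this
      convert this using 1
      rw [hvj]
      obtain ⟨d, hd⟩ := Nat.exists_eq_add_of_lt hpos
      rw [hd]
      simp only [zero_add, Nat.add_sub_cancel, mul_add]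
      omega
    · refine ⟨_, .iteTrue hvj.ne' (.act (.dec hvj)), ?_⟩
      have := DigitStep.single (t := ⟨f, v⟩) (f := f) (i := i) hl.1 ht
        (y := v (i, j) - 1) (by omega) rfl
      convert this using 1
      simp; omega

theorem run_posDigits {x : List (Fin m)} (i : ι) (l : List κ)
    (t : Store (ι × κ) (F × Bool)) :
    (sem x.length x).Run (posDigits i l) t
      ⟨(t.ctl.1, decide (0 < dval (x.length + 1) (fun j => t.reg (i, j)) l)), t.reg⟩ := by
  induction l with
  | nil => exact .act .upd
  | cons j l ih =>
    rcases Nat.eq_zero_or_pos (t.reg (i, j)) with h | h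
    · refine .iteFalse (not_not.2 h) ?_
      simpa [dval, h] using ih
    · have h' : decide (0 < dval (x.length + 1) (fun j => t.reg (i, j)) (j :: l)) = true := by
        simp [dval]; omega
      rw [h']
      exact .iteTrue h.ne' (.act .upd)

/-- Translation of actions to digits. -/
def digitAct {c : ℕ} : Act ι F m → CProg (ι × Fin (c + 1)) (F × Bool) m
  | .inc i => incDigits i (List.finRange _)
  | .dec i => decDigits i (List.finRange _)
  | .upd g => .act (.upd fun f => (g f.1, f.2))
  | .read i g => .act (.read (i, 0) fun f o => (g f.1 o, f.2))

/-- Evaluation of tests on digits. -/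
def digitPre {c : ℕ} : Tst ι F → CProg (ι × Fin (c + 1)) (F × Bool) m
  | .pos i => posDigits i (List.finRange _)
  | .flag _ => .skip

/-- Translation of tests to digits, after evaluation. -/
def digitTst {c : ℕ} : Tst ι F → Tst (ι × Fin (c + 1)) (F × Bool)
  | .pos _ => .flag fun f => f.2 = true
  | .flag b => .flag fun f => b f.1

/-- Registers of polynomial size can be simulated by registers bounded by the length of the
input. -/
theorem exists_digitRun (c : ℕ) (p : CProg ι F m) : ∃ q : CProg (ι × Fin (c + 1)) (F × Bool) m,
    ∀ (x : List (Fin m)) (f : F) (s : Store ι F),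
      (sem ((x.length + 1) ^ (c + 1) - 1) x).Run p ⟨f, fun _ => 0⟩ s →
      ∃ t, (sem x.length x).Run q ⟨(f, false), fun _ => 0⟩ t ∧ t.ctl.1 = s.ctl := by
  let D : List (Fin (c + 1)) := List.finRange (c + 1)
  have hD : D.Nodup := List.nodup_finRange _
  have hD0 : D = 0 :: (List.finRange c).map Fin.succ := List.finRange_succ
  refine ⟨p.bind digitAct digitPre digitTst, fun x f s h => ?_⟩
  obtain ⟨t, ht, ht'⟩ := Sem.Run.bind (M' := sem x.length x) (f := digitAct) (pre := digitPre)
    (g := digitTst)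
    (fun (s : Store ι F) (t : Store (ι × Fin (c + 1)) (F × Bool)) => t.ctl.1 = s.ctl ∧
      (∀ r, t.reg r < x.length + 1) ∧
      ∀ i, dval (x.length + 1) (fun j => t.reg (i, j)) D = s.reg i)
    (fun a _ s s' t h hst => by
      obtain ⟨hc, hb, hv⟩ := hst
      have hstep : ∀ i t' z, DigitStep (x.length + 1) i D t t' z → t'.ctl.1 = s.ctl ∧
          (∀ r, t'.reg r < x.length + 1) ∧ ∀ i', dval (x.length + 1) (fun j => t'.reg (i', j)) D =
            Function.update s.reg i z i' := by
        intro i t' z h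
        refine ⟨h.ctl.trans hc, h.bound, fun i' => ?_⟩
        by_cases hi : i' = i
        · subst hi; simpa using h.val
        · rw [Function.update_of_ne hi, ← hv]
          exact dval_congr fun j _ => h.frame i' j (.inl hi)
      cases h with
      | @inc i s h =>
        obtain ⟨t', hr, hd⟩ := run_incDigits (x := x) i hD t hb (by
          rw [hv, List.length_finRange]; omega)
        exact ⟨t', hr, by simpa [hv] using hstep i t' _ hd⟩
      | @dec i s h =>
        obtain ⟨t', hr, hd⟩ := run_decDigits (x := x) i hD t hb (by rw [hv]; exact h)
        exact ⟨t', hr, by simpa [hv] using hstep i t' _ hd⟩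
      | upd => exact ⟨_, .act .upd, by simp [hc], hb, hv⟩
      | @read i g s h =>
        -- A read requires a value of at most `x.length`, which is below the base, so the higher
        -- digits vanish and the lowest digit is the position.
        have h0 : t.reg (i, 0) = s.reg i := by
          have := hv i
          rw [hD0, dval] at this
          rcases Nat.eq_zero_or_pos (dval (x.length + 1) (fun j => t.reg (i, j))
            ((List.finRange c).map Fin.succ)) with h' | h'
          · rw [h'] at this; simpa using this
          · have := Nat.mul_le_mul_left (x.length + 1) h'
            omega
        refine ⟨_, .act (.read (by rwa [h0])), ?_, hb, hv⟩
        simp [hc, h0])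
    (fun tst _ s t hst => by
      obtain ⟨hc, hb, hv⟩ := hst
      cases tst with
      | pos i =>
        refine ⟨_, run_posDigits i D t, ⟨hc, hb, hv⟩, ?_⟩
        simp [sem, Tst.Holds, digitTst, D, ← hv, Nat.pos_iff_ne_zero]
      | flag b => exact ⟨t, .skip _, ⟨hc, hb, hv⟩, by simp [sem, Tst.Holds, digitTst, hc]⟩)
    p (Prog.forall_of (fun _ => trivial) (fun _ => trivial) p) h
    (u := ⟨(f, false), fun _ => 0⟩) ⟨rfl, fun _ => by simp, fun _ => dval_zero _ _⟩
  exact ⟨t, ht, ht'.1⟩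

end Digits

/-- Registers may have polynomial size, and the empty word may be ignored. -/
theorem CounterDecidable.of_poly {A : Type*} {m : ℕ} {e : A ≃ Fin m} {L : Language A}
    {ι F : Type} [DecidableEq ι] [Finite ι] [Nonempty ι] [Finite F] (f₀ : F) (acc : Set F)
    (p : CProg ι F m) (c : ℕ)
    (h : ∀ w : List A, w ≠ [] → ∃ s : Store ι F,
      (sem ((w.length + 1) ^ (c + 1) - 1) (w.map e)).Run p ⟨f₀, fun _ => 0⟩ s ∧
        (s.ctl ∈ acc ↔ w ∈ L)) :
    CounterDecidable e L := by
  obtain ⟨q, hq⟩ := exists_digitRun c p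
  refine .of_finite _ _ _ (exists_run_guardEmpty (B := fun n => n) (e := e) (L := L) (p := q)
    (f₀ := (f₀, false)) (acc := {f | f.1 ∈ acc}) (Classical.arbitrary ι, 0) fun w hw => ?_)
  obtain ⟨s, hs, hL⟩ := h w hw
  obtain ⟨t, ht, htc⟩ := hq (w.map e) f₀ s (by rwa [List.length_map])
  rw [List.length_map] at ht
  exact ⟨t, ht, by rw [← hL, ← htc]; rfl⟩

end Logspace

/-! ### Logarithmic-space machines as counter programs -/

namespace Logspace

open SpaceComplexity

/-! ### Addition and multiplication of registers -/

section Arithmetic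

variable {ι F : Type} [DecidableEq ι] {m B : ℕ} {x : List (Fin m)}

/-- Repeat a program. -/
def repeatProg (p : CProg ι F m) : ℕ → CProg ι F m
  | 0 => .skip
  | n + 1 => .seq p (repeatProg p n)

theorem run_repeat_inc (i : ι) (f : F) (n : ℕ) (v : ι → ℕ) (h : v i + n ≤ B) :
    (sem B x).Run (repeatProg (.act (.inc i)) n) ⟨f, v⟩ ⟨f, Function.update v i (v i + n)⟩ := by
  induction n generalizing v with
  | zero => simpa [repeatProg] using .skip _
  | succ n ih =>
    have := ih (Function.update v i (v i + 1)) (by simp; omega)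
    simp only [Function.update_self, Function.update_idem] at this
    rw [show v i + (n + 1) = v i + 1 + n by omega]
    exact .seq (.act (.inc (by show v i < B; omega))) this

/-- Add `c` times register `i` to register `j`, and clear register `i`. -/
def addTimes (c : ℕ) (i j : ι) : CProg ι F m :=
  .loop (.pos i) (.seq (.act (.dec i)) (repeatProg (.act (.inc j)) c))

theorem run_addTimes (c : ℕ) {i j : ι} (hij : i ≠ j) (f : F) (v : ι → ℕ)
    (h : v j + c * v i ≤ B) :
    (sem B x).Run (addTimes c i j) ⟨f, v⟩
      ⟨f, Function.update (Function.update v i 0) j (v j + c * v i)⟩ := by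
  unfold addTimes
  generalize hn : v i = n
  induction n generalizing v with
  | zero =>
    have h0 : Function.update v i 0 = v := by rw [← hn]; exact Function.update_eq_self i v
    rw [h0, Nat.mul_zero, Nat.add_zero, Function.update_eq_self]
    exact .loopFalse (not_not.2 hn)
  | succ n ih =>
    rw [hn, Nat.mul_succ] at h
    have h₁ := run_repeat_inc (B := B) (x := x) j f c (Function.update v i (v i - 1))
      (by rw [Function.update_of_ne hij.symm]; omega)
    rw [Function.update_of_ne hij.symm] at h₁
    have h₂ := ih (Function.update (Function.update v i (v i - 1)) j (v j + c))
      (by simp [hij, hn]; omega) (by simp [hij, hn])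
    refine .loopTrue (show v i ≠ 0 by omega) (.seq (.act (.dec (show 0 < v i by omega))) h₁) ?_
    convert h₂ using 2
    funext a
    by_cases ha : a = j
    · subst ha; simp; ring
    · by_cases ha' : a = i
      · subst ha'; simp [ha]
      · simp [ha, ha']

/-- Multiply register `i` by `c`, with scratch register `j`. -/
def mulProg (c : ℕ) (i j : ι) : CProg ι F m := .seq (addTimes c i j) (addTimes 1 j i)

theorem run_mulProg (c : ℕ) {i j : ι} (hij : i ≠ j) (f : F) (v : ι → ℕ) (hj : v j = 0)
    (h : c * v i ≤ B) :
    (sem B x).Run (mulProg c i j) ⟨f, v⟩ ⟨f, Function.update v i (c * v i)⟩ := by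
  have h₁ := run_addTimes (B := B) (x := x) c hij f v (by rw [hj]; omega)
  have h₂ := run_addTimes (B := B) (x := x) 1 hij.symm f
    (Function.update (Function.update v i 0) j (v j + c * v i)) (by simp [hij, hj]; omega)
  refine .seq h₁ ?_
  convert h₂ using 2
  funext a
  by_cases ha : a = i
  · subst ha; simp [hij, hj]
  · by_cases ha' : a = j
    · subst ha'; simp [ha, hj]
    · simp [ha, ha']

end Arithmetic

/-! ### Work tapes as pairs of numbers -/

section Simulation

variable {A : Type*} (M : Machine A) {g m : ℕ}

/-- The control values of the simulation of a machine. -/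
structure MCtl (g : ℕ) : Type where
  state : M.State
  atLeft : Bool
  scan : Fin M.numTapes → M.Symbol
  pend : Option (M.State × Move × (Fin M.numTapes → M.Symbol × Move))
  digit : Fin (g + 1)
  aux : Bool

instance : Finite Move := by
  refine Finite.of_surjective (fun i : Fin 3 => match i with
    | 0 => Move.left
    | 1 => Move.stay
    | 2 => Move.right) fun d => ?_
  cases d
  · exact ⟨0, rfl⟩
  · exact ⟨1, rfl⟩
  · exact ⟨2, rfl⟩

instance : Finite (MCtl M g) := by
  have := M.finiteState
  have := M.finiteSymbol
  refine Finite.of_injective (fun f : MCtl M g =>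
    (f.state, f.atLeft, f.scan, f.pend, f.digit, f.aux)) fun f f' h => ?_
  cases f
  cases f'
  simpa using h

/-- The registers of the simulation: the position of the input head, a scratch register, and for
each tape the contents to the left and to the right of the head. -/
inductive MReg : Type
  | pos : MReg
  | tmp : MReg
  | left (i : Fin M.numTapes) : MReg
  | right (i : Fin M.numTapes) : MReg

noncomputable instance : DecidableEq (MReg M) := Classical.decEq _

instance : Nonempty (MReg M) := ⟨.pos⟩

instance : Finite (MReg M) := by
  refine Finite.of_injective (fun r : MReg M => match r with
    | .pos => (0, none)
    | .tmp => (1, none)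
    | .left i => (2, some i)
    | .right i => (3, some i) : MReg M → Fin 4 × Option (Fin M.numTapes)) fun r r' h => ?_
  cases r <;> cases r' <;> simp at h ⊢ <;> exact h

variable {M} (E : M.Symbol ≃ Fin g)

/-- The symbol with a given code. -/
def decodeSym : Fin (g + 1) → M.Symbol := Fin.cases M.blank E.symm

/-- The number that represents a stack of symbols. -/
def encodeStack : List M.Symbol → ℕ
  | [] => 0
  | a :: l => (g + 1) * encodeStack l + (E a).succ

theorem encodeStack_lt (l : List M.Symbol) : encodeStack E l < (g + 1) ^ l.length := by
  induction l with
  | nil => simp [encodeStack]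
  | cons a l ih =>
    rw [encodeStack, List.length_cons, pow_succ']
    have h1 : (E a).succ.val < g + 1 := (E a).succ.isLt
    calc (g + 1) * encodeStack E l + (E a).succ.val
        < (g + 1) * encodeStack E l + (g + 1) := by omega
      _ = (g + 1) * (encodeStack E l + 1) := by ring
      _ ≤ _ := Nat.mul_le_mul_left _ ih

theorem encodeStack_div (l : List M.Symbol) :
    encodeStack E l / (g + 1) = encodeStack E l.tail := by
  cases l with
  | nil => simp [encodeStack]
  | cons a l =>
    rw [encodeStack, Nat.mul_add_div (Nat.succ_pos _), Nat.div_eq_of_lt (E a).succ.isLt]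
    rfl

/-- No symbol has the code `0`. Popping the empty stack thus yields the digit `0`, which is decoded
as the blank, in agreement with the cells beyond the represented part of the tape. -/
theorem decodeSym_encodeStack (l : List M.Symbol) (h : encodeStack E l % (g + 1) < g + 1) :
    decodeSym E ⟨encodeStack E l % (g + 1), h⟩ = l.headD M.blank := by
  cases l with
  | nil =>
    have : (⟨encodeStack E [] % (g + 1), h⟩ : Fin (g + 1)) = 0 := Fin.ext (by simp [encodeStack])
    rw [this]
    rfl
  | cons a l =>
    have : (⟨encodeStack E (a :: l) % (g + 1), h⟩ : Fin (g + 1)) = (E a).succ := Fin.ext (by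
      show encodeStack E (a :: l) % (g + 1) = _
      rw [encodeStack, Nat.mul_add_mod, Nat.mod_eq_of_lt (E a).succ.isLt])
    rw [this]
    simp [decodeSym]

/-- Push the symbol scanned on tape `i` onto the stack in a register. -/
def pushProg (i : Fin M.numTapes) (r : MReg M) : CProg (MReg M) (MCtl M g) m :=
  .seq (.act (.upd fun f => { f with digit := (E (f.scan i)).succ })) (.seq (mulProg (g + 1) r .tmp)
    (.loop (.flag fun f => f.digit ≠ 0)
      (.seq (.act (.upd fun f => { f with digit := Fin.ofNat (g + 1) (f.digit - 1) }))
        (.act (.inc r)))))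

/-- The digit to be added is at most `g`, so the control value itself can count it down. -/
theorem run_pushProg {B : ℕ} {x : List (Fin m)} (i : Fin M.numTapes) {r : MReg M} (hr : r ≠ .tmp)
    (f : MCtl M g) (v : MReg M → ℕ) (ht : v .tmp = 0)
    (hB : (g + 1) * v r + (E (f.scan i)).succ ≤ B) :
    (sem B x).Run (pushProg E i r) ⟨f, v⟩
      ⟨{ f with digit := 0 }, Function.update v r ((g + 1) * v r + (E (f.scan i)).succ)⟩ := by
  have key : ∀ (d : ℕ) (f : MCtl M g) (v : MReg M → ℕ), f.digit.val = d → v r + d ≤ B →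
      (sem B x).Run (.loop (.flag fun f : MCtl M g => f.digit ≠ 0)
        (.seq (.act (.upd fun f => { f with digit := Fin.ofNat (g + 1) (f.digit - 1) }))
          (.act (.inc r)))) ⟨f, v⟩ ⟨{ f with digit := 0 }, Function.update v r (v r + d)⟩ := by
    intro d
    induction d with
    | zero =>
      intro f v hd _
      have hd : f.digit = 0 := Fin.ext hd
      have hf : ({ f with digit := 0 } : MCtl M g) = f := by rw [← hd]
      simp only [hf, Nat.add_zero, Function.update_eq_self]
      exact .loopFalse (not_not.2 hd)
    | succ d ih =>
      intro f v hd hB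
      have hlt := f.digit.isLt
      have := ih { f with digit := Fin.ofNat (g + 1) (f.digit - 1) }
        (Function.update v r (v r + 1))
        (by simp [hd]; omega) (by simp; omega)
      simp only [Function.update_self, Function.update_idem] at this
      rw [show v r + (d + 1) = v r + 1 + d by omega]
      refine .loopTrue (fun h => ?_) (.seq (.act .upd) (.act (.inc (show v r < B by omega)))) this
      rw [show f.digit = 0 from h] at hd
      simp at hd
  have h₂ := run_mulProg (B := B) (x := x) (g + 1) hr
    { f with digit := (E (f.scan i)).succ } v ht (by omega)
  have h₃ := key _ { f with digit := (E (f.scan i)).succ }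
    (Function.update v r ((g + 1) * v r)) rfl (by simpa using hB)
  simp only [Function.update_self, Function.update_idem] at h₃
  exact .seq (.act .upd) (.seq h₂ h₃)

/-- Pop a symbol from the stack in a register; it becomes the symbol scanned on tape `i`. -/
def popProg (i : Fin M.numTapes) (r : MReg M) : CProg (MReg M) (MCtl M g) m :=
  .seq (.act (.upd fun f => { f with digit := 0 })) (.seq
    (.loop (.pos r) (.seq (.act (.dec r)) (.seq
      (.act (.upd fun f => { f with digit := Fin.ofNat (g + 1) (f.digit + 1) }))
      (.ite (.flag fun f => f.digit = 0) (.act (.inc .tmp)) .skip))))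
    (.seq (addTimes 1 .tmp r)
      (.act (.upd fun f => { f with scan := Function.update f.scan i (decodeSym E f.digit) }))))

/-- Division by repeated decrement: the remainder cycles through the control value, and the scratch
register counts the overflows. The sum of both registers never grows, so the bound `B` is respected.
-/
theorem run_popProg {B : ℕ} {x : List (Fin m)} (i : Fin M.numTapes) {r : MReg M} (hr : r ≠ .tmp)
    (f : MCtl M g) (v : MReg M → ℕ) (ht : v .tmp = 0) (hB : v r ≤ B) :
    (sem B x).Run (popProg E i r) ⟨f, v⟩
      ⟨{ f with
          digit := Fin.ofNat (g + 1) (v r)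
          scan := Function.update f.scan i (decodeSym E (Fin.ofNat (g + 1) (v r))) },
        Function.update v r (v r / (g + 1))⟩ := by
  have key : ∀ (n : ℕ) (f : MCtl M g) (v : MReg M → ℕ), v r = n → v r + v .tmp ≤ B →
      (sem B x).Run (.loop (.pos r) (.seq (.act (.dec r)) (.seq
        (.act (.upd fun f : MCtl M g => { f with digit := Fin.ofNat (g + 1) (f.digit + 1) }))
        (.ite (.flag fun f => f.digit = 0) (.act (.inc .tmp)) .skip)))) ⟨f, v⟩
        ⟨{ f with digit := Fin.ofNat (g + 1) (f.digit + n) },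
          Function.update (Function.update v r 0) .tmp (v .tmp + (f.digit + n) / (g + 1))⟩ := by
    intro n
    induction n with
    | zero =>
      intro f v hn _
      have h0 : Function.update v r 0 = v := by rw [← hn]; exact Function.update_eq_self r v
      have h1 : (f.digit : ℕ) / (g + 1) = 0 := Nat.div_eq_of_lt f.digit.isLt
      have h2 : Fin.ofNat (g + 1) f.digit = f.digit := by simp
      simp only [h0, Nat.add_zero, h1, h2, Function.update_eq_self]
      exact .loopFalse (not_not.2 hn)
    | succ n ih =>
      intro f v hn hB
      have hlt := f.digit.isLt
      by_cases hd : f.digit.val = g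
      · have hd0 : Fin.ofNat (g + 1) (f.digit + 1) = 0 := Fin.ext (by simp [hd])
        have := ih { f with digit := Fin.ofNat (g + 1) (f.digit + 1) }
          (Function.update (Function.update v r (v r - 1)) .tmp (v .tmp + 1))
          (by simp [hr, hn]) (by simp [hr]; omega)
        refine .loopTrue (show v r ≠ 0 by omega) (.seq (.act (.dec (show 0 < v r by omega)))
          (.seq (.act .upd) (.iteTrue hd0 (.act (.inc ?_))))) ?_
        · show Function.update v r (v r - 1) .tmp < B
          rw [Function.update_of_ne hr.symm]; omega
        · convert this using 2
          · show Function.update (Function.update v r (v r - 1)) .tmp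
              (Function.update v r (v r - 1) .tmp + 1) = _
            rw [Function.update_of_ne hr.symm]
          · simp only [hd0, Fin.val_zero, Nat.zero_add]
            congr 1
            apply Fin.ext
            simp only [Fin.ofNat, hd]
            rw [show g + (n + 1) = n + (g + 1) by omega, Nat.add_mod_right]
          · funext a
            by_cases ha : a = .tmp
            · subst ha
              simp only [Function.update_self, hd0, Fin.val_zero, Nat.zero_add]
              rw [hd, show g + (n + 1) = n + (g + 1) by omega,
                Nat.add_div_right _ (show 0 < g + 1 from Nat.succ_pos g)]
              omega
            · by_cases ha' : a = r
              · subst ha'; simp [ha]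
              · simp [ha, ha']
      · have hd1 : (Fin.ofNat (g + 1) (f.digit + 1)).val = f.digit + 1 := by
          simp [Fin.ofNat]; omega
        have := ih { f with digit := Fin.ofNat (g + 1) (f.digit + 1) }
          (Function.update v r (v r - 1)) (by simp [hn]) (by simp [hr.symm]; omega)
        refine .loopTrue (show v r ≠ 0 by omega) (.seq (.act (.dec (show 0 < v r by omega)))
          (.seq (.act .upd) (.iteFalse (fun h => ?_) (.skip _)))) ?_
        · rw [show Fin.ofNat (g + 1) (f.digit + 1) = 0 from h] at hd1
          simp at hd1
        · convert this using 2
          · congr 1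
            rw [hd1]; congr 1; omega
          · funext a
            by_cases ha : a = .tmp
            · subst ha
              simp only [Function.update_self, hd1, Function.update_of_ne hr.symm]
              congr 2; omega
            · by_cases ha' : a = r
              · subst ha'; simp [ha]
              · simp [ha, ha']
  have h₁ := key _ { f with digit := 0 } v rfl (by omega)
  have hdiv : v r / (g + 1) ≤ v r := Nat.div_le_self _ _
  have h₂ := run_addTimes (B := B) (x := x) 1 hr.symm
    { f with digit := Fin.ofNat (g + 1) (v r) }
    (Function.update (Function.update v r 0) .tmp (v r / (g + 1))) (by simp [hr]; omega)
  simp only [Fin.val_zero, Nat.zero_add, ht] at h₁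
  refine .seq (.act .upd) (.seq h₁ (.seq h₂ ?_))
  convert Sem.Run.act (M := sem B x) ActStep.upd using 2
  funext a
  by_cases ha : a = r
  · subst ha; simp [hr]
  · by_cases ha' : a = .tmp
    · subst ha'; simp [ha, ht]
    · simp [ha, ha']

/-- A tape with its head, represented by the scanned symbol and two numbers. At most `S` cells are
represented. -/
def TapeSim (S : ℕ) (t : ℕ → M.Symbol) (h : ℕ) (a : M.Symbol) (y z : ℕ) : Prop :=
  ∃ l r : List M.Symbol, y = encodeStack E l ∧ z = encodeStack E r ∧ l.length = h ∧
    (∀ j, t j = (l.reverse ++ a :: r)[j]?.getD M.blank) ∧ l.length + r.length + 1 ≤ S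

variable {E} {S h y z : ℕ} {t : ℕ → M.Symbol} {a : M.Symbol}

theorem TapeSim.scan (H : TapeSim E S t h a y z) : t h = a := by
  obtain ⟨l, r, -, -, rfl, ht, -⟩ := H
  simp [ht]

/-- All codes of symbols are positive, so the number is `0` only for the empty stack; this is how
the left end of the tape is recognised. -/
theorem TapeSim.head_eq_zero (H : TapeSim E S t h a y z) : y = 0 ↔ h = 0 := by
  obtain ⟨l, r, rfl, -, rfl, -, -⟩ := H
  cases l <;> simp [encodeStack]

theorem TapeSim.lt (H : TapeSim E S t h a y z) : y < (g + 1) ^ S ∧ z < (g + 1) ^ S := by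
  obtain ⟨l, r, rfl, rfl, -, -, hS⟩ := H
  exact ⟨(encodeStack_lt E l).trans_le (Nat.pow_le_pow_right (Nat.succ_pos _) (by omega)),
    (encodeStack_lt E r).trans_le (Nat.pow_le_pow_right (Nat.succ_pos _) (by omega))⟩

theorem TapeSim.write (H : TapeSim E S t h a y z) (b : M.Symbol) :
    TapeSim E S (Function.update t h b) h b y z := by
  obtain ⟨l, r, hy, hz, rfl, ht, hS⟩ := H
  refine ⟨l, r, hy, hz, rfl, fun j => ?_, hS⟩
  by_cases hj : j = l.length
  · subst hj; simp
  · rw [Function.update_of_ne hj, ht]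
    simp only [List.getElem?_append, List.length_reverse, List.getElem?_cons]
    split_ifs <;> first | rfl | omega

/-- If the right stack is empty, a fresh blank cell joins the represented part, and `hS` pays for
it. -/
theorem TapeSim.moveRight (H : TapeSim E S t h a y z) (hS : h + 1 < S) :
    TapeSim E S t (h + 1) (decodeSym E (Fin.ofNat (g + 1) z)) ((g + 1) * y + (E a).succ)
      (z / (g + 1)) := by
  obtain ⟨l, r, rfl, rfl, rfl, ht, hS'⟩ := H
  refine ⟨a :: l, r.tail, rfl, encodeStack_div E r, rfl, fun j => ?_, ?_⟩
  · rw [ht, show decodeSym E (Fin.ofNat (g + 1) (encodeStack E r)) = r.headD M.blank from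
      decodeSym_encodeStack E r _]
    cases r with
    | nil =>
      simp only [List.headD_nil, List.tail_nil, List.reverse_cons, List.append_assoc,
        List.singleton_append]
      simp only [List.getElem?_append, List.getElem?_cons]
      split_ifs <;> simp
    | cons b r => simp
  · cases r with
    | nil => simp; omega
    | cons b r => simp at hS' ⊢; omega

theorem TapeSim.moveLeft (H : TapeSim E S t h a y z) (hh : h ≠ 0) :
    TapeSim E S t (h - 1) (decodeSym E (Fin.ofNat (g + 1) y)) (y / (g + 1))
      ((g + 1) * z + (E a).succ) := by
  obtain ⟨l, r, rfl, rfl, rfl, ht, hS'⟩ := H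
  refine ⟨l.tail, a :: r, encodeStack_div E l, rfl, by simp, fun j => ?_, ?_⟩
  · rw [ht, show decodeSym E (Fin.ofNat (g + 1) (encodeStack E l)) = l.headD M.blank from
      decodeSym_encodeStack E l _]
    cases l with
    | nil => simp at hh
    | cons b l => simp
  · cases l with
    | nil => simp at hh
    | cons b l => simp at hS' ⊢; omega

end Simulation

end Logspace

/-! ### Simulation of the steps of a machine -/

namespace Logspace

open SpaceComplexity

section Step

variable {A : Type*} {M : Machine A} {g m : ℕ}

/-- The symbol to be written and the movement of the head on tape `i`. -/
def MCtl.tapeAction (f : MCtl M g) (i : Fin M.numTapes) : M.Symbol × Move :=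
  match f.pend with
  | some r => r.2.2 i
  | none => (M.blank, .stay)

/-- The movement of the input head. -/
def MCtl.inputMove (f : MCtl M g) : Move :=
  match f.pend with
  | some r => r.2.1
  | none => .stay

/-- The next state. -/
def MCtl.nextState (f : MCtl M g) : M.State :=
  match f.pend with
  | some r => r.1
  | none => f.state

variable (E : M.Symbol ≃ Fin g)

/-- Write on tape `i` and move its head. -/
def moveTape (i : Fin M.numTapes) : CProg (MReg M) (MCtl M g) m :=
  .seq (.act (.upd fun f => { f with scan := Function.update f.scan i (f.tapeAction i).1 }))
    (.ite (.flag fun f => (f.tapeAction i).2 = .left)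
      (.ite (.pos (.left i)) (.seq (pushProg E i (.right i)) (popProg E i (.left i))) .skip)
      (.ite (.flag fun f => (f.tapeAction i).2 = .right)
        (.seq (pushProg E i (.left i)) (popProg E i (.right i))) .skip))

/-- The represented part fits into `S` cells before and after the move, so both stacks stay below
`(g + 1) ^ S`. Applied after the move, this bounds the number that a push creates. A left move in
cell `0` leaves only the write. -/
theorem run_moveTape {B S h : ℕ} {x : List (Fin m)} (i : Fin M.numTapes) (f : MCtl M g)
    (v : MReg M → ℕ) (ht : v .tmp = 0) (hB : (g + 1) ^ S ≤ B + 1) {t : ℕ → M.Symbol}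
    (H : TapeSim E S t h (f.scan i) (v (.left i)) (v (.right i)))
    (hS : (f.tapeAction i).2.apply h < S) :
    ∃ a d y z, (sem B x).Run (moveTape E i) ⟨f, v⟩
      ⟨{ f with scan := Function.update f.scan i a, digit := d },
        Function.update (Function.update v (.left i) y) (.right i) z⟩ ∧
      TapeSim E S (Function.update t h (f.tapeAction i).1) ((f.tapeAction i).2.apply h) a y z := by
  have H' := H.write (f.tapeAction i).1
  set b := (f.tapeAction i).1 with hb
  have hlt := H'.lt
  have hself : Function.update (Function.update v (.left i) (v (.left i))) (.right i)
      (v (.right i)) = v := by simp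
  cases hm : (f.tapeAction i).2 with
  | stay =>
    refine ⟨b, f.digit, v (.left i), v (.right i), .seq (.act .upd)
      (.iteFalse ?_ (.iteFalse ?_ ?_)), H'⟩
    · exact fun h' => by have := hm.symm.trans h'; cases this
    · exact fun h' => by have := hm.symm.trans h'; cases this
    · rw [hself]; exact .skip _
  | left =>
    by_cases h0 : v (.left i) = 0
    · refine ⟨b, f.digit, v (.left i), v (.right i), .seq (.act .upd)
        (.iteTrue hm (.iteFalse ?_ ?_)), ?_⟩
      · exact not_not.2 h0
      · rw [hself]; exact .skip _
      · have hh := H.head_eq_zero.1 h0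
        subst hh
        exact H'
    · have H'' := H'.moveLeft (fun hh => h0 (H.head_eq_zero.2 hh))
      have h₁ := run_pushProg (B := B) (x := x) E i (r := .right i) (by simp)
        { f with scan := Function.update f.scan i b } v ht
        (by have := H''.lt.2; simp only [Function.update_self]; omega)
      have h₂ := run_popProg (B := B) (x := x) E i (r := .left i) (by simp)
        { f with scan := Function.update f.scan i b, digit := 0 }
        (Function.update v (.right i) ((g + 1) * v (.right i) + (E b).succ)) (by simp [ht])
        (by simp; omega)
      simp only [Function.update_self] at h₁
      simp only [Function.update_idem, ne_eq, reduceCtorEq, not_false_eq_true,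
        Function.update_of_ne] at h₂
      rw [Function.update_comm (show MReg.right i ≠ MReg.left i by simp)] at h₂
      exact ⟨_, _, _, _, .seq (.act .upd) (.iteTrue hm (.iteTrue h0 (.seq h₁ h₂))), H''⟩
  | right =>
    rw [hm] at hS
    have H'' := H'.moveRight hS
    have h₁ := run_pushProg (B := B) (x := x) E i (r := .left i) (by simp)
      { f with scan := Function.update f.scan i b } v ht
      (by have := H''.lt.1; simp only [Function.update_self]; omega)
    have h₂ := run_popProg (B := B) (x := x) E i (r := .right i) (by simp)
      { f with scan := Function.update f.scan i b, digit := 0 }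
      (Function.update v (.left i) ((g + 1) * v (.left i) + (E b).succ)) (by simp [ht])
      (by simp; omega)
    simp only [Function.update_self] at h₁
    simp only [Function.update_idem, ne_eq, reduceCtorEq, not_false_eq_true,
      Function.update_of_ne] at h₂
    refine ⟨_, _, _, _, .seq (.act .upd) (.iteFalse ?_ (.iteTrue hm (.seq h₁ h₂))), H''⟩
    exact fun h' => by have := hm.symm.trans h'; cases this

/-- Write on all tapes in a list and move their heads. -/
def moveTapes : List (Fin M.numTapes) → CProg (MReg M) (MCtl M g) m
  | [] => .skip
  | i :: l => .seq (moveTape E i) (moveTapes l)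

theorem run_moveTapes {B S : ℕ} {x : List (Fin m)} (hB : (g + 1) ^ S ≤ B + 1)
    {t : Fin M.numTapes → ℕ → M.Symbol} {h : Fin M.numTapes → ℕ} (l : List (Fin M.numTapes))
    (hl : l.Nodup) (f : MCtl M g) (v : MReg M → ℕ) (ht : v .tmp = 0)
    (H : ∀ i ∈ l, TapeSim E S (t i) (h i) (f.scan i) (v (.left i)) (v (.right i)))
    (hS : ∀ i ∈ l, (f.tapeAction i).2.apply (h i) < S) :
    ∃ sc d v', (sem B x).Run (moveTapes E l) ⟨f, v⟩ ⟨{ f with scan := sc, digit := d }, v'⟩ ∧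
      v' .tmp = 0 ∧ v' .pos = v .pos ∧
      (∀ i ∈ l, TapeSim E S (Function.update (t i) (h i) (f.tapeAction i).1)
        ((f.tapeAction i).2.apply (h i)) (sc i) (v' (.left i)) (v' (.right i))) ∧
      ∀ i ∉ l, sc i = f.scan i ∧ v' (.left i) = v (.left i) ∧ v' (.right i) = v (.right i) := by
  induction l generalizing f v with
  | nil => exact ⟨f.scan, f.digit, v, .skip _, ht, rfl, by simp, by simp⟩
  | cons i l ih =>
    rw [List.nodup_cons] at hl
    obtain ⟨a, d, y, z, h₁, H₁⟩ := run_moveTape (x := x) E i f v ht hB (H i (by simp))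
      (hS i (by simp))
    obtain ⟨sc, d', v', h₂, ht', hp', H₂, H₃⟩ := ih hl.2
      { f with scan := Function.update f.scan i a, digit := d }
      (Function.update (Function.update v (.left i) y) (.right i) z) (by simp [ht])
      (fun j hj => by
        have hji : j ≠ i := fun h => hl.1 (h ▸ hj)
        simpa [hji] using H j (by simp [hj]))
      (fun j hj => hS j (by simp [hj]))
    refine ⟨sc, d', v', .seq h₁ h₂, ht', by simpa using hp', fun j hj => ?_, fun j hj => ?_⟩
    · rcases List.mem_cons.1 hj with rfl | hj
      · obtain ⟨e₁, e₂, e₃⟩ := H₃ j hl.1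
        rw [e₁, e₂, e₃]
        simpa using H₁
      · exact H₂ j hj
    · simp only [List.mem_cons, not_or] at hj
      obtain ⟨e₁, e₂, e₃⟩ := H₃ j hj.2
      rw [e₁, e₂, e₃]
      simp [hj.1]

/-- The position of the input head is `h`; it is given by `p` and by a flag for cell `0`. -/
def InputSim (n : ℕ) (l : Bool) (p h : ℕ) : Prop :=
  p ≤ n ∧ ((l = true ∧ h = 0 ∧ p = 0) ∨ (l = false ∧ h = p + 1))

/-- Move the input head. -/
def moveInput : CProg (MReg M) (MCtl M g) m :=
  .ite (.flag fun f => f.inputMove = .left)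
    (.ite (.flag fun f => f.atLeft = true) .skip
      (.ite (.pos .pos) (.act (.dec .pos)) (.act (.upd fun f => { f with atLeft := true }))))
    (.ite (.flag fun f => f.inputMove = .right)
      (.ite (.flag fun f => f.atLeft = true) (.act (.upd fun f => { f with atLeft := false }))
        (.seq (.act (.read .pos fun f o => { f with aux := o.isSome }))
          (.ite (.flag fun f => f.aux = true) (.act (.inc .pos)) .skip)))
      .skip)

/-- There are `n + 2` input cells; cell `0` is represented by a flag, so that the register stays
within `n`. The right end is noticed because no letter can be read there. -/
theorem run_moveInput {B h : ℕ} {x : List (Fin m)} (hB : x.length ≤ B) (f : MCtl M g)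
    (v : MReg M → ℕ) (H : InputSim x.length f.atLeft (v .pos) h) :
    ∃ l u p, (sem B x).Run moveInput ⟨f, v⟩
        ⟨{ f with atLeft := l, aux := u }, Function.update v .pos p⟩ ∧
      InputSim x.length l p (min (f.inputMove.apply h) (x.length + 1)) := by
  have hself : Function.update v .pos (v .pos) = v := Function.update_eq_self _ _
  obtain ⟨hp, H⟩ := H
  cases hm : f.inputMove with
  | stay =>
    refine ⟨f.atLeft, f.aux, v .pos, .iteFalse ?_ (.iteFalse ?_ ?_), hp, ?_⟩
    · exact fun h' => by have := hm.symm.trans h'; cases this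
    · exact fun h' => by have := hm.symm.trans h'; cases this
    · rw [hself]; exact .skip _
    · rw [min_eq_left (by simp only [Move.apply]; omega)]; exact H
  | left =>
    rcases H with ⟨hl, rfl, h0⟩ | ⟨hl, rfl⟩
    · refine ⟨f.atLeft, f.aux, v .pos, .iteTrue hm (.iteTrue hl ?_), hp, .inl ⟨hl, by
        simp [Move.apply], h0⟩⟩
      rw [hself]; exact .skip _
    · by_cases h0 : v .pos = 0
      · refine ⟨true, f.aux, v .pos, .iteTrue hm (.iteFalse ?_ (.iteFalse (not_not.2 h0) ?_)), hp,
          .inl ⟨rfl, by simp [Move.apply, h0], h0⟩⟩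
        · simp [sem, Tst.Holds, hl]
        · rw [hself]; exact .act .upd
      · refine ⟨f.atLeft, f.aux, v .pos - 1, .iteTrue hm (.iteFalse ?_ (.iteTrue h0
          (.act (.dec (show 0 < v .pos by omega))))), by omega, .inr ⟨hl, ?_⟩⟩
        · simp [sem, Tst.Holds, hl]
        · simp only [Move.apply]; omega
  | right =>
    have hne : ¬ f.inputMove = .left := fun h' => by have := hm.symm.trans h'; cases this
    rcases H with ⟨hl, rfl, h0⟩ | ⟨hl, rfl⟩
    · refine ⟨false, f.aux, v .pos, .iteFalse hne (.iteTrue hm (.iteTrue hl ?_)), hp, .inr ⟨rfl, by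
        simp [Move.apply, h0]⟩⟩
      rw [hself]; exact .act .upd
    · have hread (u : Bool) (hu : x[v .pos]?.isSome = u) : (sem B x).Run
          (.act (.read .pos fun f o => { f with aux := o.isSome })) ⟨f, v⟩
          ⟨{ f with aux := u }, v⟩ := by
        subst hu
        exact .act (.read (s := ⟨f, v⟩) hp)
      by_cases h0 : v .pos < x.length
      · refine ⟨f.atLeft, true, v .pos + 1, .iteFalse hne (.iteTrue hm (.iteFalse ?_
          (.seq (hread true (by simp [h0])) (.iteTrue rfl (.act (.inc (h0.trans_le hB))))))),
          by omega, .inr ⟨hl, ?_⟩⟩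
        · simp [sem, Tst.Holds, hl]
        · simp only [Move.apply]; omega
      · refine ⟨f.atLeft, false, v .pos, .iteFalse hne (.iteTrue hm (.iteFalse ?_
          (.seq (hread false (by simpa using h0)) (.iteFalse ?_ ?_)))), by omega, .inr ⟨hl, ?_⟩⟩
        · simp [sem, Tst.Holds, hl]
        · simp [sem, Tst.Holds]
        · rw [hself]
          exact .skip _
        · simp only [Move.apply]; omega

variable (e : A ≃ Fin m)

/-- The input symbol given by a letter or by the end of the word. -/
def symbolOf : Option (Fin m) → InputSymbol A
  | some a => .letter (e.symm a)
  | none => .rightEnd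

theorem inputAt_succ (w : List A) (p : ℕ) :
    inputAt w (p + 1) = symbolOf e (w.map e)[p]? := by
  rw [List.getElem?_map, inputAt]
  cases w[p]? <;> simp [symbolOf]

/-- Determine the next transition. -/
def fetchTrans : CProg (MReg M) (MCtl M g) m :=
  .ite (.flag fun f => f.atLeft = true)
    (.act (.upd fun f => { f with pend := M.trans f.state .leftEnd f.scan }))
    (.act (.read .pos fun f o => { f with pend := M.trans f.state (symbolOf e o) f.scan }))

/-- The transition that is due in a configuration. -/
def transAt (w : List A) (c : Cfg M) :
    Option (M.State × Move × (Fin M.numTapes → M.Symbol × Move)) :=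
  M.trans c.state (inputAt w c.inputHead) (fun i => c.tape i (c.head i))

/-- A configuration is represented by a control value and the values of the registers. -/
structure CfgSim (S : ℕ) (w : List A) (c : Cfg M) (f : MCtl M g) (v : MReg M → ℕ) : Prop where
  state : f.state = c.state
  input : InputSim w.length f.atLeft (v .pos) c.inputHead
  tmp : v .tmp = 0
  tape : ∀ i, TapeSim E S (c.tape i) (c.head i) (f.scan i) (v (.left i)) (v (.right i))

variable {E}

theorem run_fetchTrans {B S : ℕ} {w : List A} {c : Cfg M} {f : MCtl M g} {v : MReg M → ℕ}
    (H : CfgSim E S w c f v) :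
    (sem B (w.map e)).Run (fetchTrans e) ⟨f, v⟩ ⟨{ f with pend := transAt w c }, v⟩ := by
  have hscan : f.scan = fun i => c.tape i (c.head i) := funext fun i => (H.tape i).scan.symm
  obtain ⟨hp, ⟨hl, h0, -⟩ | ⟨hl, h0⟩⟩ := H.input
  · refine .iteTrue hl ?_
    rw [transAt, ← hscan, ← H.state, h0]
    exact .act .upd
  · refine .iteFalse (by simp [sem, Tst.Holds, hl]) ?_
    rw [transAt, ← hscan, ← H.state, h0, inputAt_succ e]
    exact .act (.read (s := ⟨f, v⟩) (by simpa using hp))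

variable (E)

/-- Simulation of one step of a machine. -/
def stepProg : CProg (MReg M) (MCtl M g) m :=
  .seq moveInput (.seq (moveTapes E (List.finRange M.numTapes))
    (.seq (.act (.upd fun f => { f with state := f.nextState })) (fetchTrans e)))

variable {E}

/-- The transition due next is fetched at the end of each step, so halting shows in the control
value when the surrounding loop is tested. -/
theorem run_stepProg {B S : ℕ} {w : List A} (hw : w.length ≤ B) (hB : (g + 1) ^ S ≤ B + 1)
    {c c' : Cfg M} {f : MCtl M g} {v : MReg M → ℕ} (H : CfgSim E S w c f v)
    (hf : f.pend = transAt w c) (hc : M.step w c = some c') (hS : ∀ i, c'.head i < S) :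
    ∃ f' v', (sem B (w.map e)).Run (stepProg E e) ⟨f, v⟩ ⟨f', v'⟩ ∧ CfgSim E S w c' f' v' ∧
      f'.pend = transAt w c' := by
  simp only [Machine.step, Option.map_eq_some_iff] at hc
  obtain ⟨r, hr, rfl⟩ := hc
  rw [transAt, hr] at hf
  have hact : ∀ i, f.tapeAction i = r.2.2 i := fun i => by simp [MCtl.tapeAction, hf]
  obtain ⟨l, u, p, h₁, H₁⟩ := run_moveInput (x := w.map e) (by simpa using hw) f v
    (by simpa using H.input)
  obtain ⟨sc, d, v', h₂, ht, hp, H₂, -⟩ := run_moveTapes (x := w.map e) (t := c.tape) (h := c.head)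
    E hB (List.finRange _) (List.nodup_finRange _) { f with atLeft := l, aux := u }
    (Function.update v .pos p) (by simpa using H.tmp) (fun i _ => by simpa using H.tape i)
    (fun i _ => by
      have : (r.2.2 i).2.apply (c.head i) < S := hS i
      rwa [← hact i] at this)
  have H₃ : CfgSim E S w
      { state := r.1
        inputHead := min (r.2.1.apply c.inputHead) (w.length + 1)
        tape := fun i => Function.update (c.tape i) (c.head i) (r.2.2 i).1
        head := fun i => (r.2.2 i).2.apply (c.head i) }
      ({ f with atLeft := l, aux := u, scan := sc, digit := d, state := r.1 } : MCtl M g) v' := by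
    refine ⟨rfl, ?_, ht, fun i => ?_⟩
    · have hi : f.inputMove = r.2.1 := by simp [MCtl.inputMove, hf]
      simpa [hp, hi] using H₁
    · have := H₂ i (List.mem_finRange i)
      rwa [show MCtl.tapeAction { f with atLeft := l, aux := u } i = r.2.2 i from hact i] at this
  have hn : ({ f with atLeft := l, aux := u, scan := sc, digit := d } : MCtl M g).nextState =
      r.1 := by simp [MCtl.nextState, hf]
  have h₃ : (sem B (w.map e)).Run (.act (.upd fun f => { f with state := f.nextState }))
      ⟨({ f with atLeft := l, aux := u, scan := sc, digit := d } : MCtl M g), v'⟩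
      ⟨{ f with atLeft := l, aux := u, scan := sc, digit := d, state := r.1 }, v'⟩ := by
    rw [← hn]
    exact .act .upd
  exact ⟨_, v', .seq h₁ (.seq h₂ (.seq h₃ (run_fetchTrans e H₃))),
    ⟨H₃.state, H₃.input, H₃.tmp, H₃.tape⟩, rfl⟩

theorem run_steps {B S : ℕ} {w : List A} (hw : w.length ≤ B) (hB : (g + 1) ^ S ≤ B + 1)
    {c c' : Cfg M} {f : MCtl M g} {v : MReg M → ℕ} (H : CfgSim E S w c f v)
    (hf : f.pend = transAt w c)
    (hc : Relation.ReflTransGen (fun c₁ c₂ => M.step w c₁ = some c₂) c c')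
    (hc' : M.step w c' = none)
    (hS : ∀ c₁, Relation.ReflTransGen (fun c₁ c₂ => M.step w c₁ = some c₂) c c₁ →
      ∀ i, c₁.head i < S) :
    ∃ f' v', (sem B (w.map e)).Run (.loop (.flag fun f => f.pend ≠ none) (stepProg E e))
      ⟨f, v⟩ ⟨f', v'⟩ ∧ f'.state = c'.state := by
  induction hc using Relation.ReflTransGen.head_induction_on generalizing f v with
  | refl =>
    refine ⟨f, v, .loopFalse (not_not.2 ?_), H.state⟩
    simpa [hf, transAt, Machine.step] using hc'
  | head h _ ih =>
    obtain ⟨f₁, v₁, h₁, H₁, hf₁⟩ := run_stepProg e hw hB H hf h (hS _ (.single h))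
    obtain ⟨f₂, v₂, h₂, H₂⟩ := ih H₁ hf₁ (fun c₁ hc₁ => hS c₁ (.head h hc₁))
    refine ⟨f₂, v₂, .loopTrue (fun h' => ?_) h₁ h₂, H₂⟩
    rw [show f.pend = none from h'] at hf
    simp [Machine.step, show M.trans _ _ _ = none from hf.symm] at h

end Step

/-- This is where logarithmic space enters: `2 ^ (log₂ n + 1) ≤ 2 * n ≤ (n + 1) ^ 2` and `g + 1 ≤ 2
^ (g + 1)`, so after exchanging exponents the number of possible stacks is polynomial in `n`. -/
theorem pow_log_bound (g C n : ℕ) (hn : n ≠ 0) :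
    (g + 1) ^ (C * (Nat.log 2 n + 1)) ≤ (n + 1) ^ (2 * (g + 1) * C) := by
  have h1 : g + 1 ≤ 2 ^ (g + 1) := Nat.lt_two_pow_self.le
  have h2 : 2 ^ (Nat.log 2 n + 1) ≤ (n + 1) ^ 2 := by
    have := Nat.pow_log_le_self 2 hn
    rw [pow_succ]
    nlinarith
  calc (g + 1) ^ (C * (Nat.log 2 n + 1)) ≤ (2 ^ (g + 1)) ^ (C * (Nat.log 2 n + 1)) :=
        Nat.pow_le_pow_left h1 _
    _ = (2 ^ (Nat.log 2 n + 1)) ^ ((g + 1) * C) := by rw [← pow_mul, ← pow_mul]; congr 1; ring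
    _ ≤ ((n + 1) ^ 2) ^ ((g + 1) * C) := Nat.pow_le_pow_left h2 _
    _ = _ := by rw [← pow_mul]; congr 1; ring

theorem counterDecidable_of_mem_logspace {A : Type*} {m : ℕ} (e : A ≃ Fin m) {L : Language A}
    (hL : L ∈ LOGSPACE A) : CounterDecidable e L := by
  obtain ⟨M, C, hD, hS⟩ := hL
  have := M.finiteSymbol
  obtain ⟨g, ⟨E⟩⟩ := Finite.exists_equiv_fin M.Symbol
  refine .of_poly (ι := MReg M) (F := MCtl M g) ⟨M.start, true, fun _ => M.blank, none, 0, false⟩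
    {f | f.state ∈ M.accept}
    (.seq (fetchTrans e) (.loop (.flag fun f => f.pend ≠ none) (stepProg E e))) (2 * (g + 1) * C)
    fun w hw => ?_
  obtain ⟨c, hc, hc', hacc⟩ := hD w
  have hn : w.length ≠ 0 := by simpa using hw
  set f₀ : MCtl M g := ⟨M.start, true, fun _ => M.blank, none, 0, false⟩
  have H : CfgSim E (C * (Nat.log 2 w.length + 1)) w M.init f₀ 0 := by
    refine ⟨rfl, ⟨Nat.zero_le _, .inl ⟨rfl, rfl, rfl⟩⟩, rfl, fun i => ⟨[], [], rfl, rfl, rfl,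
      fun j => ?_, ?_⟩⟩
    · cases j <;> rfl
    -- The space bound for the initial configuration provides the one cell that is represented at
    -- the start.
    · have := hS w _ .refl i
      simp at this ⊢
      omega
  -- The exponent is positive even for `C = 0`, so input positions fit into the registers as well.
  have hB1 : w.length ≤ (w.length + 1) ^ (2 * (g + 1) * C + 1) - 1 := by
    have : w.length + 1 ≤ (w.length + 1) ^ (2 * (g + 1) * C + 1) :=
      Nat.le_self_pow (by omega) _
    omega
  have hB2 : (g + 1) ^ (C * (Nat.log 2 w.length + 1)) ≤
      (w.length + 1) ^ (2 * (g + 1) * C + 1) - 1 + 1 := by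
    have h1 := pow_log_bound g C w.length hn
    have h2 : (w.length + 1) ^ (2 * (g + 1) * C) ≤ (w.length + 1) ^ (2 * (g + 1) * C + 1) :=
      Nat.pow_le_pow_right (by omega) (by omega)
    omega
  obtain ⟨f', v', h, hf'⟩ := run_steps (f := { f₀ with pend := transAt w M.init }) (v := 0) e hB1
    hB2 ⟨H.state, H.input, H.tmp, H.tape⟩ rfl hc hc' (fun c₁ hc₁ i => hS w c₁ hc₁ i)
  refine ⟨⟨f', v'⟩, .seq (run_fetchTrans e H) h, ?_⟩
  show f'.state ∈ M.accept ↔ _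
  rw [hf', hacc]

end Logspace

/-! ### Predicates decided by counter programs -/

namespace Logspace

section Programs

variable {m n : ℕ} {x : List (Fin m)}

/-- Set the first component of the control value. -/
def setFlag (b : Bool) : CProg ℕ (Bool × Bool) m := .act (.upd fun f => (b, f.2))

/-- Copy register `i` to register `j`, with scratch register `t`. -/
def copy {F : Type} (i j t : ℕ) : CProg ℕ F m :=
  .seq (clear j) (.seq (clear t) (.seq
    (.loop (.pos i) (.seq (.act (.dec i)) (.seq (.act (.inc j)) (.act (.inc t)))))
    (addTimes 1 t i)))

theorem run_copy {F : Type} {i j t : ℕ} (hij : i ≠ j) (hit : i ≠ t) (hjt : j ≠ t) (f : F)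
    {v : ℕ → ℕ} (hv : ∀ r, v r ≤ n) :
    ∃ v', (sem n x).Run (copy i j t) ⟨f, v⟩ ⟨f, v'⟩ ∧ (∀ r, v' r ≤ n) ∧ v' j = v i ∧
      ∀ r, r ≠ j → r ≠ t → v' r = v r := by
  have key : ∀ (d : ℕ) (v : ℕ → ℕ), v i = d → v j + d ≤ n → v t + d ≤ n →
      (sem n x).Run
        (.loop (.pos i) (.seq (.act (.dec i)) (.seq (.act (.inc j)) (.act (.inc t)))))
        ⟨f, v⟩ ⟨f, Function.update (Function.update (Function.update v i 0) j (v j + d)) t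
          (v t + d)⟩ := by
    intro d
    induction d with
    | zero =>
      intro v hd _ _
      have h0 : Function.update v i 0 = v := by rw [← hd]; exact Function.update_eq_self i v
      simp only [h0, Nat.add_zero, Function.update_eq_self]
      exact .loopFalse (not_not.2 hd)
    | succ d ih =>
      intro v hd hj ht
      have h := ih (Function.update (Function.update (Function.update v i (v i - 1)) j (v j + 1)) t
        (v t + 1)) (by simp [hij, hit, hd]) (by simp [hjt]; omega) (by simp; omega)
      have h₁ := ActStep.inc (B := n) (x := x) (i := j)
        (s := ⟨f, Function.update v i (v i - 1)⟩)
        (show Function.update v i (v i - 1) j < n by rw [Function.update_of_ne hij.symm]; omega)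
      have h₂ := ActStep.inc (B := n) (x := x) (i := t)
        (s := ⟨f, Function.update (Function.update v i (v i - 1)) j (v j + 1)⟩)
        (show Function.update (Function.update v i (v i - 1)) j (v j + 1) t < n by
          simp [hjt.symm, hit.symm]; omega)
      simp only [Function.update_of_ne hij.symm] at h₁
      simp only [Function.update_of_ne hjt.symm, Function.update_of_ne hit.symm] at h₂
      refine .loopTrue (show v i ≠ 0 by omega) (.seq (.act (.dec (show 0 < v i by omega)))
        (.seq (.act h₁) (.act h₂))) ?_
      convert h using 2
      funext r
      by_cases hr : r = t
      · subst hr; simp; omega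
      by_cases hr' : r = j
      · subst hr'; simp [hr]; omega
      by_cases hr'' : r = i
      · subst hr''; simp [hr, hr']
      · simp [hr, hr', hr'']
  have h₁ := run_clear (B := n) (x := x) j ⟨f, v⟩
  have h₂ := run_clear (B := n) (x := x) t ⟨f, Function.update v j 0⟩
  have h₃ := key (v i) (Function.update (Function.update v j 0) t 0) (by simp [hij, hit])
    (by simp [hjt, hv i]) (by simp [hv i])
  have h₄ := run_addTimes (B := n) (x := x) 1 hit.symm f (Function.update (Function.update
    (Function.update (Function.update (Function.update v j 0) t 0) i 0) j (v i)) t (v i))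
    (by simp [hit, hij, hv i])
  simp only [Function.update_self, Function.update_of_ne hjt, Nat.zero_add] at h₃
  refine ⟨_, .seq h₁ (.seq h₂ (.seq h₃ h₄)), fun r => ?_, ?_, fun r hj ht => ?_⟩
  · refine bounded_update (bounded_update (bounded_update (bounded_update (bounded_update
      (bounded_update (bounded_update hv j ?_) t ?_) i ?_) j ?_) t ?_) t ?_) i ?_ r
    all_goals simp [hit, hij, hv i]
  · simp [hij.symm, hjt]
  · by_cases hi : r = i
    · subst hi; simp [hij, hit]
    · simp [hj, ht, hi]

/-- Subtract register `j` from register `i` and clear register `j`. The control value is updated if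
the difference is negative. -/
def subtract (i j : ℕ) : CProg ℕ (Bool × Bool) m :=
  .loop (.pos j) (.seq (.act (.dec j)) (.ite (.pos i) (.act (.dec i)) (setFlag false)))

/-- Each unit of `j` that no longer finds a unit in `i` clears the flag, so the comparison comes
with the truncated difference. -/
theorem run_subtract {i j : ℕ} (hij : i ≠ j) (f : Bool × Bool) (v : ℕ → ℕ) :
    (sem n x).Run (subtract i j) ⟨f, v⟩ ⟨(f.1 && decide (v j ≤ v i), f.2),
      Function.update (Function.update v j 0) i (v i - v j)⟩ := by
  generalize hd : v j = d
  induction d generalizing f v with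
  | zero =>
    have h0 : Function.update v j 0 = v := by rw [← hd]; exact Function.update_eq_self j v
    simp only [h0, Nat.sub_zero, Function.update_eq_self, Nat.zero_le, decide_true, Bool.and_true]
    exact .loopFalse (not_not.2 hd)
  | succ d ih =>
    refine .loopTrue (show v j ≠ 0 by omega)
      (s' := ⟨(f.1 && decide (v i ≠ 0), f.2),
        Function.update (Function.update v j (v j - 1)) i (v i - 1)⟩)
      (.seq (.act (.dec (show 0 < v j by omega))) ?_) ?_
    · by_cases h0 : v i = 0
      · have h1 : Function.update (Function.update v j (v j - 1)) i (v i - 1) =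
            Function.update v j (v j - 1) := by
          rw [show v i - 1 = Function.update v j (v j - 1) i by
            rw [Function.update_of_ne hij, h0], Function.update_eq_self]
        rw [h1]
        refine .iteFalse ?_ ?_
        · show ¬ Function.update v j (v j - 1) i ≠ 0
          rw [Function.update_of_ne hij]; exact not_not.2 h0
        · simp only [h0, ne_eq, not_true_eq_false, decide_false, Bool.and_false]
          exact .act .upd
      · refine .iteTrue ?_ ?_
        · show Function.update v j (v j - 1) i ≠ 0
          rwa [Function.update_of_ne hij]
        · have h1 := ActStep.dec (B := n) (x := x) (i := i)
            (s := ⟨f, Function.update v j (v j - 1)⟩)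
            (show 0 < Function.update v j (v j - 1) i by rw [Function.update_of_ne hij]; omega)
          simp only [Function.update_of_ne hij] at h1
          simpa [h0] using Sem.Run.act (M := sem n x) h1
    · convert ih (f.1 && decide (v i ≠ 0), f.2)
        (Function.update (Function.update v j (v j - 1)) i (v i - 1)) (by simp [hij.symm, hd])
        using 2
      · rfl
      · simp only [Function.update_self, Bool.and_assoc]
        congr 2
        rw [← Bool.decide_and, decide_eq_decide]
        omega
      · funext r
        by_cases hr : r = i
        · subst hr; simp; omega
        by_cases hr' : r = j
        · subst hr'; simp [hr]
        · simp [hr, hr']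

/-- Copy several registers. -/
def copyAll {F κ : Type} (src dst : κ → ℕ) (t : ℕ) : List κ → CProg ℕ F m
  | [] => .skip
  | i :: l => .seq (copy (src i) (dst i) t) (copyAll src dst t l)

theorem run_copyAll {F κ : Type} {src dst : κ → ℕ} {t : ℕ} (hd : Function.Injective dst)
    (hsd : ∀ i j, src i ≠ dst j) (hst : ∀ i, src i ≠ t) (hdt : ∀ i, dst i ≠ t) (f : F) (l : List κ)
    {v : ℕ → ℕ} (hv : ∀ r, v r ≤ n) :
    ∃ v', (sem n x).Run (copyAll src dst t l) ⟨f, v⟩ ⟨f, v'⟩ ∧ (∀ r, v' r ≤ n) ∧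
      (∀ i ∈ l, v' (dst i) = v (src i)) ∧ ∀ r, (∀ i ∈ l, r ≠ dst i) → r ≠ t → v' r = v r := by
  induction l generalizing v with
  | nil => exact ⟨v, .skip _, hv, by simp, by simp⟩
  | cons i l ih =>
    obtain ⟨v₁, h₁, hv₁, hi, hr₁⟩ := run_copy (x := x) (hsd i i) (hst i) (hdt i) f hv
    obtain ⟨v₂, h₂, hv₂, hl, hr₂⟩ := ih hv₁
    refine ⟨v₂, .seq h₁ h₂, hv₂, fun j hj => ?_, fun r hr ht => ?_⟩
    · by_cases hjl : j ∈ l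
      · rw [hl j hjl, hr₁ _ (hsd j i) (hst j)]
      · obtain rfl : j = i := by simpa [hjl] using hj
        rw [hr₂ _ (fun a ha h => hjl (by rwa [hd h])) (hdt j), hi]
    · rw [hr₂ r (fun a ha => hr a (List.mem_cons_of_mem _ ha)) ht,
        hr₁ r (hr i List.mem_cons_self) ht]

theorem run_fill_of_le (hx : x.length = n) (i : ℕ) (f : Bool × Bool) {v : ℕ → ℕ}
    (hv : ∀ r, v r ≤ n) :
    (sem n x).Run (fill i) ⟨f, v⟩ ⟨(f.1, false), Function.update v i n⟩ := by
  subst hx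
  exact run_fill i ⟨f, v⟩ (hv i)

/-- Run a program with all values of the registers in a list, until the control value indicates
success. -/
def searchAll (p : CProg ℕ (Bool × Bool) m) : List ℕ → CProg ℕ (Bool × Bool) m
  | [] => p
  | r :: l => .seq (fill r) (.seq (searchAll p l) (.seq (continueIf r)
      (.loop (.flag fun f => f.2 = true) (.seq (.act (.dec r)) (.seq (searchAll p l) (continueIf r))))))
where
  /-- Another value of the register has to be tried. -/
  continueIf (r : ℕ) : CProg ℕ (Bool × Bool) m :=
    .ite (.pos r) (.act (.upd fun f => (f.1, !f.1))) (.act (.upd fun f => (f.1, false)))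

theorem run_continueIf (r : ℕ) (f : Bool × Bool) (v : ℕ → ℕ) :
    (sem n x).Run (searchAll.continueIf r) ⟨f, v⟩ ⟨(f.1, !f.1 && decide (v r ≠ 0)), v⟩ := by
  by_cases h : v r = 0
  · simp only [h, ne_eq, not_true_eq_false, decide_false, Bool.and_false]
    exact .iteFalse (not_not.2 h) (.act .upd)
  · simp only [h, ne_eq, not_false_eq_true, decide_true, Bool.and_true]
    exact .iteTrue h (.act .upd)

/-- Tuples are tried downwards from the maximal one until the first success. The registers in `l`
then hold a witness and not merely a verdict; the iteration in `Dec.dtc` takes the next point from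
them. As `q` depends only on registers below `N`, the scratch registers of `p` do no harm. -/
theorem run_searchAll (hx : x.length = n) {N : ℕ} {p : CProg ℕ (Bool × Bool) m}
    {q : (ℕ → ℕ) → Prop} (hq : ∀ v v', (∀ i < N, v' i = v i) → (q v' ↔ q v))
    (hp : ∀ f v, (∀ i, v i ≤ n) → ∃ f' v', (sem n x).Run p ⟨f, v⟩ ⟨f', v'⟩ ∧ (∀ i, v' i ≤ n) ∧
      (∀ i < N, v' i = v i) ∧ (f'.1 = true ↔ q v))
    (l : List ℕ) (hl : l.Nodup) (hN : ∀ r ∈ l, r < N) (f : Bool × Bool) {v : ℕ → ℕ}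
    (hv : ∀ i, v i ≤ n) :
    ∃ f' v', (sem n x).Run (searchAll p l) ⟨f, v⟩ ⟨f', v'⟩ ∧ (∀ i, v' i ≤ n) ∧
      (∀ i < N, i ∉ l → v' i = v i) ∧ (f'.1 = true → q v') ∧
      ((∃ u, (∀ i, u i ≤ n) ∧ (∀ i < N, i ∉ l → u i = v i) ∧ q u) → f'.1 = true) := by
  induction l generalizing f v with
  | nil =>
    obtain ⟨f', v', h, hv', hvN, hf⟩ := hp f v hv
    refine ⟨f', v', h, hv', fun i hi _ => hvN i hi, fun h => (hq v v' hvN).2 (hf.1 h), ?_⟩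
    rintro ⟨u, -, hu, hqu⟩
    exact hf.2 ((hq v u fun i hi => hu i hi (by simp)).1 hqu)
  | cons r l ih =>
    rw [List.nodup_cons] at hl
    have hrN := hN r List.mem_cons_self
    have ih' := fun f v => ih hl.2 (fun i hi => hN i (List.mem_cons_of_mem _ hi)) f (v := v)
    -- Here `y` is the value of `r` tried last and `a` its outcome; the loop is responsible for the
    -- values below `y`.
    have key : ∀ (y : ℕ) (a : Bool) (v : ℕ → ℕ), (∀ i, v i ≤ n) → v r = y → (a = true → q v) →
        ∃ f' v', (sem n x).Run (.loop (.flag fun f => f.2 = true)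
            (.seq (.act (.dec r)) (.seq (searchAll p l) (searchAll.continueIf r))))
            ⟨(a, !a && decide (v r ≠ 0)), v⟩ ⟨f', v'⟩ ∧ (∀ i, v' i ≤ n) ∧
          (∀ i < N, i ∉ r :: l → v' i = v i) ∧ (f'.1 = true → q v') ∧ (a = true → f'.1 = true) ∧
          ((∃ u, (∀ i, u i ≤ n) ∧ (∀ i < N, i ∉ r :: l → u i = v i) ∧ u r < y ∧ q u) →
            f'.1 = true) := by
      intro y
      induction y with
      | zero =>
        intro a v hv hy ha
        exact ⟨_, v, .loopFalse (by simp [sem, Tst.Holds, hy]), hv, fun _ _ _ => rfl, ha, id,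
          by simp⟩
      | succ y ihy =>
        intro a v hv hy ha
        cases a with
        | true =>
          exact ⟨_, v, .loopFalse (by simp [sem, Tst.Holds]), hv, fun _ _ _ => rfl, ha, id,
            fun _ => rfl⟩
        | false =>
          obtain ⟨f₁, v₁, h₁, hv₁, hN₁, hf₁, hu₁⟩ := ih' (false, true)
            (Function.update v r (v r - 1))
            (bounded_update hv r ((Nat.sub_le _ _).trans (hv r)))
          have hr₁ : v₁ r = y := by
            rw [hN₁ r hrN hl.1, Function.update_self]; omega
          have hN₁' : ∀ i < N, i ∉ r :: l → v₁ i = v i := fun i hi hil => by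
            simp only [List.mem_cons, not_or] at hil
            rw [hN₁ i hi hil.2, Function.update_of_ne hil.1]
          obtain ⟨f₂, v₂, h₂, hv₂, hN₂, hf₂, ha₂, hu₂⟩ := ihy f₁.1 v₁ hv₁ hr₁ hf₁
          refine ⟨f₂, v₂, .loopTrue ?_ (.seq (.act ?_) (.seq h₁ (run_continueIf r f₁ v₁))) h₂, hv₂,
            fun i hi hil => (hN₂ i hi hil).trans (hN₁' i hi hil), hf₂, by simp, ?_⟩
          · simp [sem, Tst.Holds, hy]
          · simp only [hy, Bool.not_false, ne_eq, Nat.add_eq_zero_iff, one_ne_zero, and_false,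
              not_false_eq_true, decide_true, Bool.and_true]
            have := ActStep.dec (B := n) (x := x) (i := r) (s := ⟨(false, true), v⟩)
              (show 0 < v r by omega)
            rw [← hy]
            exact this
          · rintro ⟨u, hu, huN, hur, hqu⟩
            rcases Nat.lt_succ_iff_lt_or_eq.1 hur with hur | hur
            · exact hu₂ ⟨u, hu, fun i hi hil => (huN i hi hil).trans (hN₁' i hi hil).symm, hur, hqu⟩
            · refine ha₂ (hu₁ ⟨u, hu, fun i hi hil => ?_, hqu⟩)
              by_cases hir : i = r
              · subst hir; rw [hur, Function.update_self]; omega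
              · rw [huN i hi (by simp [hir, hil]), Function.update_of_ne hir]
    obtain ⟨f₁, v₁, h₁, hv₁, hN₁, hf₁, hu₁⟩ := ih' (f.1, false) (Function.update v r n)
      (bounded_update hv r le_rfl)
    have hr₁ : v₁ r = n := by rw [hN₁ r hrN hl.1, Function.update_self]
    have hN₁' : ∀ i < N, i ∉ r :: l → v₁ i = v i := fun i hi hil => by
      simp only [List.mem_cons, not_or] at hil
      rw [hN₁ i hi hil.2, Function.update_of_ne hil.1]
    obtain ⟨f₂, v₂, h₂, hv₂, hN₂, hf₂, ha₂, hu₂⟩ := key n f₁.1 v₁ hv₁ hr₁ hf₁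
    refine ⟨f₂, v₂, .seq (run_fill_of_le hx r f hv) (.seq h₁ (.seq (run_continueIf r f₁ v₁) h₂)),
      hv₂, fun i hi hil => (hN₂ i hi hil).trans (hN₁' i hi hil), hf₂, ?_⟩
    rintro ⟨u, hu, huN, hqu⟩
    rcases (hu r).lt_or_eq with hur | hur
    · exact hu₂ ⟨u, hu, fun i hi hil => (huN i hi hil).trans (hN₁' i hi hil).symm, hur, hqu⟩
    · refine ha₂ (hu₁ ⟨u, hu, fun i hi hil => ?_, hqu⟩)
      by_cases hir : i = r
      · subst hir; rw [hur, Function.update_self]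
      · rw [huN i hi (by simp [hir, hil]), Function.update_of_ne hir]

/-- Run a program once for every tuple of values of the registers in a list. -/
def repeatAll (p : CProg ℕ (Bool × Bool) m) : List ℕ → CProg ℕ (Bool × Bool) m
  | [] => p
  | r :: l => .seq (fill r) (.seq (repeatAll p l)
      (.loop (.pos r) (.seq (.act (.dec r)) (repeatAll p l))))

/-- The registers in `l` are a clock with `(n + 1) ^ l.length` ticks, and `I` is indexed by the
number of executions of `p`. The clock lies in `U`, which `p` preserves and on which `I` does not
depend. -/
theorem run_repeatAll (hx : x.length = n) {U : Set ℕ} {p : CProg ℕ (Bool × Bool) m}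
    {I : ℕ → (ℕ → ℕ) → Prop} (hI : ∀ j v v', (∀ i ∉ U, v' i = v i) → I j v → I j v')
    (hp : ∀ j f v, (∀ i, v i ≤ n) → I j v → ∃ f' v', (sem n x).Run p ⟨f, v⟩ ⟨f', v'⟩ ∧
      (∀ i, v' i ≤ n) ∧ (∀ i ∈ U, v' i = v i) ∧ I (j + 1) v')
    (l : List ℕ) (hl : l.Nodup) (hU : ∀ r ∈ l, r ∈ U) (j : ℕ) (f : Bool × Bool) {v : ℕ → ℕ}
    (hv : ∀ i, v i ≤ n) (hj : I j v) :
    ∃ f' v', (sem n x).Run (repeatAll p l) ⟨f, v⟩ ⟨f', v'⟩ ∧ (∀ i, v' i ≤ n) ∧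
      (∀ i ∈ U, i ∉ l → v' i = v i) ∧ I (j + (n + 1) ^ l.length) v' := by
  induction l generalizing j f v with
  | nil =>
    obtain ⟨f', v', h, hv', hvU, hj'⟩ := hp j f v hv hj
    exact ⟨f', v', h, hv', fun i hi _ => hvU i hi, hj'⟩
  | cons r l ih =>
    rw [List.nodup_cons] at hl
    have hrU := hU r List.mem_cons_self
    have ih' := fun j f v => ih hl.2 (fun i hi => hU i (List.mem_cons_of_mem _ hi)) j f (v := v)
    have hIr : ∀ j v y, I j v → I j (Function.update v r y) := fun j v y =>
      hI j v _ fun i hi => Function.update_of_ne (fun h => hi (by rwa [h])) _ _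
    have key : ∀ (y j : ℕ) (f : Bool × Bool) (v : ℕ → ℕ), (∀ i, v i ≤ n) → v r = y → I j v →
        ∃ f' v', (sem n x).Run (.loop (.pos r) (.seq (.act (.dec r)) (repeatAll p l)))
            ⟨f, v⟩ ⟨f', v'⟩ ∧ (∀ i, v' i ≤ n) ∧
          (∀ i ∈ U, i ∉ r :: l → v' i = v i) ∧ I (j + y * (n + 1) ^ l.length) v' := by
      intro y
      induction y with
      | zero =>
        intro j f v hv hy hj
        exact ⟨f, v, .loopFalse (not_not.2 hy), hv, fun _ _ _ => rfl, by simpa using hj⟩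
      | succ y ihy =>
        intro j f v hv hy hj
        obtain ⟨f₁, v₁, h₁, hv₁, hN₁, hj₁⟩ := ih' j f (Function.update v r (v r - 1))
          (bounded_update hv r ((Nat.sub_le _ _).trans (hv r))) (hIr j v _ hj)
        have hr₁ : v₁ r = y := by rw [hN₁ r hrU hl.1, Function.update_self]; omega
        obtain ⟨f₂, v₂, h₂, hv₂, hN₂, hj₂⟩ := ihy _ f₁ v₁ hv₁ hr₁ hj₁
        refine ⟨f₂, v₂, .loopTrue (show v r ≠ 0 by omega)
          (.seq (.act (.dec (show 0 < v r by omega))) h₁) h₂, hv₂, fun i hi hil => ?_, ?_⟩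
        · rw [hN₂ i hi hil]
          simp only [List.mem_cons, not_or] at hil
          rw [hN₁ i hi hil.2, Function.update_of_ne hil.1]
        · rwa [Nat.add_mul, Nat.one_mul, Nat.add_comm (y * _), ← Nat.add_assoc]
    obtain ⟨f₁, v₁, h₁, hv₁, hN₁, hj₁⟩ := ih' j (f.1, false) (Function.update v r n)
      (bounded_update hv r le_rfl) (hIr j v _ hj)
    have hr₁ : v₁ r = n := by rw [hN₁ r hrU hl.1, Function.update_self]
    obtain ⟨f₂, v₂, h₂, hv₂, hN₂, hj₂⟩ := key n _ f₁ v₁ hv₁ hr₁ hj₁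
    refine ⟨f₂, v₂, .seq (run_fill_of_le hx r f hv) (.seq h₁ h₂), hv₂, fun i hi hil => ?_, ?_⟩
    · rw [hN₂ i hi hil]
      simp only [List.mem_cons, not_or] at hil
      rw [hN₁ i hi hil.2, Function.update_of_ne hil.1]
    · rw [List.length_cons, pow_succ']
      convert hj₂ using 1
      ring

end Programs

end Logspace

/-! ### Closure of decidable predicates under first-order logic -/

namespace Logspace

/-- The program decides `p` on nonempty words, and it preserves the registers below `N`. -/
def Decides {A : Type*} {m : ℕ} (e : A ≃ Fin m) (P : CProg ℕ (Bool × Bool) m) (N : ℕ)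
    (p : List A → (ℕ → ℕ) → Prop) : Prop :=
  ∀ w : List A, w ≠ [] → ∀ (f : Bool × Bool) (v : ℕ → ℕ), (∀ i, v i ≤ w.length) →
    ∃ f' v', (sem w.length (w.map e)).Run P ⟨f, v⟩ ⟨f', v'⟩ ∧ (∀ i, v' i ≤ w.length) ∧
      (∀ i < N, v' i = v i) ∧ (f'.1 = true ↔ p w v)

/-- The predicate on words and positions is decided by counter programs. -/
def Dec {A : Type*} {m : ℕ} (e : A ≃ Fin m) {κ : Type} (p : List A → (κ → ℕ) → Prop) : Prop :=
  ∀ (σ : κ → ℕ) (N : ℕ), (∀ i, σ i < N) → ∃ P, Decides e P N fun w v => p w (v ∘ σ)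

namespace Dec

variable {A : Type*} {m : ℕ} {e : A ≃ Fin m} {κ : Type}

theorem congr {p q : List A → (κ → ℕ) → Prop} (hp : Dec e p)
    (h : ∀ w ≠ [], ∀ v, (∀ i, v i ≤ w.length) → (p w v ↔ q w v)) : Dec e q := by
  intro σ N hσ
  obtain ⟨P, hP⟩ := hp σ N hσ
  refine ⟨P, fun w hw f v hv => ?_⟩
  obtain ⟨f', v', hr, hv', hN, hf⟩ := hP w hw f v hv
  exact ⟨f', v', hr, hv', hN, hf.trans (h w hw _ fun i => hv _)⟩

/-- Decidability is demanded for every placement of the arguments in registers, so a change of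
variables is just another placement. -/
theorem comp {κ' : Type} {p : List A → (κ → ℕ) → Prop} (hp : Dec e p) (τ : κ → κ') :
    Dec e fun w (v : κ' → ℕ) => p w (v ∘ τ) :=
  fun σ N hσ => hp (σ ∘ τ) N fun i => hσ (τ i)

theorem const (b : Prop) : Dec e fun _ (_ : κ → ℕ) => b := by
  classical
  exact fun σ N hσ => ⟨setFlag (decide b), fun w hw f v hv =>
    ⟨_, v, .act .upd, hv, fun _ _ => rfl, by simp⟩⟩

theorem not {p : List A → (κ → ℕ) → Prop} (hp : Dec e p) : Dec e fun w v => ¬ p w v := by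
  intro σ N hσ
  obtain ⟨P, hP⟩ := hp σ N hσ
  refine ⟨.seq P (.act (.upd fun f => (!f.1, f.2))), fun w hw f v hv => ?_⟩
  obtain ⟨f', v', hr, hv', hN, hf⟩ := hP w hw f v hv
  exact ⟨_, v', .seq hr (.act .upd), hv', hN, by simp [← hf]⟩

theorem and {p q : List A → (κ → ℕ) → Prop} (hp : Dec e p) (hq : Dec e q) :
    Dec e fun w v => p w v ∧ q w v := by
  intro σ N hσ
  obtain ⟨P, hP⟩ := hp σ N hσ
  obtain ⟨Q, hQ⟩ := hq σ N hσ
  refine ⟨.seq P (.ite (.flag fun f => f.1 = true) Q .skip), fun w hw f v hv => ?_⟩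
  obtain ⟨f₁, v₁, hr₁, hv₁, hN₁, hf₁⟩ := hP w hw f v hv
  by_cases h : f₁.1 = true
  · obtain ⟨f₂, v₂, hr₂, hv₂, hN₂, hf₂⟩ := hQ w hw f₁ v₁ hv₁
    refine ⟨f₂, v₂, .seq hr₁ (.iteTrue h hr₂), hv₂, fun i hi => (hN₂ i hi).trans (hN₁ i hi), ?_⟩
    have hv : v₁ ∘ σ = v ∘ σ := funext fun i => hN₁ _ (hσ i)
    have hp : p w (v ∘ σ) := hf₁.1 h
    simp only [hf₂, hv, hp, true_and]
  · refine ⟨f₁, v₁, .seq hr₁ (.iteFalse h (.skip _)), hv₁, hN₁, ?_⟩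
    rw [hf₁] at h ⊢
    simp [h]

theorem or {p q : List A → (κ → ℕ) → Prop} (hp : Dec e p) (hq : Dec e q) :
    Dec e fun w v => p w v ∨ q w v :=
  (hp.not.and hq.not).not.congr fun _ _ _ _ => by tauto

theorem imp {p q : List A → (κ → ℕ) → Prop} (hp : Dec e p) (hq : Dec e q) :
    Dec e fun w v => p w v → q w v :=
  (hp.not.or hq).congr fun _ _ _ _ => by tauto

theorem iff {p q : List A → (κ → ℕ) → Prop} (hp : Dec e p) (hq : Dec e q) :
    Dec e fun w v => (p w v ↔ q w v) :=
  ((hp.imp hq).and (hq.imp hp)).congr fun _ _ _ _ => by tauto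

theorem forall_mem {β : Type*} {p : β → List A → (κ → ℕ) → Prop} (l : List β)
    (hp : ∀ b ∈ l, Dec e (p b)) : Dec e fun w v => ∀ b ∈ l, p b w v := by
  induction l with
  | nil => exact (const True).congr fun _ _ _ _ => by simp
  | cons b l ih =>
    exact ((hp b List.mem_cons_self).and (ih fun b hb => hp b (List.mem_cons_of_mem _ hb))).congr
      fun _ _ _ _ => by simp

theorem exists_mem {β : Type*} {p : β → List A → (κ → ℕ) → Prop} (l : List β)
    (hp : ∀ b ∈ l, Dec e (p b)) : Dec e fun w v => ∃ b ∈ l, p b w v :=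
  (forall_mem l fun b hb => (hp b hb).not).not.congr fun _ _ _ _ => by push Not; rfl

theorem exists_finite {β : Type*} [Finite β] {p : β → List A → (κ → ℕ) → Prop}
    (hp : ∀ b, Dec e (p b)) : Dec e fun w v => ∃ b, p b w v := by
  have := Fintype.ofFinite β
  exact (exists_mem Finset.univ.toList fun b _ => hp b).congr fun _ _ _ _ => by simp

theorem forall_finite {β : Type*} [Finite β] {p : β → List A → (κ → ℕ) → Prop}
    (hp : ∀ b, Dec e (p b)) : Dec e fun w v => ∀ b, p b w v :=
  (exists_finite fun b => (hp b).not).not.congr fun _ _ _ _ => by push Not; rfl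

theorem letter (i : κ) (a : A) : Dec e fun w v => w[v i]? = some a := by
  intro σ N hσ
  refine ⟨.act (.read (σ i) fun f o => (decide (o = some (e a)), f.2)), fun w hw f v hv =>
    ⟨_, v, .act (.read ?_), hv, fun _ _ => rfl, ?_⟩⟩
  · simpa using hv (σ i)
  · simp

theorem length_le (i : κ) : Dec e fun w v => w.length ≤ v i := by
  intro σ N hσ
  refine ⟨.act (.read (σ i) fun f o => (decide (o = none), f.2)), fun w hw f v hv =>
    ⟨_, v, .act (.read ?_), hv, fun _ _ => rfl, ?_⟩⟩
  · simpa using hv (σ i)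
  · simp

theorem eq_zero (i : κ) : Dec e fun _ v => v i = 0 := by
  intro σ N hσ
  refine ⟨.ite (.pos (σ i)) (setFlag false) (setFlag true), fun w hw f v hv => ?_⟩
  by_cases h : v (σ i) = 0
  · exact ⟨_, v, .iteFalse (not_not.2 h) (.act .upd), hv, fun _ _ => rfl, by simp [h]⟩
  · exact ⟨_, v, .iteTrue h (.act .upd), hv, fun _ _ => rfl, by simp [h]⟩

/-- The sum could exceed the register bound and is never formed. Instead `v i` and `v d` are
subtracted from a copy of `v l`: equality holds if no subtraction is truncated and nothing remains.
-/
theorem add_eq (i d l : κ) : Dec e fun _ v => v i + v d = v l := by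
  intro σ N hσ
  have hi := hσ i
  have hd := hσ d
  have hl := hσ l
  refine ⟨.seq (setFlag true) (.seq (copy (σ l) N (N + 2)) (.seq (copy (σ i) (N + 1) (N + 2))
    (.seq (subtract N (N + 1)) (.seq (copy (σ d) (N + 1) (N + 2)) (.seq (subtract N (N + 1))
      (.ite (.pos N) (setFlag false) .skip)))))), fun w hw f v hv => ?_⟩
  obtain ⟨v₁, h₁, hv₁, e₁, r₁⟩ := run_copy (x := w.map e) (i := σ l) (j := N) (t := N + 2)
    (by omega) (by omega) (by omega) (true, f.2) hv
  obtain ⟨v₂, h₂, hv₂, e₂, r₂⟩ := run_copy (x := w.map e) (i := σ i) (j := N + 1) (t := N + 2)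
    (by omega) (by omega) (by omega) (true, f.2) hv₁
  have h₃ := run_subtract (n := w.length) (x := w.map e) (i := N) (j := N + 1) (by omega)
    (true, f.2) v₂
  rw [r₁ _ (by omega) (by omega)] at e₂
  rw [e₂, r₂ N (by omega) (by omega), e₁] at h₃
  set v₃ := Function.update (Function.update v₂ (N + 1) 0) N (v (σ l) - v (σ i)) with hv₃'
  have hv₃ : ∀ r, v₃ r ≤ w.length := bounded_update (bounded_update hv₂ _ (Nat.zero_le _)) _
    ((Nat.sub_le _ _).trans (hv _))
  have r₃ : ∀ r < N, v₃ r = v r := fun r hr => by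
    rw [hv₃', Function.update_of_ne (by omega), Function.update_of_ne (by omega),
      r₂ r (by omega) (by omega), r₁ r (by omega) (by omega)]
  obtain ⟨v₄, h₄, hv₄, e₄, r₄⟩ := run_copy (x := w.map e) (i := σ d) (j := N + 1) (t := N + 2)
    (by omega) (by omega) (by omega) (true && decide (v (σ i) ≤ v (σ l)), f.2) hv₃
  have h₅ := run_subtract (n := w.length) (x := w.map e) (i := N) (j := N + 1) (by omega)
    (true && decide (v (σ i) ≤ v (σ l)), f.2) v₄
  rw [r₃ _ hd] at e₄
  rw [e₄, r₄ N (by omega) (by omega), hv₃', Function.update_self] at h₅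
  have hv₅ := bounded_update (bounded_update hv₄ (N + 1) (Nat.zero_le _)) N
    (y := v (σ l) - v (σ i) - v (σ d)) (by have := hv (σ l); omega)
  have r₅ : ∀ r < N, Function.update (Function.update v₄ (N + 1) 0) N
      (v (σ l) - v (σ i) - v (σ d)) r = v r := fun r hr => by
    rw [Function.update_of_ne (by omega), Function.update_of_ne (by omega),
      r₄ r (by omega) (by omega), r₃ r hr]
  by_cases h0 : v (σ l) - v (σ i) - v (σ d) = 0
  · refine ⟨_, _, .seq (.act .upd) (.seq h₁ (.seq h₂ (.seq h₃ (.seq h₄ (.seq h₅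
      (.iteFalse ?_ (.skip _))))))), hv₅, r₅, ?_⟩
    · simpa [sem, Tst.Holds] using h0
    · simp; omega
  · refine ⟨_, _, .seq (.act .upd) (.seq h₁ (.seq h₂ (.seq h₃ (.seq h₄ (.seq h₅
      (.iteTrue ?_ (.act .upd))))))), hv₅, r₅, ?_⟩
    · simpa [sem, Tst.Holds] using h0
    · simp; omega

/-- Unlike in a mere existence test, the witness stays in the registers `ρ`, where further programs
can use it. -/
theorem exists_search {τ : Type} [Finite τ] {p : List A → (κ ⊕ τ → ℕ) → Prop} (hp : Dec e p)
    {σ : κ → ℕ} {ρ : τ → ℕ} (hρ : Function.Injective ρ) {N : ℕ} (hσN : ∀ i, σ i < N)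
    (hρN : ∀ i, ρ i < N) (hσρ : ∀ i j, σ i ≠ ρ j) :
    ∃ P : CProg ℕ (Bool × Bool) m, ∀ w : List A, w ≠ [] → ∀ (f : Bool × Bool) (v : ℕ → ℕ),
      (∀ i, v i ≤ w.length) → ∃ f' v', (sem w.length (w.map e)).Run P ⟨f, v⟩ ⟨f', v'⟩ ∧
        (∀ i, v' i ≤ w.length) ∧ (∀ i < N, i ∉ Set.range ρ → v' i = v i) ∧
        (f'.1 = true → p w (Sum.elim (v ∘ σ) (v' ∘ ρ))) ∧
        ((∃ u : τ → ℕ, (∀ i, u i ≤ w.length) ∧ p w (Sum.elim (v ∘ σ) u)) → f'.1 = true) := by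
  have := Fintype.ofFinite τ
  have hlt : ∀ i, Sum.elim σ ρ i < N := by rintro (i | i) <;> simp [hσN, hρN]
  obtain ⟨P, hP⟩ := hp (Sum.elim σ ρ) N hlt
  refine ⟨searchAll P (Finset.univ.toList.map ρ), fun w hw f v hv => ?_⟩
  have hmem : ∀ i, i ∈ Finset.univ.toList.map ρ ↔ i ∈ Set.range ρ := by simp
  obtain ⟨f', v', h, hv', hN, hf, hu⟩ := run_searchAll (n := w.length) (x := w.map e) (by simp)
    (q := fun v => p w (v ∘ Sum.elim σ ρ))
    (fun v v' h => by rw [show v' ∘ Sum.elim σ ρ = v ∘ Sum.elim σ ρ from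
      funext fun i => h _ (hlt i)])
    (hP w hw) (Finset.univ.toList.map ρ) ((Finset.nodup_toList _).map hρ)
    (fun r hr => by
      obtain ⟨i, rfl⟩ := (hmem r).1 hr
      exact hρN i) f hv
  simp only [hmem] at hN hu
  refine ⟨f', v', h, hv', hN, fun h => ?_, ?_⟩
  · have := hf h
    rwa [Sum.comp_elim, show v' ∘ σ = v ∘ σ from funext fun i =>
      hN _ (hσN i) (by rintro ⟨j, hj⟩; exact hσρ i j hj.symm)] at this
  · rintro ⟨u, hu', hpu⟩
    refine hu ⟨Function.extend ρ u v, fun i => ?_, fun i _ hi => ?_, ?_⟩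
    · by_cases hi : i ∈ Set.range ρ
      · obtain ⟨j, rfl⟩ := hi
        rw [hρ.extend_apply]
        exact hu' j
      · rw [Function.extend_apply' _ _ _ hi]
        exact hv i
    · rw [Function.extend_apply' _ _ _ hi]
    · rw [Sum.comp_elim, Function.extend_comp hρ, show Function.extend ρ u v ∘ σ = v ∘ σ from
        funext fun i => Function.extend_apply' _ _ _ (by rintro ⟨j, hj⟩; exact hσρ i j hj.symm)]
      exact hpu

theorem ex {τ : Type} [Finite τ] {p : List A → (κ ⊕ τ → ℕ) → Prop} (hp : Dec e p) :
    Dec e fun w v => ∃ u : τ → ℕ, (∀ i, u i ≤ w.length) ∧ p w (Sum.elim v u) := by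
  intro σ N hσ
  obtain ⟨k, ⟨E⟩⟩ := Finite.exists_equiv_fin τ
  obtain ⟨P, hP⟩ := exists_search hp (σ := σ) (ρ := fun i => N + (E i).val) (N := N + k)
    (fun i j h => E.injective (Fin.ext (by simpa using h)))
    (fun i => (hσ i).trans_le (Nat.le_add_right _ _))
    (fun i => Nat.add_lt_add_left (E i).isLt _)
    (fun i j h => by have := hσ i; omega)
  refine ⟨P, fun w hw f v hv => ?_⟩
  obtain ⟨f', v', h, hv', hN, hf, hu⟩ := hP w hw f v hv
  exact ⟨f', v', h, hv', fun i hi => hN i (by omega) (by rintro ⟨j, hj⟩; simp at hj; omega),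
    fun h => ⟨_, fun i => hv' _, hf h⟩, hu⟩

/-- Quantification over a single position. -/
theorem ex_one {p : List A → (κ → ℕ) → ℕ → Prop}
    (hp : Dec e fun w (v : Option κ → ℕ) => p w (v ∘ some) (v none)) :
    Dec e fun w v => ∃ y ≤ w.length, p w v y := by
  refine (ex (τ := Unit) (hp.comp fun o => o.elim (.inr ()) .inl)).congr fun w _ v _ => ?_
  constructor
  · rintro ⟨u, hu, h⟩
    exact ⟨u (), hu (), h⟩
  · rintro ⟨y, hy, h⟩
    exact ⟨fun _ => y, fun _ => hy, h⟩

theorem all_one {p : List A → (κ → ℕ) → ℕ → Prop}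
    (hp : Dec e fun w (v : Option κ → ℕ) => p w (v ∘ some) (v none)) :
    Dec e fun w v => ∀ y ≤ w.length, p w v y :=
  (ex_one (p := fun w v y => ¬ p w v y) hp.not).not.congr fun _ _ _ _ => by push Not; rfl

theorem le (i j : κ) : Dec e fun _ v => v i ≤ v j :=
  (ex_one (p := fun _ v y => v i + y = v j) (add_eq (some i) none (some j))).congr
    fun w _ v hv => ⟨fun ⟨y, _, h⟩ => by omega, fun h => ⟨v j - v i, (Nat.sub_le _ _).trans (hv j),
      by omega⟩⟩

theorem lt (i j : κ) : Dec e fun _ v => v i < v j :=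
  (le j i).not.congr fun _ _ _ _ => by omega

theorem eq (i j : κ) : Dec e fun _ v => v i = v j :=
  ((le i j).and (le j i)).congr fun _ _ _ _ => by omega

end Dec

/-! ### Deterministic transitive closure -/

/-- Before the first terminal point, `g` has to agree with the partial function `step`, so its
iterates follow the given path. -/
theorem exists_iterate_of_reflTransGen {X : Type*} {step : X → X → Prop} {term : X → Prop}
    (hstep : ∀ x y y', step x y → step x y' → y = y') {g : X → X}
    (hg : ∀ x y, ¬ term x → step x y → step x (g x)) {x y : X}
    (h : Relation.ReflTransGen step x y) (hy : term y) : ∃ j, term (g^[j] x) := by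
  induction h using Relation.ReflTransGen.head_induction_on with
  | refl => exact ⟨0, hy⟩
  | @head a _ h _ ih =>
    by_cases ha : term a
    · exact ⟨0, ha⟩
    · obtain ⟨j, hj⟩ := ih
      refine ⟨j + 1, ?_⟩
      rwa [Function.iterate_succ_apply, hstep _ _ _ (hg _ _ ha h) h]

/-- Pigeonhole: if the first terminal iterate came later than the number of codes, two earlier
iterates would coincide, and skipping the cycle would reach a terminal point sooner. Terminal points
are fixed by `g`, so overshooting is harmless. -/
theorem iterate_of_card {X V : Type*} [Fintype V] {term : X → Prop} {g : X → X}
    (hg : ∀ x, term x → g x = x) (enc : V → X) {x : X} (hx : ∀ j, ∃ v, enc v = g^[j] x)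
    (h : ∃ j, term (g^[j] x)) : term (g^[Fintype.card V] x) := by
  classical
  have hmono : ∀ j d, term (g^[j] x) → g^[d + j] x = g^[j] x := fun j d hj => by
    induction d with
    | zero => rw [Nat.zero_add]
    | succ d ih => rw [Nat.succ_add, Function.iterate_succ_apply', ih, hg _ hj]
  choose c hc using hx
  have hmin := Nat.find_spec h
  set j := Nat.find h with hj
  by_cases hle : j ≤ Fintype.card V
  · rw [← Nat.sub_add_cancel hle, hmono _ _ hmin]
    exact hmin
  · obtain ⟨a, b, hab, hcab⟩ := Fintype.exists_ne_map_eq_of_card_lt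
      (fun i : Fin (Fintype.card V + 1) => c i) (by simp)
    wlog hlt : a < b generalizing a b
    · exact this b a hab.symm hcab.symm (by omega)
    have h₁ : g^[a.val] x = g^[b.val] x := by rw [← hc, ← hc, show c a = c b from hcab]
    have h₂ : g^[j - b + a] x = g^[j] x := by
      rw [Function.iterate_add_apply, h₁, ← Function.iterate_add_apply,
        Nat.sub_add_cancel (by omega)]
    refine absurd ?_ (Nat.find_min h (m := j - b + a) (by omega))
    rw [h₂]
    exact hmin

/-- A partial function is followed by overwriting the current point with its successor, so only two
points and a clock have to be stored. Codes need not be unique; functionality and the invariant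
refer to the encoded points. -/
theorem Dec.dtc {A : Type*} {m : ℕ} {e : A ≃ Fin m} {κ : Type} [Finite κ] {X : Type*}
    {enc : List A → (κ → ℕ) → X} {step : List A → X → X → Prop} {term : List A → X → Prop}
    (hstep : Dec e fun w (v : κ ⊕ κ → ℕ) => step w (enc w (v ∘ .inl)) (enc w (v ∘ .inr)))
    (hterm : Dec e fun w v => term w (enc w v))
    (hfun : ∀ w x y y', step w x y → step w x y' → y = y')
    (hsurj : ∀ w ≠ [], ∀ x y, step w x y → ∃ v, (∀ i, v i ≤ w.length) ∧ enc w v = y) :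
    Dec e fun w v => ∃ y, Relation.ReflTransGen (step w) (enc w v) y ∧ term w y := by
  classical
  intro σ N hσ
  have := Fintype.ofFinite κ
  obtain ⟨k, ⟨E⟩⟩ := Finite.exists_equiv_fin κ
  have hE : ∀ i, (E i).val < k := fun i => (E i).isLt
  have hinj : ∀ c, Function.Injective fun i => c + (E i).val := fun c i j h =>
    E.injective (Fin.ext (by simpa using h))
  -- Blocks of `k` registers from `N` on hold the current point, the next point and the clock;
  -- register `N + 3 * k` is scratch space for copying.
  set cur : κ → ℕ := fun i => N + (E i).val with hcur
  set nxt : κ → ℕ := fun i => N + k + (E i).val with hnxt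
  obtain ⟨P, hP⟩ := hterm cur (N + 3 * k + 1) fun i => by have := hE i; simp only [hcur]; omega
  obtain ⟨Q, hQ⟩ := hstep.exists_search (σ := cur) (ρ := nxt) (N := N + 3 * k + 1) (hinj _)
    (fun i => by have := hE i; simp only [hcur]; omega)
    (fun i => by have := hE i; simp only [hnxt]; omega)
    (fun i j => by have := hE i; simp only [hcur, hnxt]; omega)
  set L : List κ := Finset.univ.toList with hL
  have hLmem : ∀ i, i ∈ L := by simp [hL]
  set body : CProg ℕ (Bool × Bool) m := .seq P (.ite (.flag fun f => f.1 = true) .skip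
    (.seq Q (.ite (.flag fun f => f.1 = true) (copyAll nxt cur (N + 3 * k) L) .skip))) with hbody
  refine ⟨.seq (copyAll σ cur (N + 3 * k) L) (.seq (repeatAll body (List.range' (N + 2 * k) k)) P),
    fun w hw f v hv => ?_⟩
  obtain ⟨v₁, h₁, hv₁, hcur₁, hr₁⟩ := run_copyAll (x := w.map e) (src := σ) (dst := cur)
    (t := N + 3 * k) (hinj _) (fun i j => by have := hσ i; simp only [hcur]; omega)
    (fun i => by have := hσ i; omega) (fun i => by have := hE i; simp only [hcur]; omega) f L hv
  -- The total function `g` stays in place at terminal points and at dead ends, exactly as one round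
  -- of `body` does.
  set g : X → X := fun x => if h : ¬ term w x ∧ ∃ y, step w x y then h.2.choose else x with hg
  have hg₁ : ∀ x, term w x → g x = x := fun x hx => dif_neg fun h => h.1 hx
  have hg₂ : ∀ x y, ¬ term w x → step w x y → step w x (g x) := fun x y hx hy => by
    have h : ¬ term w x ∧ ∃ y, step w x y := ⟨hx, y, hy⟩
    rw [hg]
    simp only [dif_pos h]
    exact h.2.choose_spec
  have hg₃ : ∀ x, (∀ y, ¬ step w x y) → g x = x := fun x hx =>
    dif_neg fun h => h.2.elim hx
  have hcur₁' : v₁ ∘ cur = v ∘ σ := funext fun i => hcur₁ i (hLmem i)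
  obtain ⟨f₂, v₂, h₂, hv₂, -, hN₂, henc⟩ := run_repeatAll (n := w.length) (x := w.map e) (by simp)
    (U := {i | N + 2 * k ≤ i ∧ i < N + 3 * k}) (p := body)
    (I := fun j u => (∀ i < N, u i = v i) ∧ enc w (u ∘ cur) = g^[j] (enc w (v ∘ σ)))
    (fun j u u' h hu => by
      refine ⟨fun i hi => (h i (by simp only [Set.mem_ofPred_eq]; omega)).trans (hu.1 i hi), ?_⟩
      rw [show u' ∘ cur = u ∘ cur from funext fun i => h _ (by
        have := hE i
        simp only [Set.mem_ofPred_eq, hcur]; omega)]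
      exact hu.2)
    (fun j f u hu hI => by
      obtain ⟨f₁, u₁, h₁, hu₁, hN₁, hf₁⟩ := hP w hw f u hu
      have hc₁ : u₁ ∘ cur = u ∘ cur := funext fun i => hN₁ _ (by
        have := hE i
        simp only [hcur]; omega)
      by_cases ht : f₁.1 = true
      · refine ⟨f₁, u₁, .seq h₁ (.iteTrue ht (.skip _)), hu₁, fun i hi => hN₁ i (by
          have := hi.2; omega), fun i hi => (hN₁ i (by omega)).trans (hI.1 i hi), ?_⟩
        rw [hc₁, Function.iterate_succ_apply', ← hI.2, hg₁ _ (hf₁.1 ht)]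
      · have ht' := fun h => ht (hf₁.2 h)
        obtain ⟨f₂, u₂, h₂, hu₂, hN₂, hf₂, hs₂⟩ := hQ w hw f₁ u₁ hu₁
        have hN₂' : ∀ i < N + 3 * k + 1, i ∉ Set.range nxt → u₂ i = u i := fun i hi hi' =>
          (hN₂ i hi hi').trans (hN₁ i hi)
        have hnr : ∀ i, (i < N + k ∨ N + 2 * k ≤ i) → i ∉ Set.range nxt := by
          rintro i hi ⟨j, rfl⟩
          have := hE j
          simp only [hnxt] at hi
          omega
        have hc₂ : u₂ ∘ cur = u ∘ cur := funext fun i => hN₂' _ (by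
          have := hE i
          simp only [hcur]; omega) (hnr _ (by have := hE i; simp only [hcur]; omega))
        by_cases hfs : f₂.1 = true
        · obtain ⟨u₃, h₃, hu₃, hc₃, hr₃⟩ := run_copyAll (x := w.map e) (src := nxt) (dst := cur)
            (t := N + 3 * k) (hinj _)
            (fun i j => by have := hE j; simp only [hcur, hnxt]; omega)
            (fun i => by have := hE i; simp only [hnxt]; omega)
            (fun i => by have := hE i; simp only [hcur]; omega) f₂ L hu₂
          refine ⟨f₂, u₃, .seq h₁ (.iteFalse ht (.seq h₂ (.iteTrue hfs h₃))), hu₃, fun i hi => ?_,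
            fun i hi => ?_, ?_⟩
          · have h1 := hi.1
            have h2 := hi.2
            rw [hr₃ i (fun j _ => by have := hE j; simp only [hcur]; omega) (by omega),
              hN₂' i (by omega) (hnr i (by omega))]
          · rw [hr₃ i (fun j _ => by simp only [hcur]; omega) (by omega),
              hN₂' i (by omega) (hnr i (by omega)), hI.1 i hi]
          · have hst := hf₂ hfs
            simp only [Sum.elim_comp_inl, Sum.elim_comp_inr, hc₁] at hst
            rw [show u₃ ∘ cur = u₂ ∘ nxt from funext fun i => hc₃ i (hLmem i),
              Function.iterate_succ_apply', ← hI.2]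
            exact hfun w _ _ _ hst (hg₂ _ _ ht' hst)
        · refine ⟨f₂, u₂, .seq h₁ (.iteFalse ht (.seq h₂ (.iteFalse hfs (.skip _)))), hu₂,
            fun i hi => hN₂' i (by have := hi.2; omega) (hnr i (.inr hi.1)),
            fun i hi => (hN₂' i (by omega) (hnr i (by omega))).trans (hI.1 i hi), ?_⟩
          rw [hc₂, Function.iterate_succ_apply', ← hI.2, hg₃]
          -- A failed search means a dead end, since by `hsurj` every successor has a code within
          -- the searched range.
          intro y hy
          obtain ⟨z, hz, rfl⟩ := hsurj w hw _ _ hy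
          refine hfs (hs₂ ⟨z, hz, ?_⟩)
          simpa only [Sum.elim_comp_inl, Sum.elim_comp_inr, hc₁] using hy)
    (List.range' (N + 2 * k) k) List.nodup_range' (fun r hr => by
      rw [List.mem_range'_1] at hr
      simp only [Set.mem_ofPred_eq]; omega) 0 f hv₁
    ⟨fun i hi => hr₁ i (fun j _ => by simp only [hcur]; omega) (by omega), by
      rw [hcur₁', Function.iterate_zero_apply]⟩
  obtain ⟨f₃, v₃, h₃, hv₃, hN₃, hf₃⟩ := hP w hw f₂ v₂ hv₂
  refine ⟨f₃, v₃, .seq h₁ (.seq h₂ h₃), hv₃, fun i hi => (hN₃ i (by omega)).trans (hN₂ i hi), ?_⟩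
  simp only [hf₃, henc, Nat.zero_add, List.length_range']
  have hreach : ∀ j, Relation.ReflTransGen (step w) (enc w (v ∘ σ)) (g^[j] (enc w (v ∘ σ))) := by
    intro j
    induction j with
    | zero => exact .refl
    | succ j ih =>
      rw [Function.iterate_succ_apply']
      by_cases h : ¬ term w (g^[j] (enc w (v ∘ σ))) ∧ ∃ y, step w (g^[j] (enc w (v ∘ σ))) y
      · obtain ⟨y, hy⟩ := h.2
        exact ih.tail (hg₂ _ y h.1 hy)
      · rwa [show g (g^[j] (enc w (v ∘ σ))) = _ from dif_neg h]
  refine ⟨fun h => ⟨_, hreach _, h⟩, fun ⟨y, hy, ht⟩ => ?_⟩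
  -- The number of ticks of the clock is the number of possible codes.
  have hcard : Fintype.card (κ → Fin (w.length + 1)) = (w.length + 1) ^ k := by
    rw [Fintype.card_fun, Fintype.card_fin, Fintype.card_congr E, Fintype.card_fin]
  have hx : ∀ z, Relation.ReflTransGen (step w) (enc w (v ∘ σ)) z →
      ∃ u : κ → Fin (w.length + 1), enc w (fun i => u i) = z := by
    intro z hz
    rcases Relation.ReflTransGen.cases_tail hz with rfl | ⟨z', -, hz⟩
    · exact ⟨fun i => ⟨v (σ i), Nat.lt_succ_of_le (hv _)⟩, rfl⟩
    · obtain ⟨u, hu, rfl⟩ := hsurj w hw _ _ hz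
      exact ⟨fun i => ⟨u i, Nat.lt_succ_of_le (hu i)⟩, rfl⟩
  rw [← hcard]
  exact iterate_of_card hg₁ (fun u : κ → Fin (w.length + 1) => enc w fun i => u i)
    (fun j => hx _ (hreach j)) (exists_iterate_of_reflTransGen (hfun w) hg₂ hy ht)

end Logspace

/-! ### Factors of a word -/

namespace Logspace

open FCDatalog

/-- The factor of `w` between two positions. -/
def seg {A : Type*} (w : List A) (i j : ℕ) : List A := (w.take j).drop i

section Factors

variable {A : Type*} {w : List A} {i j : ℕ}

theorem seg_infix (w : List A) (i j : ℕ) : seg w i j <:+: w :=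
  (List.drop_suffix _ _).isInfix.trans (List.take_prefix _ _).isInfix

theorem exists_seg_eq {u : List A} (h : u <:+: w) :
    ∃ i ≤ w.length, ∃ j ≤ w.length, seg w i j = u := by
  obtain ⟨a, b, rfl⟩ := h
  refine ⟨a.length, by simp, a.length + u.length, by simp, ?_⟩
  rw [seg, ← List.length_append, List.take_left, List.drop_left]

theorem getElem?_seg (w : List A) (i j c : ℕ) :
    (seg w i j)[c]? = if i + c < j then w[i + c]? else none := by
  rw [seg, List.getElem?_drop, List.getElem?_take]

theorem length_seg (hj : j ≤ w.length) : (seg w i j).length = j - i := by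
  simp [seg, hj]

theorem seg_eq_nil (hj : j ≤ w.length) : seg w i j = [] ↔ j ≤ i := by
  rw [← List.length_eq_zero_iff, length_seg hj]
  omega

theorem seg_eq_self (hw : w ≠ []) : seg w i j = w ↔ i = 0 ∧ w.length ≤ j := by
  have hpos := List.length_pos_of_ne_nil hw
  constructor
  · intro h
    have := congrArg List.length h
    simp only [seg, List.length_drop, List.length_take] at this
    omega
  · rintro ⟨rfl, h⟩
    simp [seg, List.take_of_length_le h]

theorem seg_append {k : ℕ} (hik : i ≤ k) (hkj : k ≤ j) : seg w i k ++ seg w k j = seg w i j := by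
  refine List.ext_getElem? fun c => ?_
  by_cases hk : k ≤ w.length
  · rw [List.getElem?_append, length_seg hk, getElem?_seg, getElem?_seg, getElem?_seg]
    split_ifs
    any_goals first | rfl | omega
    congr 1
    omega
  · rw [show seg w k j = [] from by simp [seg]; omega, List.append_nil, getElem?_seg, getElem?_seg]
    split_ifs
    any_goals first | rfl | omega
    simp
    omega

/-- The alternative `k = i` serves the case `j < i`, where the factor and both parts are empty
although no cut point lies between `i` and `j`. -/
theorem seg_eq_append (hi : i ≤ w.length) (hj : j ≤ w.length) (a b : List A) :
    seg w i j = a ++ b ↔ ∃ k ≤ w.length, i ≤ k ∧ (k ≤ j ∨ k = i) ∧ seg w i k = a ∧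
      seg w k j = b := by
  constructor
  · intro h
    have hl := congrArg List.length h
    rw [length_seg hj, List.length_append] at hl
    by_cases hij : i ≤ j
    · have hs := seg_append (w := w) (Nat.le_add_right i a.length) (show i + a.length ≤ j by omega)
      rw [h] at hs
      obtain ⟨h₁, h₂⟩ := List.append_inj hs (by rw [length_seg (by omega)]; omega)
      exact ⟨i + a.length, by omega, by omega, .inl (by omega), h₁, h₂⟩
    · rw [(seg_eq_nil hj).2 (by omega)] at h
      obtain ⟨rfl, rfl⟩ := List.append_eq_nil_iff.1 h.symm
      exact ⟨i, hi, le_rfl, .inr rfl, (seg_eq_nil hi).2 le_rfl, (seg_eq_nil hj).2 (by omega)⟩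
  · rintro ⟨k, hk, hik, hkj | rfl, rfl, rfl⟩
    · exact (seg_append hik hkj).symm
    · rw [(seg_eq_nil hi).2 le_rfl, List.nil_append]

/-- Equality of factors becomes a first-order condition in which every quantifier over numbers
ranges over positions: a common length and equal letters at all offsets. -/
theorem seg_eq_seg {i' j' : ℕ} (hj : j ≤ w.length) (hj' : j' ≤ w.length) :
    seg w i j = seg w i' j' ↔ ∃ d ≤ w.length, j - i = d ∧ j' - i' = d ∧
      ∀ c ≤ w.length, c < d → ∀ a, w[i + c]? = some a ↔ w[i' + c]? = some a := by
  constructor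
  · intro h
    have hl := congrArg List.length h
    rw [length_seg hj, length_seg hj'] at hl
    refine ⟨j - i, by omega, rfl, hl.symm, fun c _ hc a => ?_⟩
    have := congrArg (·[c]?) h
    simp only [getElem?_seg, show i + c < j by omega, show i' + c < j' by omega, if_true] at this
    rw [this]
  · rintro ⟨d, hd, h₁, h₂, h⟩
    refine List.ext_getElem? fun c => ?_
    rw [getElem?_seg, getElem?_seg]
    by_cases hc : c < d
    · rw [if_pos (by omega), if_pos (by omega)]
      exact Option.ext fun a => by simpa using h c (by omega) hc a
    · rw [if_neg (by omega), if_neg (by omega)]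

theorem seg_eq_singleton (hj : j ≤ w.length) (a : A) :
    seg w i j = [a] ↔ i + 1 = j ∧ w[i]? = some a := by
  constructor
  · intro h
    have hl := congrArg List.length h
    rw [length_seg hj, List.length_singleton] at hl
    have := congrArg (·[0]?) h
    rw [getElem?_seg, if_pos (by omega)] at this
    exact ⟨by omega, by simpa using this⟩
  · rintro ⟨rfl, h⟩
    refine List.ext_getElem? fun c => ?_
    rw [getElem?_seg]
    cases c with
    | zero => simpa using h
    | succ c => simp

end Factors

/-! ### Decidability of pattern equations -/

namespace Dec

variable {A : Type*} {m : ℕ} {e : A ≃ Fin m} {κ : Type}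

/-- If the sum exceeds the length, there is neither a letter nor a position `y`, so the quantifier
may be restricted to positions. -/
theorem letter_add (i c : κ) (a : A) : Dec e fun w v => w[v i + v c]? = some a := by
  refine (ex_one (p := fun w v y => v i + v c = y ∧ w[y]? = some a)
    ((add_eq (some i) (some c) none).and (letter none a))).congr fun w _ v _ => ?_
  constructor
  · rintro ⟨y, -, rfl, h⟩
    exact h
  · intro h
    exact ⟨_, (List.getElem?_eq_some_iff.1 h).1.le, rfl, h⟩

theorem succ_eq (i j : κ) : Dec e fun _ v => v i + 1 = v j := by
  refine ((lt i j).and (all_one (p := fun _ v y => v i < y → v j ≤ y)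
    ((lt (some i) none).imp (le (some j) none)))).congr fun w _ v hv =>
    ⟨fun ⟨h₁, h₂⟩ => ?_, fun h => ⟨by omega, fun y _ hy => by omega⟩⟩
  have := h₂ (v i + 1) (by have := hv j; omega) (by omega)
  omega

theorem sub_eq (i j d : κ) : Dec e fun _ v => v j - v i = v d :=
  ((add_eq i d j).or ((le j i).and (eq_zero d))).congr fun _ _ _ _ => by omega

theorem seg_eq_seg (i j i' j' : κ) :
    Dec e fun w v => seg w (v i) (v j) = seg w (v i') (v j') := by
  have : Finite A := Finite.of_equiv _ e.symm
  refine (ex_one (p := fun w v d => v j - v i = d ∧ v j' - v i' = d ∧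
      ∀ c ≤ w.length, c < d → ∀ a, w[v i + c]? = some a ↔ w[v i' + c]? = some a)
    ((sub_eq (some i) (some j) none).and ((sub_eq (some i') (some j') none).and
      (all_one (p := fun w (v : Option κ → ℕ) c => c < v none → ∀ a,
          w[v (some i) + c]? = some a ↔ w[v (some i') + c]? = some a)
        ((lt none (some none)).imp (forall_finite fun a =>
          (letter_add (some (some i)) none a).iff (letter_add (some (some i')) none a))))))).congr
    fun w _ v hv => (Logspace.seg_eq_seg (hv j) (hv j')).symm

/-- For each symbol of the pattern one position is guessed, the one where the image of the remaining
pattern begins. It becomes a new variable `none`, so the index type grows during the induction. -/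
theorem seg_eq_image (i j : κ) (p q : Var → κ) (α : Pattern A) : Dec e fun w v =>
    seg w (v i) (v j) = α.image fun x => seg w (v (p x)) (v (q x)) := by
  induction α generalizing κ with
  | nil => exact (le j i).congr fun w _ v hv => (seg_eq_nil (hv j)).symm
  | cons s α ih =>
    have hs : Dec e fun w (v : Option κ → ℕ) => seg w (v (some i)) (v none) =
        symbolImage (fun x => seg w (v (some (p x))) (v (some (q x)))) s := by
      cases s with
      | inl a =>
        exact ((succ_eq (some i) none).and (letter (some i) a)).congr fun w _ v hv =>
          (seg_eq_singleton (hv none) a).symm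
      | inr x => exact seg_eq_seg _ _ _ _
    refine (ex_one (p := fun w v k => v i ≤ k ∧ (k ≤ v j ∨ k = v i) ∧
        seg w (v i) k = symbolImage (fun x => seg w (v (p x)) (v (q x))) s ∧
        seg w k (v j) = Pattern.image (fun x => seg w (v (p x)) (v (q x))) α)
      ((le (some i) none).and (((le none (some j)).or (eq none (some i))).and (hs.and
        (ih none (some j) (fun x => some (p x)) fun x => some (q x)))))).congr
      fun w _ v hv => ?_
    rw [← seg_eq_append (hv i) (hv j)]
    rfl

end Dec

end Logspace

/-! ### Derivations of deterministic linear programs -/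

namespace FCDatalog

section Congruence

variable {A : Type*} {Rel : Type} {θ θ' : Var → List A}

theorem Pattern.image_congr {α : Pattern A} (h : ∀ x ∈ α.vars, θ x = θ' x) :
    α.image θ = α.image θ' := by
  rw [Pattern.image, Pattern.image, List.flatMap_def, List.flatMap_def]
  congr 1
  refine List.map_congr_left fun s hs => ?_
  cases s with
  | inl a => rfl
  | inr x => exact h x hs

theorem Pattern.vars_finite (α : Pattern A) : α.vars.Finite :=
  (List.finite_toSet α).preimage Sum.inr_injective.injOn

theorem Atom.vars_finite (φ : Atom A Rel) : φ.vars.Finite := by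
  cases φ with
  | eqn x α => exact (Set.finite_singleton x).union α.vars_finite
  | rel R ys => exact List.finite_toSet ys

theorem Rule.vars_finite (ρ : Rule A Rel) : ρ.vars.Finite := by
  have : ρ.vars = ⋃ φ ∈ {φ | φ ∈ ρ.body}, φ.vars := by
    ext x
    simp [Rule.vars]
  rw [this]
  exact (List.finite_toSet ρ.body).biUnion fun φ _ => φ.vars_finite

theorem Rule.mem_vars_eqn {ρ : Rule A Rel} {x : Var} {α : Pattern A} (h : Atom.eqn x α ∈ ρ.body)
    {y : Var} (hy : y = x ∨ y ∈ α.vars) : y ∈ ρ.vars :=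
  ⟨_, h, hy⟩

theorem Rule.mem_vars_rel {ρ : Rule A Rel} {R : Rel} {ys : List Var} (h : Atom.rel R ys ∈ ρ.body)
    {y : Var} (hy : y ∈ ys) : y ∈ ρ.vars :=
  ⟨_, h, hy⟩

end Congruence

namespace Program

variable {A : Type*} (P : Program A)

/-- The recursive call of a rule of a linear program. -/
noncomputable def recCall (ρ : Rule A P.Rel) : Option (P.Rel × List Var) :=
  (P.recursiveAtoms ρ).head?.bind fun
    | .eqn _ _ => none
    | .rel R ys => some (R, ys)

variable {P}

theorem mem_recursiveAtoms {ρ : Rule A P.Rel} {φ : Atom A P.Rel} :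
    φ ∈ P.recursiveAtoms ρ ↔ φ ∈ ρ.body ∧ P.IsRecursiveAtom ρ.head φ := by
  simp [recursiveAtoms]

theorem recursiveAtoms_eq (hlin : P.IsLinear) {ρ : Rule A P.Rel} (hρ : ρ ∈ P.rules) :
    P.recursiveAtoms ρ = ((P.recCall ρ).map fun c => Atom.rel c.1 c.2).toList := by
  have hl := hlin ρ hρ
  have hrec : ∀ φ ∈ P.recursiveAtoms ρ, P.IsRecursiveAtom ρ.head φ := fun φ hφ =>
    (mem_recursiveAtoms.1 hφ).2
  rw [recCall]
  match h : P.recursiveAtoms ρ with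
  | [] => rfl
  | [.eqn x α] => exact (hrec (.eqn x α) (by rw [h]; exact List.mem_cons_self)).elim
  | [.rel R ys] => rfl
  | _ :: _ :: _ => rw [h] at hl; simp at hl

theorem recCall_eq_some (hlin : P.IsLinear) {ρ : Rule A P.Rel} (hρ : ρ ∈ P.rules) {R : P.Rel}
    {ys : List Var} :
    P.recCall ρ = some (R, ys) ↔ Atom.rel R ys ∈ ρ.body ∧ P.MutuallyRecursive ρ.head R := by
  have h : (Atom.rel R ys : Atom A P.Rel) ∈ P.recursiveAtoms ρ ↔ _ := mem_recursiveAtoms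
  rw [recursiveAtoms_eq hlin hρ] at h
  refine Iff.trans ?_ h
  cases P.recCall ρ with
  | none => simp
  | some c => simp [Prod.ext_iff, eq_comm]

theorem bottom_eq (hlin : P.IsLinear) {ρ : Rule A P.Rel} (hρ : ρ ∈ P.rules) :
    P.bottom ρ = (P.recCall ρ).elim [] Prod.snd := by
  rw [bottom, recursiveAtoms_eq hlin hρ]
  cases P.recCall ρ <;> simp [Atom.argList]

/-- All body atoms of `ρ` but the recursive call hold. -/
def Fires (P : Program A) (ρ : Rule A P.Rel) (w : List A) (θ : Var → List A) : Prop :=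
  P.IsWSubst ρ w θ ∧ ρ.SatEqns w θ ∧ ∀ R ys, Atom.rel R ys ∈ ρ.body →
    ¬ P.MutuallyRecursive ρ.head R → (R, ys.map θ) ∈ P.facts w

theorem Fires.congr {ρ : Rule A P.Rel} {w : List A} {θ θ' : Var → List A} (h : P.Fires ρ w θ)
    (hu : θ P.univVar = θ' P.univVar) (hv : ∀ x ∈ ρ.vars, θ x = θ' x) : P.Fires ρ w θ' := by
  obtain ⟨⟨h₁, h₂⟩, h₃, h₄⟩ := h
  refine ⟨⟨hu ▸ h₁, fun x hx => hv x hx ▸ h₂ x hx⟩, fun x α hφ => ?_, fun R ys hφ hR => ?_⟩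
  · have := h₃ x α hφ
    rwa [Atom.Sat, hv x (Rule.mem_vars_eqn hφ (.inl rfl)),
      Pattern.image_congr fun y hy => hv y (Rule.mem_vars_eqn hφ (.inr hy))] at this
  · rw [← List.map_congr_left fun y hy => hv y (Rule.mem_vars_rel hφ hy)]
    exact h₄ R ys hφ hR

/-- Some rule with a head symbol in `C` leads from the fact `x` to its recursive call, or to `none`
if there is no recursive call. -/
def Leads (P : Program A) (C : Set P.Rel) (w : List A) (x : P.Rel × List (List A))
    (o : Option (P.Rel × List (List A))) : Prop :=
  ∃ ρ ∈ P.rules, ρ.head ∈ C ∧ ∃ θ, P.Fires ρ w θ ∧ x = (ρ.head, ρ.args.map θ) ∧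
    o = (P.recCall ρ).map fun c => (c.1, c.2.map θ)

variable {C : Set P.Rel} {w : List A}

/-- Global determinism identifies the rule, and then local determinism its bottom tuple. The last
component of a top tuple is always `w`, so the fact fixes the whole top tuple; `W` asks only for the
pattern equations, which hold for any rule that fires. -/
theorem Leads.unique (hP : P ∈ deterministicLinear A) {x : P.Rel × List (List A)}
    {o o' : Option (P.Rel × List (List A))} (h : P.Leads C w x o) (h' : P.Leads C w x o') :
    o = o' := by
  obtain ⟨hlin, hloc, hglob⟩ := hP
  obtain ⟨ρ, hρ, -, θ, hθ, rfl, rfl⟩ := h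
  obtain ⟨χ, hχ, -, θ', hθ', hx, rfl⟩ := h'
  obtain ⟨hhead, hargs⟩ := Prod.mk.inj hx
  have hW : (((P.top ρ).map θ, (P.bottom ρ).map θ) : List (List A) × List (List A)) ∈ P.W w ρ :=
    ⟨θ, hθ.1, hθ.2.1, rfl⟩
  have hW' : (((P.top ρ).map θ, (P.bottom χ).map θ') : List (List A) × List (List A)) ∈
      P.W w χ := by
    refine ⟨θ', hθ'.1, hθ'.2.1, ?_⟩
    rw [top, top, List.map_append, List.map_append, hargs, List.map_singleton, List.map_singleton,
      hθ.1.1, hθ'.1.1]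
  by_cases hne : ρ = χ
  · subst hne
    have := hloc w ρ hρ _ _ _ hW hW'
    rw [bottom_eq hlin hρ] at this
    cases hc : P.recCall ρ with
    | none => rfl
    | some c =>
      rw [hc] at this
      simp only [Option.map_some]
      rw [show c.2.map θ = c.2.map θ' from this]
  · exact absurd ⟨_, _, _, hW, hW'⟩ (hglob w ρ hρ χ hχ hhead hne)

theorem mem_facts_of_leads (hlin : P.IsLinear) {x : P.Rel × List (List A)}
    {o : Option (P.Rel × List (List A))} (h : P.Leads C w x o) (ho : ∀ y ∈ o, y ∈ P.facts w) :
    x ∈ P.facts w := by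
  obtain ⟨ρ, hρ, -, θ, ⟨hθ, heq, hrel⟩, rfl, rfl⟩ := h
  refine fact_of_rule hρ hθ fun φ hφ => ?_
  cases φ with
  | eqn x α => exact heq x α hφ
  | rel R ys =>
    refine ⟨?_, fun y hy => hθ.2 y (Rule.mem_vars_rel hφ hy)⟩
    by_cases hR : P.MutuallyRecursive ρ.head R
    · refine ho _ ?_
      rw [(recCall_eq_some hlin hρ).2 ⟨hφ, hR⟩]
      rfl
    · exact hrel R ys hφ hR

/-- By linearity a derivation has at most one subderivation that stays in the component, so inside
the component it is a path. The other body atoms are absorbed into `Leads`, and `hC` keeps recursive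
calls in `C`. -/
theorem mem_facts_iff (hlin : P.IsLinear)
    (hC : ∀ R R', R ∈ C → P.MutuallyRecursive R R' → R' ∈ C) {x : P.Rel × List (List A)}
    (hx : x.1 ∈ C) : x ∈ P.facts w ↔
      ∃ y, Relation.ReflTransGen (fun x y => P.Leads C w x (some y)) x y ∧
        P.Leads C w y none := by
  constructor
  · rintro ⟨n, hn⟩
    induction n generalizing x with
    | zero => exact hn.elim
    | succ n ih =>
      rw [stage_succ] at hn
      rcases hn with hn | ⟨ρ, hρ, θ, hθ, hsat, rfl⟩
      · exact ih hx hn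
      have hfires : P.Fires ρ w θ := ⟨hθ, fun x α hφ => hsat _ hφ, fun R ys hφ _ =>
        ⟨n, (hsat _ hφ).1⟩⟩
      have hleads : P.Leads C w (ρ.head, ρ.args.map θ)
        ((P.recCall ρ).map fun c => (c.1, c.2.map θ)) := ⟨ρ, hρ, hx, θ, hfires, rfl, rfl⟩
      cases hc : P.recCall ρ with
      | none =>
        rw [hc] at hleads
        exact ⟨_, .refl, hleads⟩
      | some c =>
        obtain ⟨hφ, hR⟩ := (recCall_eq_some hlin hρ (R := c.1) (ys := c.2)).1 hc
        rw [hc] at hleads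
        obtain ⟨y, hy, hy'⟩ := ih (x := (c.1, c.2.map θ)) (hC _ _ hx hR) (hsat _ hφ).1
        exact ⟨y, .head hleads hy, hy'⟩
  · rintro ⟨y, hxy, hy⟩
    clear hx
    induction hxy using Relation.ReflTransGen.head_induction_on with
    | refl => exact mem_facts_of_leads hlin hy (by simp)
    | head h _ ih => exact mem_facts_of_leads hlin h (by simpa using ih)

/-- `R` depends on `R'`, but not conversely. -/
def StrictlyBelow (P : Program A) (R' R : P.Rel) : Prop :=
  Relation.TransGen P.DependsOn R R' ∧ ¬ Relation.TransGen P.DependsOn R' R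

/-- This is the order of the strongly connected components of the dependency graph; a strict order
on a finite type is well-founded. -/
theorem strictlyBelow_wellFounded (P : Program A) : WellFounded P.StrictlyBelow := by
  have := P.finiteRel
  have : IsTrans P.Rel P.StrictlyBelow := ⟨fun a b c hab hbc =>
    ⟨hbc.1.trans hab.1, fun h => hab.2 (h.trans hbc.1)⟩⟩
  have : Std.Irrefl P.StrictlyBelow := ⟨fun a h => h.2 h.1⟩
  exact Finite.wellFounded_of_trans_of_irrefl _

/-- The symbols that are mutually recursive with a symbol, and the symbol itself. -/
def component (P : Program A) (R : P.Rel) : Set P.Rel := {R' | R' = R ∨ P.MutuallyRecursive R R'}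

theorem component_closed {R : P.Rel} (R₁ R₂ : P.Rel) (h₁ : R₁ ∈ P.component R)
    (h : P.MutuallyRecursive R₁ R₂) : R₂ ∈ P.component R := by
  rcases h₁ with rfl | h₁
  · exact .inr h
  · exact .inr ⟨h₁.1.trans h.1, h.2.trans h₁.2⟩

theorem strictlyBelow_of_mem_body {R R' : P.Rel} {ρ : Rule A P.Rel} (hρ : ρ ∈ P.rules)
    (hR : ρ.head ∈ P.component R) {ys : List Var} (hφ : Atom.rel R' ys ∈ ρ.body)
    (hrec : ¬ P.MutuallyRecursive ρ.head R') : P.StrictlyBelow R' R := by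
  have hd : Relation.TransGen P.DependsOn ρ.head R' := .single ⟨ρ, hρ, rfl, ys, hφ⟩
  rcases hR with hR | hR
  · rw [hR] at hd hrec
    exact ⟨hd, fun h => hrec ⟨hd, h⟩⟩
  · exact ⟨hR.1.trans hd, fun h => hrec ⟨hd, h.trans hR.1⟩⟩

end Program

end FCDatalog

/-! ### Evaluation of deterministic linear programs by counter programs -/

namespace Logspace

open FCDatalog FCDatalog.Program

/-- The substitution that is given by pairs of positions. -/
def places {A : Type*} {K : ℕ} (w : List A) (u : Fin (K + 1) × Bool → ℕ) (x : Var) : List A :=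
  seg w (u (Fin.ofNat (K + 1) x, false)) (u (Fin.ofNat (K + 1) x, true))

theorem map_eq_map_range {α β : Type*} (f : α → β) (l : List α) (d : α) :
    l.map f = (List.range l.length).map fun j => f (l.getD j d) := by
  refine List.ext_getElem (by simp) fun j h₁ h₂ => ?_
  simp at h₁
  simp [h₁]

/-- Variables up to `K` have separate pairs of positions. Values that are not factors of `w` cannot
be represented and get the default pair. -/
theorem exists_places {A : Type*} {w : List A} (K : ℕ) (θ : Var → List A) :
    ∃ u : Fin (K + 1) × Bool → ℕ, (∀ i, u i ≤ w.length) ∧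
      ∀ x ≤ K, θ x <:+: w → places w u x = θ x := by
  have h : ∀ k : ℕ, ∃ c : ℕ × ℕ, c.1 ≤ w.length ∧ c.2 ≤ w.length ∧
      (θ k <:+: w → seg w c.1 c.2 = θ k) := fun k => by
    by_cases hk : θ k <:+: w
    · obtain ⟨i, hi, j, hj, h⟩ := exists_seg_eq hk
      exact ⟨(i, j), hi, hj, fun _ => h⟩
    · exact ⟨(0, 0), Nat.zero_le _, Nat.zero_le _, fun h => absurd h hk⟩
  choose c hc₁ hc₂ hc using h
  refine ⟨fun i => if i.2 then (c i.1).2 else (c i.1).1, fun i => ?_, fun x hx hθ => ?_⟩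
  · dsimp only
    split_ifs
    exacts [hc₂ _, hc₁ _]
  · have : (Fin.ofNat (K + 1) x).val = x := Nat.mod_eq_of_lt (by omega)
    simp only [places, this, if_true, Bool.false_eq_true, if_false]
    exact hc x hθ

section Evaluation

variable {A : Type*} {m : ℕ} (e : A ≃ Fin m) (P : Program A)

/-- The facts with relation symbol `R` are decided by counter programs. -/
def DecFacts (R : P.Rel) : Prop :=
  ∀ (κ : Type) (p q : ℕ → κ), Dec e fun w v =>
    (R, (List.range (P.ar R)).map fun j => seg w (v (p j)) (v (q j))) ∈ P.facts w

variable {e P} {K r : ℕ}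

/-- Under `places` every value is a factor of `w`, so the factor conditions come for free. There
remain the value of the universe variable, the pattern equations, and facts of strictly lower
components, which `ih` decides. -/
theorem dec_fires {R : P.Rel} (ih : ∀ R', P.StrictlyBelow R' R → DecFacts e P R')
    {ρ : Rule A P.Rel} (hρ : ρ ∈ P.rules) (hR : ρ.head ∈ P.component R) (K : ℕ) :
    Dec e fun w (u : Fin (K + 1) × Bool → ℕ) => P.Fires ρ w (places w u) := by
  let ok : Atom A P.Rel → List A → (Fin (K + 1) × Bool → ℕ) → Prop := fun φ w u => match φ with
    | .eqn x α => places w u x = α.image (places w u)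
    | .rel R' ys => ¬ P.MutuallyRecursive ρ.head R' → (R', ys.map (places w u)) ∈ P.facts w
  have hok : ∀ φ ∈ ρ.body, Dec e (ok φ) := by
    intro φ hφ
    cases φ with
    | eqn x α =>
      exact Dec.seg_eq_image (Fin.ofNat (K + 1) x, false) (Fin.ofNat (K + 1) x, true)
        (fun x => (Fin.ofNat (K + 1) x, false)) (fun x => (Fin.ofNat (K + 1) x, true)) α
    | rel R' ys =>
      by_cases hrec : P.MutuallyRecursive ρ.head R'
      · exact (Dec.const True).congr fun w _ u _ => by simp [ok, hrec]
      · refine (ih R' (strictlyBelow_of_mem_body hρ hR hφ hrec) _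
          (fun j => (Fin.ofNat (K + 1) (ys.getD j 0), false))
          (fun j => (Fin.ofNat (K + 1) (ys.getD j 0), true))).congr fun w _ u _ => ?_
        have hlen : ys.length = P.ar R' := (P.wellFormed ρ hρ).body_arity _ hφ
        rw [← hlen]
        simp only [ok, hrec, not_false_eq_true, forall_const]
        rw [map_eq_map_range _ ys 0]
        rfl
  refine (((Dec.eq_zero (Fin.ofNat (K + 1) P.univVar, false)).and
    (Dec.length_le (Fin.ofNat (K + 1) P.univVar, true))).and
      (Dec.forall_mem ρ.body hok)).congr fun w hw u hu => ?_
  rw [Fires, IsWSubst, ← seg_eq_self hw]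
  constructor
  · rintro ⟨h₁, h₂⟩
    refine ⟨⟨h₁, fun x _ => seg_infix _ _ _⟩, fun x α hφ => ?_, fun R' ys hφ => h₂ _ hφ⟩
    have h := h₂ _ hφ
    exact ⟨h, seg_infix _ _ _, (show places w u x = _ from h) ▸ seg_infix _ _ _⟩
  · rintro ⟨⟨h₁, -⟩, h₂, h₃⟩
    refine ⟨h₁, fun φ hφ => ?_⟩
    cases φ with
    | eqn x α => exact (h₂ x α hφ).1
    | rel R' ys => exact h₃ R' ys hφ

/-- The fact that is given by the bits of some registers, which determine the relation symbol, and
by pairs of positions. -/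
def encFact (D : (Fin r → Bool) → P.Rel) (w : List A) (v : Fin r ⊕ Fin (K + 1) × Bool → ℕ) :
    P.Rel × List (List A) :=
  (D fun i => decide (v (.inl i) = 0),
    (List.range (P.ar (D fun i => decide (v (.inl i) = 0)))).map (places w (v ∘ .inr)))

variable {D : (Fin r → Bool) → P.Rel}

/-- The relation symbol is stored as a vector of zero and nonzero registers; the value `1` is
available because `w` is nonempty. -/
theorem exists_encFact (hD : Function.Surjective D) {w : List A} (hw : w ≠ []) {R : P.Rel}
    {t : List (List A)} (ht : t.length = P.ar R) (hK : P.ar R ≤ K) (hi : ∀ u ∈ t, u <:+: w) :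
    ∃ v : Fin r ⊕ Fin (K + 1) × Bool → ℕ, (∀ i, v i ≤ w.length) ∧ encFact D w v = (R, t) := by
  have hpos := List.length_pos_of_ne_nil hw
  obtain ⟨b, rfl⟩ := hD R
  obtain ⟨u, hu, h⟩ := exists_places (w := w) K fun j => t.getD j []
  refine ⟨Sum.elim (fun i => if b i then 0 else 1) u, ?_, ?_⟩
  · rintro (i | i)
    · simp only [Sum.elim_inl]
      split_ifs <;> omega
    · exact hu i
  · have hb : D (fun i => decide (Sum.elim (fun i => if b i then 0 else 1) u (.inl i) = 0)) =
        D b := by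
      congr 1
      funext i
      cases h : b i <;> simp [h]
    rw [encFact, hb, Sum.elim_comp_inr]
    refine congrArg (Prod.mk (D b)) ?_
    conv_rhs => rw [← List.map_id t, map_eq_map_range id t [], ht]
    refine List.map_congr_left fun j hj => ?_
    rw [List.mem_range] at hj
    have hjt : j < t.length := by rw [ht]; exact hj
    refine h j (hj.le.trans hK) (hi _ ?_)
    rw [List.getD_eq_getElem _ _ hjt]
    exact List.getElem_mem hjt

theorem dec_encFact_eq {κ : Type} (s : Fin r ⊕ Fin (K + 1) × Bool → κ) (R : P.Rel)
    (p q : ℕ → κ) : Dec e fun w v => encFact D w (v ∘ s) =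
      (R, (List.range (P.ar R)).map fun j => seg w (v (p j)) (v (q j))) := by
  have htag : Dec e fun _ (v : κ → ℕ) => D (fun i => decide (v (s (.inl i)) = 0)) = R := by
    refine (Dec.exists_finite (β := Fin r → Bool) (p := fun b _ v => D b = R ∧
      ∀ i, (v (s (.inl i)) = 0 ↔ b i = true)) fun b => (Dec.const _).and
        (Dec.forall_finite fun i => (Dec.eq_zero _).iff (Dec.const _))).congr fun w _ v _ => ?_
    constructor
    · rintro ⟨b, hb, h⟩
      rw [← hb]
      congr 1
      funext i
      simp [h]
    · intro h
      exact ⟨_, h, fun i => by simp⟩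
  refine (htag.and (Dec.forall_mem (List.range (P.ar R)) fun j _ => Dec.seg_eq_seg
    (s (.inr (Fin.ofNat (K + 1) j, false))) (s (.inr (Fin.ofNat (K + 1) j, true))) (p j)
      (q j))).congr fun w _ v _ => ?_
  rw [encFact, Prod.mk.injEq]
  refine and_congr_right fun h => ?_
  simp only [Function.comp_apply]
  rw [h, List.map_inj_left]
  rfl

theorem dec_encFact_eq_map {κ : Type} (s : Fin r ⊕ Fin (K + 1) × Bool → κ)
    (t : Fin (K + 1) × Bool → κ) (R : P.Rel) {ys : List Var} (hys : ys.length = P.ar R) :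
    Dec e fun w v => encFact D w (v ∘ s) = (R, ys.map (places w (v ∘ t))) := by
  refine (dec_encFact_eq (D := D) s R (fun j => t (Fin.ofNat (K + 1) (ys.getD j 0), false))
    (fun j => t (Fin.ofNat (K + 1) (ys.getD j 0), true))).congr fun w _ v _ => ?_
  rw [map_eq_map_range _ ys 0, hys]
  rfl

/-- A finite disjunction over the rules. The quantifier over substitutions is replaced by one over
positions: firing depends only on the universe variable and on the variables of the rule, whose
values are factors of `w`. -/
theorem dec_leads (hP : P.IsLinear) {R : P.Rel} (ih : ∀ R', P.StrictlyBelow R' R → DecFacts e P R')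
    (hK : ∀ ρ ∈ P.rules, ∀ x ∈ ρ.vars, x ≤ K) (hu : P.univVar ≤ K) {κ : Type}
    (s : Fin r ⊕ Fin (K + 1) × Bool → κ) (o : Option (Fin r ⊕ Fin (K + 1) × Bool → κ)) :
    Dec e fun w v => P.Leads (P.component R) w (encFact D w (v ∘ s))
      (o.map fun s' => encFact D w (v ∘ s')) := by
  have hrec : ∀ ρ ∈ P.rules, ∀ c, P.recCall ρ = some c → Atom.rel c.1 c.2 ∈ ρ.body :=
    fun ρ hρ c hc => ((recCall_eq_some hP hρ (R := c.1) (ys := c.2)).1 hc).1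
  have ho : ∀ ρ ∈ P.rules, Dec e fun w (v : κ ⊕ Fin (K + 1) × Bool → ℕ) =>
      (o.map fun s' => encFact D w (v ∘ .inl ∘ s')) =
        (P.recCall ρ).map fun c => (c.1, c.2.map (places w (v ∘ .inr))) := by
    intro ρ hρ
    cases o with
    | none =>
      cases hc : P.recCall ρ with
      | none => exact (Dec.const True).congr fun _ _ _ _ => by simp
      | some c => exact (Dec.const False).congr fun _ _ _ _ => by simp
    | some s' =>
      cases hc : P.recCall ρ with
      | none => exact (Dec.const False).congr fun _ _ _ _ => by simp
      | some c =>
        exact (dec_encFact_eq_map (D := D) (.inl ∘ s') .inr c.1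
          ((P.wellFormed ρ hρ).body_arity _ (hrec ρ hρ c hc))).congr fun _ _ _ _ => by simp
  have hrule : ∀ ρ ∈ P.rules, Dec e fun w (v : κ → ℕ) => ρ.head ∈ P.component R ∧
      ∃ u : Fin (K + 1) × Bool → ℕ, (∀ i, u i ≤ w.length) ∧ P.Fires ρ w (places w u) ∧
        encFact D w (v ∘ s) = (ρ.head, ρ.args.map (places w u)) ∧
        (o.map fun s' => encFact D w (v ∘ s')) =
          (P.recCall ρ).map fun c => (c.1, c.2.map (places w u)) := by
    intro ρ hρ
    by_cases hR : ρ.head ∈ P.component R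
    · have hf : Dec e fun w (v : κ ⊕ Fin (K + 1) × Bool → ℕ) => P.Fires ρ w (places w (v ∘ .inr)) :=
        (dec_fires ih hρ hR K).comp Sum.inr
      have he : Dec e fun w (v : κ ⊕ Fin (K + 1) × Bool → ℕ) =>
          encFact D w (v ∘ .inl ∘ s) = (ρ.head, ρ.args.map (places w (v ∘ .inr))) :=
        dec_encFact_eq_map (Sum.inl ∘ s) Sum.inr ρ.head (P.wellFormed ρ hρ).head_arity
      exact (Dec.const _).and (Dec.ex (hf.and (he.and (ho ρ hρ))))
    · exact (Dec.const False).congr fun _ _ _ _ => by simp [hR]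
  refine (Dec.exists_mem P.rules.toList fun ρ hρ => hrule ρ (Finset.mem_toList.1 hρ)).congr
    fun w _ v _ => ?_
  simp only [Finset.mem_toList]
  constructor
  · rintro ⟨ρ, hρ, hR, u, -, hf, h₁, h₂⟩
    exact ⟨ρ, hρ, hR, _, hf, h₁, h₂⟩
  · rintro ⟨ρ, hρ, hR, θ, hf, h₁, h₂⟩
    obtain ⟨u, hun, h⟩ := exists_places (w := w) K θ
    have hvars : ∀ x ∈ ρ.vars, θ x = places w u x := fun x hx =>
      (h x (hK ρ hρ x hx) (hf.1.2 x hx)).symm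
    have huniv : θ P.univVar = places w u P.univVar :=
      (h _ hu (by rw [hf.1.1])).symm
    refine ⟨ρ, hρ, hR, u, hun, hf.congr huniv hvars, ?_, ?_⟩
    · rw [h₁, List.map_congr_left fun x hx => hvars x ((P.wellFormed ρ hρ).safe x hx)]
    · rw [h₂]
      cases hc : P.recCall ρ with
      | none => rfl
      | some c =>
        rw [Option.map_some, Option.map_some, List.map_congr_left fun x hx =>
          hvars x (Rule.mem_vars_rel (hrec ρ hρ c hc) hx)]

theorem exists_var_bound (P : Program A) :
    ∃ K, (∀ ρ ∈ P.rules, ∀ x ∈ ρ.vars, x ≤ K) ∧ P.univVar ≤ K ∧ ∀ R, P.ar R ≤ K := by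
  have := P.finiteRel
  have hfin : (⋃ ρ ∈ (P.rules : Set (Rule A P.Rel)), ρ.vars).Finite :=
    P.rules.finite_toSet.biUnion fun ρ _ => ρ.vars_finite
  obtain ⟨a, ha⟩ := hfin.bddAbove
  obtain ⟨b, hb⟩ := (Set.finite_range P.ar).bddAbove
  refine ⟨max a (max P.univVar b), fun ρ hρ x hx => ?_,
    (le_max_left _ _).trans (le_max_right _ _), fun R => ?_⟩
  · exact (ha (Set.mem_biUnion (t := fun ρ : Rule A P.Rel => ρ.vars) hρ hx)).trans (le_max_left _ _)
  · exact (hb ⟨R, rfl⟩).trans ((le_max_right _ _).trans (le_max_right _ _))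

/-- Induction over the components of the dependency graph; inside a component, membership is
reachability along a partial function on facts, which `Dec.dtc` decides. -/
theorem decFacts (hP : P ∈ deterministicLinear A) (R : P.Rel) : DecFacts e P R := by
  have := P.finiteRel
  have : Nonempty P.Rel := ⟨R⟩
  obtain ⟨K, hK, hu, har⟩ := exists_var_bound P
  obtain ⟨r, ⟨E⟩⟩ := Finite.exists_equiv_fin P.Rel
  -- A relation symbol is coded by its characteristic vector. `D` inverts this coding and decodes
  -- the remaining vectors arbitrarily.
  have hinj : Function.Injective fun (R : P.Rel) (i : Fin r) => decide (E R = i) := by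
    intro R₁ R₂ h
    have := congrFun h (E R₁)
    simpa [eq_comm] using this
  set D : (Fin r → Bool) → P.Rel := Function.invFun fun (R : P.Rel) (i : Fin r) => decide (E R = i)
  have hD : Function.Surjective D := Function.invFun_surjective hinj
  induction R using (strictlyBelow_wellFounded P).induction with
  | _ R ih =>
    intro κ p q
    have hdtc := Dec.dtc (e := e) (enc := encFact (K := K) D)
      (step := fun w x y => P.Leads (P.component R) w x (some y))
      (term := fun w x => P.Leads (P.component R) w x none)
      (dec_leads hP.1 ih hK hu Sum.inl (some Sum.inr)) (dec_leads hP.1 ih hK hu id none)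
      (fun w x y y' h h' => Option.some_injective _ (h.unique hP h'))
      (fun w hw x y h => by
        obtain ⟨ρ, hρ, -, θ, hf, -, h⟩ := h
        obtain ⟨c, hc, rfl⟩ := Option.map_eq_some_iff.1 h.symm
        have hφ := ((recCall_eq_some hP.1 hρ (R := c.1) (ys := c.2)).1 hc).1
        have hlen : c.2.length = P.ar c.1 := (P.wellFormed ρ hρ).body_arity _ hφ
        refine exists_encFact hD hw (by simpa using hlen) (har _) fun u hu => ?_
        obtain ⟨x, hx, rfl⟩ := List.mem_map.1 hu
        exact hf.1.2 x (Rule.mem_vars_rel hφ hx))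
    -- The fact in question is given by positions `p` and `q` for its arguments; a code of it is
    -- found by search and handed to the reachability test.
    refine (Dec.ex ((dec_encFact_eq (D := D) (Sum.inr : Fin r ⊕ Fin (K + 1) × Bool → _) R
      (fun j => .inl (p j))
      (fun j => .inl (q j))).and (hdtc.comp .inr))).congr fun w hw v hv => ?_
    have hiff := fun t => mem_facts_iff (w := w) hP.1 component_closed
      (x := (R, t)) (show R ∈ P.component R from .inl rfl)
    constructor
    · rintro ⟨u, -, h₁, h₂⟩
      rw [hiff]
      simpa only [h₁, Sum.elim_inl] using h₂
    · intro h
      obtain ⟨u, hu, hu'⟩ := exists_encFact (K := K) hD hw (R := R)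
        (t := (List.range (P.ar R)).map fun j => seg w (v (p j)) (v (q j))) (by simp)
        (har _) (fun u hu => by
          obtain ⟨j, -, rfl⟩ := List.mem_map.1 hu
          exact seg_infix _ _ _)
      refine ⟨u, hu, hu', ?_⟩
      rw [hiff] at h
      simpa only [Sum.elim_comp_inr, hu'] using h

/-- For a Boolean program the output fact has no arguments, so the positions supplied to `decFacts`
are dummies; the empty word is treated separately by `guardEmpty`. -/
theorem counterDecidable_language (hP : P ∈ deterministicLinear A) (hB : P.IsBoolean) :
    CounterDecidable e P.language := by
  obtain ⟨p, hp⟩ := decFacts (e := e) hP P.Ans Unit (fun _ => ()) (fun _ => ()) (fun _ => 0) 1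
    (by simp)
  refine .of_nat _ _ (guardEmpty 0 p) (exists_run_guardEmpty (f₀ := (false, false))
    (acc := {f | f.1 = true}) (B := fun n => n) 0 fun w hw => ?_)
  obtain ⟨f', v', h, -, -, hf⟩ := hp w hw (false, false) (fun _ => 0) (by simp)
  refine ⟨_, h, hf.trans ?_⟩
  rw [show P.ar P.Ans = 0 from hB]
  rfl

end Evaluation

end Logspace

/-- Deterministic linear FC-Datalog captures LOGSPACE. -/
theorem mainTheorem4 (A : Type u) [Finite A] :
    FCDatalog.Captures (FCDatalog.deterministicLinear A) (SpaceComplexity.LOGSPACE A) := by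
  obtain ⟨m, ⟨e⟩⟩ := Finite.exists_equiv_fin A
  ext L
  constructor
  · intro hL
    exact (Logspace.counterDecidable_of_mem_logspace e hL).exists_datalog
  · rintro ⟨P, hP, hB, rfl⟩
    exact (Logspace.counterDecidable_language (e := e) hP hB).mem_logspace
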